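/- Let $L/K$ be a cyclic extension of number fields, i.e. a Galois extension whose Galois group is cyclic. Let $\mathbb I_K=\mathbb A_K^*$ and $\mathbb I_L=\mathbb A_L^*$ be the idele groups, regard $K^*$ as a subgroup of $\mathbb I_K$ by the diagonal embedding, and let $N:\mathbb I_L\to\mathbb I_K$ be the idele norm, $N(x)_v=\prod_{w\mid v}N_{L_w/K_v}(x_w)$ for every place $v$ of $K$. Let $N(L^*)\subseteq K^*$ be the group of norms of the field extension $L/K$. Then $N(L^*)\subseteq K^*\cap N(\mathbb I_L)$, the indices $[\mathbb I_K:K^*N(\mathbb I_L)]$ and $[K^*\cap N(\mathbb I_L):N(L^*)]$ are both finite, and $$\frac{[\mathbb I_K:K^*N(\mathbb I_L)]}{[K^*\cap N(\mathbb I_L):N(L^*)]}=[L:K].$$ In particular $[\mathbb I_K:K^*N(\mathbb I_L)]\ge [L:K]$. -/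

import Mathlib

open NumberField IsDedekindDomain

noncomputable section

namespace NormIndex

variable (K L : Type*) [Field K] [NumberField K] [Field L] [NumberField L] [Algebra K L]

/-- The idele group of a number field: the unit group of its adele ring. -/
abbrev IdeleGroup (K : Type*) [Field K] [NumberField K] : Type _ := (AdeleRing (𝓞 K) K)ˣ

/-- The diagonal embedding of `Kˣ` into the ideles of `K`. -/
def diagonal (K : Type*) [Field K] [NumberField K] : Kˣ →* IdeleGroup K :=
  Units.map (algebraMap K (AdeleRing (𝓞 K) K)).toMonoidHom

section FinitePlaces

variable (v : HeightOneSpectrum (𝓞 K)) (w : HeightOneSpectrum (𝓞 L))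
  [w.asIdeal.LiesOver v.asIdeal]

/-- For a prime `w` of `L` over a prime `v` of `K`, the continuous extension `K_v → L_w` of the
inclusion of `K` into `L`. -/
def adicCompletionMap : v.adicCompletion K →+* w.adicCompletion L :=
  ((HeightOneSpectrum.adicCompletion.equiv L w).symm.toRingHom.comp
    (UniformSpace.Completion.mapRingHom
      (algebraMap (WithVal (v.valuation K)) (WithVal (w.valuation L)))
      (HeightOneSpectrum.uniformContinuous_algebraMap_liesOver K L v w).continuous)).comp
    (HeightOneSpectrum.adicCompletion.equiv K v).toRingHom

theorem continuous_adicCompletionMap : Continuous (adicCompletionMap K L v w) :=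
  (HeightOneSpectrum.adicCompletion.continuous_ofCompletion L w).comp <|
    UniformSpace.Completion.continuous_map.comp
      (HeightOneSpectrum.adicCompletion.continuous_toCompletion K v)

theorem adicCompletionMap_algebraMap (x : K) :
    adicCompletionMap K L v w (algebraMap K (v.adicCompletion K) x) =
      algebraMap L (w.adicCompletion L) (algebraMap K L x) := by
  apply HeightOneSpectrum.adicCompletion.ext
  exact UniformSpace.Completion.mapRingHom_coe
    (HeightOneSpectrum.uniformContinuous_algebraMap_liesOver K L v w).continuous _

/-- The local norm `N_{L_w/K_v} : L_w → K_v` at a finite place. -/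
def finiteLocalNorm : w.adicCompletion L →* v.adicCompletion K :=
  letI : Algebra (v.adicCompletion K) (w.adicCompletion L) := (adicCompletionMap K L v w).toAlgebra
  Algebra.norm (v.adicCompletion K)

open scoped Valued in
theorem continuous_finiteLocalNorm : Continuous (finiteLocalNorm K L v w) := by
  let : Algebra (v.adicCompletion K) (w.adicCompletion L) := (adicCompletionMap K L v w).toAlgebra
  have : ContinuousSMul (v.adicCompletion K) (w.adicCompletion L) :=
    ⟨((continuous_adicCompletionMap K L v w).comp continuous_fst).mul continuous_snd⟩
  have : IsScalarTower K (v.adicCompletion K) (w.adicCompletion L) :=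
    .of_algebraMap_eq fun x ↦ by
      rw [RingHom.algebraMap_toAlgebra, adicCompletionMap_algebraMap]
      exact IsScalarTower.algebraMap_apply K L (w.adicCompletion L) x
  let b := Module.finBasis (v.adicCompletion K) (w.adicCompletion L)
  have h : ∀ x, finiteLocalNorm K L v w x = (Algebra.leftMulMatrix b x).det :=
    fun x ↦ Algebra.norm_eq_matrix_det b x
  rw [show (finiteLocalNorm K L v w : _ → _) = _ from funext h]
  exact Continuous.matrix_det
    (LinearMap.continuous_of_finiteDimensional (Algebra.leftMulMatrix b).toLinearMap)

theorem finiteLocalNorm_mem_integers {x : w.adicCompletion L}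
    (hx : x ∈ w.adicCompletionIntegers L) :
    finiteLocalNorm K L v w x ∈ v.adicCompletionIntegers K := by
  set N := finiteLocalNorm K L v w
  have h0 : N 0 ∈ v.adicCompletionIntegers K := by
    have h : N 0 * N 0 = N 0 := by rw [← map_mul, mul_zero]
    by_cases h' : N 0 = 0
    · rw [h']; exact zero_mem _
    · rw [mul_right_cancel₀ h' (h.trans (one_mul _).symm)]; exact one_mem _
  have hnhds : N ⁻¹' (v.adicCompletionIntegers K : Set (v.adicCompletion K)) ∈
      nhds (0 : w.adicCompletion L) :=
    (continuous_finiteLocalNorm K L v w).continuousAt.preimage_mem_nhds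
      ((Valued.isOpen_valuationSubring (v.adicCompletion K)).mem_nhds h0)
  obtain ⟨γ, hγ⟩ := Valued.mem_nhds_zero.1 hnhds
  set δ := MonoidWithZeroHom.ValueGroup₀.embedding γ.1 with hδ
  have hδ0 : δ ≠ 0 := by simp [hδ]
  obtain ⟨c, hc⟩ := HeightOneSpectrum.valuedAdicCompletion_surjective L w
    (δ * WithZero.exp (-1 : ℤ))
  have hcδ : Valued.v c < δ := by
    rw [hc]
    exact mul_lt_of_lt_one_right (zero_lt_iff.2 hδ0) (WithZero.exp_lt_exp.2 (by norm_num : (-1 : ℤ) < 0))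
  have hc0 : c ≠ 0 := by
    rintro rfl
    simp [hδ0] at hc
  have hNc : Valued.v (N c) ≠ 0 := by
    rw [Valuation.ne_zero_iff]
    exact ((IsUnit.mk0 c hc0).map N).ne_zero
  have hpow (n : ℕ) : Valued.v (N c) * Valued.v (N x) ^ n ≤ 1 := by
    have hmem : c * x ^ n ∈ N ⁻¹' (v.adicCompletionIntegers K : Set (v.adicCompletion K)) := by
      apply hγ
      rw [Set.mem_ofPred_eq, Valuation.restrict_lt_iff_lt_embedding, map_mul, map_pow]
      exact (mul_le_of_le_one_right' (pow_le_one' hx n)).trans_lt hcδ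
    simpa [HeightOneSpectrum.mem_adicCompletionIntegers] using hmem
  rw [HeightOneSpectrum.mem_adicCompletionIntegers]
  by_contra! hlt
  obtain ⟨n, hn⟩ := MulArchimedean.arch ((Valued.v (N c))⁻¹ * Valued.v (N x)) hlt
  have h1 : Valued.v (N x) ≤ Valued.v (N c) * Valued.v (N x) ^ n := by
    calc Valued.v (N x) = Valued.v (N c) * ((Valued.v (N c))⁻¹ * Valued.v (N x)) := by
          rw [mul_inv_cancel_left₀ hNc]
      _ ≤ _ := by gcongr
  exact absurd (h1.trans (hpow n)) (not_le.2 hlt)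

/-- The primes of `L` lying over a prime of `K`. -/
abbrev PrimesOver : Type _ := {w : HeightOneSpectrum (𝓞 L) // w.asIdeal.LiesOver v.asIdeal}

instance : Finite (PrimesOver K L v) := by
  have := v.isMaximal
  exact Finite.of_injective
    (fun w : PrimesOver K L v ↦ (⟨w.1.asIdeal, w.1.isPrime, w.2⟩ : v.asIdeal.primesOver (𝓞 L)))
    fun w w' h ↦ Subtype.ext (HeightOneSpectrum.ext (congrArg Subtype.val h))

instance : Fintype (PrimesOver K L v) := Fintype.ofFinite _

/-- The `v`-component of the norm of a finite adele `x` of `L`: the product of the local norms of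
the `x_w` over all primes `w` of `L` over `v`. -/
def finiteNormAt (x : FiniteAdeleRing (𝓞 L) L) : v.adicCompletion K :=
  ∏ w : PrimesOver K L v,
    haveI := w.2
    finiteLocalNorm K L v w.1 (x w.1)

end FinitePlaces

theorem finiteNormAt_mem (x : FiniteAdeleRing (𝓞 L) L) :
    ∀ᶠ v : HeightOneSpectrum (𝓞 K) in Filter.cofinite,
      finiteNormAt K L v x ∈ v.adicCompletionIntegers K := by
  have hx : {w : HeightOneSpectrum (𝓞 L) | ¬ x w ∈ w.adicCompletionIntegers L}.Finite := x.2
  refine Set.Finite.subset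
    (hx.biUnion (t := fun w ↦ {v | w.asIdeal.LiesOver v.asIdeal}) fun w _ ↦ ?_) ?_
  · refine Set.Subsingleton.finite fun v hv v' hv' ↦ HeightOneSpectrum.ext ?_
    rw [hv.over, hv'.over]
  · intro v hv
    by_contra h
    refine hv (show ∏ w : PrimesOver K L v, _ ∈ v.adicCompletionIntegers K from
      prod_mem fun w _ ↦ ?_)
    have := w.2
    refine finiteLocalNorm_mem_integers K L v w.1 (not_not.1 fun hw ↦ h ?_)
    exact Set.mem_biUnion hw w.2

/-- The norm on finite adeles. -/
def finiteAdeleNorm : FiniteAdeleRing (𝓞 L) L →* FiniteAdeleRing (𝓞 K) K where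
  toFun x := ⟨fun v ↦ finiteNormAt K L v x, finiteNormAt_mem K L x⟩
  map_one' := FiniteAdeleRing.ext K fun v ↦
    Finset.prod_eq_one fun (w : PrimesOver K L v) _ ↦
      haveI := w.2; map_one (finiteLocalNorm K L v w.1)
  map_mul' x y := FiniteAdeleRing.ext K fun v ↦
    (Finset.prod_congr rfl fun (w : PrimesOver K L v) _ ↦
      haveI := w.2; map_mul (finiteLocalNorm K L v w.1) (x w.1) (y w.1)).trans
    Finset.prod_mul_distrib

section InfinitePlaces

open scoped NumberField.LiesOver

/-- The local norm `N_{L_w/K_v} : L_w → K_v` at an infinite place. -/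
def infiniteLocalNorm (v : InfinitePlace K) (w : InfinitePlace L) [w.LiesOver v] :
    w.Completion →* v.Completion :=
  Algebra.norm v.Completion

open scoped Classical in
/-- The norm on infinite adeles: the `v`-component is the product of the local norms over all
infinite places `w` of `L` over `v`. -/
def infiniteAdeleNorm : InfiniteAdeleRing L →* InfiniteAdeleRing K where
  toFun x v := ∏ w : {w : InfinitePlace L // w.LiesOver v},
    haveI := w.2
    infiniteLocalNorm K L v w.1 (x w.1)
  map_one' := funext fun v ↦
    Finset.prod_eq_one fun (w : {w : InfinitePlace L // w.LiesOver v}) _ ↦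
      haveI := w.2; map_one (infiniteLocalNorm K L v w.1)
  map_mul' x y := funext fun v ↦
    (Finset.prod_congr rfl fun (w : {w : InfinitePlace L // w.LiesOver v}) _ ↦
      haveI := w.2; map_mul (infiniteLocalNorm K L v w.1) (x w.1) (y w.1)).trans
    Finset.prod_mul_distrib

end InfinitePlaces

/-- The norm on adeles, defined component by component through the local norms. -/
def adeleNorm : AdeleRing (𝓞 L) L →* AdeleRing (𝓞 K) K :=
  (infiniteAdeleNorm K L).prodMap (finiteAdeleNorm K L)

/-- The idele norm `N : I_L → I_K`. -/
def ideleNorm : IdeleGroup L →* IdeleGroup K := Units.map (adeleNorm K L)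

/-- `K^*`, as a subgroup of the ideles of `K`. -/
def principalIdeles (K : Type*) [Field K] [NumberField K] : Subgroup (IdeleGroup K) :=
  (diagonal K).range

/-- `N(I_L)`, as a subgroup of the ideles of `K`. -/
def ideleNormSubgroup : Subgroup (IdeleGroup K) := (ideleNorm K L).range

/-- `N(L^*)`, as a subgroup of the ideles of `K`; here `N` is the norm of the field extension
`L/K`. -/
def fieldNormSubgroup : Subgroup (IdeleGroup K) :=
  ((Units.map (Algebra.norm K : L →* K)).range).map (diagonal K)

end NormIndex

end

/-! Let `n = [L:K]`, let `σ` generate the Galois group, and for a Galois module `M` written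
multiplicatively let `D x = σ x / x` and `N x = x · σ x ⋯ σ^(n-1) x`. The Herbrand quotient is `q(M)
= [ker D : im N] / [ker N : im D]`. The theorem amounts to `q(C_L) = n` for the idele class group
`C_L` (`herbrandQuot_classAct`), once the two indices are translated to `K`.

Translation. The inclusion `I_K → I_L` (`conorm`) identifies `I_K` with the fixed ideles and carries
the idele norm to `N` (`exists_conorm_of_fixed`, `conorm_ideleNorm`). By Hilbert 90 for `L^*` a
fixed class in `C_L` is represented by a fixed idele, so the numerator is `[I_K : K^* N(I_L)]`
(`relIndex_range_cycNorm_classAct`). By Hilbert 90 for ideles (`hOneTrivial_ideleAct`) the kernel of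
the idele norm is `im D`, which turns the denominator into `[K^* ∩ N(I_L) : N(L^*)]`
(`relIndex_range_cycDiff_classAct`).

Computation. `q` is multiplicative in short exact sequences and equals `1` on finite modules, so it
may be computed up to finite kernels and cokernels. Let `U` be the group of ideles that are units at
every finite place. Finiteness of the class group makes the image of `U` in `C_L` of finite index,
and the kernel is the group `E` of global units; hence `q(C_L) = q(U) / q(E)`. It is not necessary
to enlarge the set of places until the class group dies.

For `q(U)`, group the places of `L` by the place `v` of `K` below and treat the product of the
completions over `v` as one algebra `A` on which `σ` acts, in place of decomposition groups and
Shapiro's lemma. At a finite `v` a normal basis spans a free lattice, the units congruent to `1`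
modulo a small such lattice are cohomologically trivial by successive approximation, and they have
finite index by compactness (`exists_trivial_latticeUnits`); so the contribution is `1`. Since there
are infinitely many factors, this has to be strengthened at almost all `v` to triviality of the
whole unit group, which comes from Hilbert 90 over the residue fields
(`herbrandQuot_pi_localInt_units`). At an infinite `v` the contribution is the local degree `n_v`,
that is `1` or `2`.

For `q(E)`, a Minkowski-type family of units permuted like the infinite places gives an equivariant
map from the integral functions on the infinite places of `L` to `E`. By Dirichlet's theorem its
image has finite index and its kernel is infinite cyclic with trivial action. The source has
quotient `∏ n_v` and the kernel has quotient `n`, so `q(E) = (∏ n_v) / n` (`herbrandQuot_units`).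
The factors `n_v` cancel and `q(C_L) = n`. -/

open NumberField IsDedekindDomain

noncomputable section

namespace NormIndex

/-! ### Herbrand quotients of pairs of endomorphisms. -/

section Herbrand

open Subgroup

/-- A pair of endomorphisms `f`, `g` of a commutative group has Herbrand quotient `q` if the
indices `[ker f : im g]` and `[ker g : im f]` are finite with quotient `q`. -/
structure HasHerbrand {M : Type*} [CommGroup M] (f g : M →* M) (q : ℚ) : Prop where
  ne_zero_left : g.range.relIndex f.ker ≠ 0
  ne_zero_right : f.range.relIndex g.ker ≠ 0
  div_eq : (g.range.relIndex f.ker : ℚ) / (f.range.relIndex g.ker : ℚ) = q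

variable {A B C : Type*} [CommGroup A] [CommGroup B] [CommGroup C]

theorem HasHerbrand.ne_zero {f g : A →* A} {q : ℚ} (h : HasHerbrand f g q) : q ≠ 0 := by
  rw [← h.div_eq]
  exact div_ne_zero (Nat.cast_ne_zero.2 h.ne_zero_left) (Nat.cast_ne_zero.2 h.ne_zero_right)

/-- Counting: `|ker f| · |im f| = |A| = |ker g| · |im g|`, so the two indices agree. -/
theorem HasHerbrand.of_finite [Finite A] {f g : A →* A} (hfg : f.comp g = 1)
    (hgf : g.comp f = 1) : HasHerbrand f g 1 := by
  have hle : ∀ {f g : A →* A}, f.comp g = 1 → g.range ≤ f.ker := by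
    rintro f g h _ ⟨x, rfl⟩
    exact DFunLike.congr_fun h x
  have key : ∀ {f g : A →* A}, f.comp g = 1 →
      Nat.card g.range * g.range.relIndex f.ker = Nat.card f.ker := by
    intro f g h
    have := (g.range.subgroupOf f.ker).card_mul_index
    rwa [Nat.card_congr (Subgroup.subgroupOfEquivOfLe (hle h)).toEquiv] at this
  have hrk : ∀ f : A →* A, Nat.card f.ker * Nat.card f.range = Nat.card A := by
    intro f
    rw [← Subgroup.index_ker]
    exact f.ker.card_mul_index
  have h1 := key hfg
  have h2 := key hgf
  have h3 := hrk f
  have h4 := hrk g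
  have pos : ∀ H : Subgroup A, 0 < Nat.card H := fun H ↦ Nat.card_pos
  have hne : ∀ H K : Subgroup A, H.relIndex K ≠ 0 := fun H K ↦ Subgroup.index_ne_zero_of_finite
  refine ⟨hne _ _, hne _ _, ?_⟩
  rw [div_eq_one_iff_eq (Nat.cast_ne_zero.2 (hne _ _)), Nat.cast_inj]
  have e : Nat.card g.range * Nat.card f.range * g.range.relIndex f.ker =
      Nat.card g.range * Nat.card f.range * f.range.relIndex g.ker := by
    calc _ = (Nat.card g.range * g.range.relIndex f.ker) * Nat.card f.range := by ring
      _ = Nat.card A := by rw [h1, h3]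
      _ = Nat.card g.ker * Nat.card g.range := h4.symm
      _ = _ := by rw [← h2]; ring
  exact Nat.eq_of_mul_eq_mul_left (Nat.mul_pos (pos _) (pos _)) e

/-- The index `[ker f_C : im g_C]` of a quotient, factored inside the middle group. -/
theorem relIndex_quotient {fB gB : B →* B} {fC gC : C →* C} {p : B →* C}
    (hp : Function.Surjective p) (hf : p.comp fB = fC.comp p) (hg : p.comp gB = gC.comp p)
    (hfg : fB.comp gB = 1) :
    gC.range.relIndex fC.ker =
      (p.ker ⊓ fB.ker ⊔ gB.range).relIndex fB.ker *
        (p.ker.map fB).relIndex (p.ker ⊓ fB.range) := by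
  have hgB : gB.range ≤ fB.ker := by
    rintro _ ⟨x, rfl⟩
    exact DFunLike.congr_fun hfg x
  have h1 : fC.ker = (p.ker.comap fB).map p := by
    ext c
    constructor
    · intro hc
      obtain ⟨b, rfl⟩ := hp c
      exact ⟨b, (DFunLike.congr_fun hf b).trans hc, rfl⟩
    · rintro ⟨b, hb, rfl⟩
      exact (DFunLike.congr_fun hf b).symm.trans hb
  have h2 : gC.range = (gB.range).map p := by
    rw [MonoidHom.map_range, hg, ← MonoidHom.map_range, MonoidHom.range_eq_top.2 hp,
      MonoidHom.range_eq_map]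
  have hle : p.ker ⊔ gB.range ⊔ fB.ker ≤ p.ker.comap fB ⊔ p.ker ⊔ fB.ker := by
    refine sup_le (sup_le ?_ (hgB.trans le_sup_right)) le_sup_right
    exact le_sup_right.trans le_sup_left
  have h3 : p.ker ≤ p.ker.comap fB := by
    intro b hb
    change p (fB b) = 1
    have := DFunLike.congr_fun hf b
    simp only [MonoidHom.comp_apply] at this
    rw [this, show p b = 1 from hb, map_one]
  have h4 : fB.ker ≤ p.ker.comap fB := by
    intro b hb
    change p (fB b) = 1
    rw [show fB b = 1 from hb, map_one]
  rw [h1, h2, Subgroup.relIndex_map_map, sup_eq_left.2 h3]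
  rw [← Subgroup.relIndex_mul_relIndex (gB.range ⊔ p.ker) (gB.range ⊔ p.ker ⊔ fB.ker)
    (p.ker.comap fB) le_sup_left (sup_le (sup_le (hgB.trans h4) h3) h4)]
  congr 1
  · rw [Subgroup.relIndex_sup_left, ← Subgroup.inf_relIndex_right]
    congr 1
    ext x
    constructor
    · rintro ⟨hx, hxf⟩
      obtain ⟨y, hy, z, hz, rfl⟩ := Subgroup.mem_sup.1 hx
      rw [mul_comm]
      refine Subgroup.mul_mem_sup ⟨hz, ?_⟩ hy
      have := fB.ker.mul_mem (fB.ker.inv_mem (hgB hy)) hxf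
      simpa using this
    · intro hx
      obtain ⟨y, ⟨hy, hy'⟩, z, hz, rfl⟩ := Subgroup.mem_sup.1 hx
      refine ⟨?_, fB.ker.mul_mem hy' (hgB hz)⟩
      rw [mul_comm]
      exact Subgroup.mul_mem_sup hz hy
  · have h5 : p.ker ⊓ fB.range = (p.ker.comap fB).map fB := by
      rw [Subgroup.map_comap_eq, inf_comm]
    have h6 : p.ker.map fB = (gB.range ⊔ p.ker).map fB := by
      rw [Subgroup.map_sup, (Subgroup.map_eq_bot_iff _).2 hgB, bot_sup_eq]
    rw [h5, h6, Subgroup.relIndex_map_map, sup_eq_left.2 h4]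

/-- The chain `im gB ≤ (S ∩ ker fB) · im gB ≤ ker fB` splits the index. It is used with `S` the
kernel of the projection to the quotient. -/
theorem relIndex_middle {fB gB : B →* B} (S : Subgroup B) (hfg : fB.comp gB = 1) :
    gB.range.relIndex fB.ker =
      (S ⊓ fB.ker ⊔ gB.range).relIndex fB.ker * (S ⊓ gB.range).relIndex (S ⊓ fB.ker) := by
  have hgB : gB.range ≤ fB.ker := by
    rintro _ ⟨x, rfl⟩
    exact DFunLike.congr_fun hfg x
  rw [← Subgroup.relIndex_mul_relIndex gB.range (S ⊓ fB.ker ⊔ gB.range) fB.ker le_sup_right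
    (sup_le inf_le_right hgB), mul_comm, Subgroup.relIndex_sup_right,
    ← Subgroup.inf_relIndex_right gB.range, inf_left_comm, inf_eq_left.2 hgB]

theorem relIndex_sub {fA gA : A →* A} {fB gB : B →* B} {i : A →* B}
    (hi : Function.Injective i) (hf : i.comp fA = fB.comp i) (hg : i.comp gA = gB.comp i)
    (hfg : fB.comp gB = 1) :
    gA.range.relIndex fA.ker =
      (i.range ⊓ gB.range).relIndex (i.range ⊓ fB.ker) *
        (i.range.map gB).relIndex (i.range ⊓ gB.range) := by
  have hgB : gB.range ≤ fB.ker := by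
    rintro _ ⟨x, rfl⟩
    exact DFunLike.congr_fun hfg x
  have h1 : fA.ker.map i = i.range ⊓ fB.ker := by
    ext b
    constructor
    · rintro ⟨a, ha, rfl⟩
      refine ⟨⟨a, rfl⟩, (DFunLike.congr_fun hf a).symm.trans ?_⟩
      rw [MonoidHom.comp_apply, show fA a = 1 from ha, map_one]
    · rintro ⟨⟨a, rfl⟩, hb⟩
      refine ⟨a, hi ?_, rfl⟩
      rw [map_one]
      exact (DFunLike.congr_fun hf a).trans hb
  have h2 : gA.range.map i = i.range.map gB := by
    rw [MonoidHom.map_range, hg, ← MonoidHom.map_range]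
  rw [← Subgroup.relIndex_map_map_of_injective _ _ hi, h1, h2, mul_comm,
    Subgroup.relIndex_mul_relIndex]
  · refine le_inf ?_ (Subgroup.map_le_range _ _)
    rw [← h2]
    exact Subgroup.map_le_range _ _
  · exact inf_le_inf_left _ hgB

variable {fA gA : A →* A} {fB gB : B →* B} {fC gC : C →* C} {i : A →* B} {p : B →* C}

/-- The six indices of a short exact sequence in terms of six natural numbers. -/
theorem exists_herbrand_factors (hi : Function.Injective i) (hp : Function.Surjective p)
    (hex : p.ker = i.range) (hfi : i.comp fA = fB.comp i) (hgi : i.comp gA = gB.comp i)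
    (hfp : p.comp fB = fC.comp p) (hgp : p.comp gB = gC.comp p)
    (hfg : fB.comp gB = 1) (hgf : gB.comp fB = 1) :
    ∃ a b c a' b' c' : ℕ,
      gC.range.relIndex fC.ker = b * a ∧ fC.range.relIndex gC.ker = b' * a' ∧
      gB.range.relIndex fB.ker = b * c ∧ fB.range.relIndex gB.ker = b' * c' ∧
      gA.range.relIndex fA.ker = c * a' ∧ fA.range.relIndex gA.ker = c' * a := by
  -- With `A` regarded as `ker p` inside `B`: `b = [ker fB : (A ∩ ker fB) im gB]`, `c = [A ∩ ker fB
  -- : A ∩ im gB]` and `a = [A ∩ im fB : fB(A)]`; the primed numbers exchange `f` and `g`. The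
  -- factors `a`, `a'` play the part of the connecting maps of the exact hexagon: they occur for `A`
  -- and for `C` and cancel in the product of the two quotients.
  refine ⟨_, _, _, _, _, _, relIndex_quotient hp hfp hgp hfg, relIndex_quotient hp hgp hfp hgf,
    relIndex_middle _ hfg, relIndex_middle _ hgf, ?_, ?_⟩
  · rw [hex]
    exact relIndex_sub hi hfi hgi hfg
  · rw [hex]
    exact relIndex_sub hi hgi hfi hgf

theorem hasHerbrand_middle (hi : Function.Injective i) (hp : Function.Surjective p)
    (hex : p.ker = i.range) (hfi : i.comp fA = fB.comp i) (hgi : i.comp gA = gB.comp i)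
    (hfp : p.comp fB = fC.comp p) (hgp : p.comp gB = gC.comp p)
    (hfg : fB.comp gB = 1) (hgf : gB.comp fB = 1) {q r : ℚ} (hA : HasHerbrand fA gA q)
    (hC : HasHerbrand fC gC r) : HasHerbrand fB gB (q * r) := by
  obtain ⟨a, b, c, a', b', c', h1, h2, h3, h4, h5, h6⟩ :=
    exists_herbrand_factors hi hp hex hfi hgi hfp hgp hfg hgf
  obtain ⟨hA0, hA1, rfl⟩ := hA
  obtain ⟨hC0, hC1, rfl⟩ := hC
  rw [h5] at hA0; rw [h6] at hA1; rw [h1] at hC0; rw [h2] at hC1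
  simp only [mul_ne_zero_iff] at hA0 hA1 hC0 hC1
  refine ⟨by rw [h3]; exact mul_ne_zero hC0.1 hA0.1, by rw [h4]; exact mul_ne_zero hC1.1 hA1.1, ?_⟩
  rw [h1, h2, h3, h4, h5, h6]
  have : (a : ℚ) ≠ 0 := mod_cast hA1.2
  have : (a' : ℚ) ≠ 0 := mod_cast hA0.2
  have : (c' : ℚ) ≠ 0 := mod_cast hA1.1
  have : (b' : ℚ) ≠ 0 := mod_cast hC1.1
  push_cast
  field_simp

theorem hasHerbrand_right (hi : Function.Injective i) (hp : Function.Surjective p)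
    (hex : p.ker = i.range) (hfi : i.comp fA = fB.comp i) (hgi : i.comp gA = gB.comp i)
    (hfp : p.comp fB = fC.comp p) (hgp : p.comp gB = gC.comp p)
    (hfg : fB.comp gB = 1) (hgf : gB.comp fB = 1) {q r : ℚ} (hA : HasHerbrand fA gA q)
    (hB : HasHerbrand fB gB r) : HasHerbrand fC gC (r / q) := by
  obtain ⟨a, b, c, a', b', c', h1, h2, h3, h4, h5, h6⟩ :=
    exists_herbrand_factors hi hp hex hfi hgi hfp hgp hfg hgf
  obtain ⟨hA0, hA1, rfl⟩ := hA
  obtain ⟨hC0, hC1, rfl⟩ := hB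
  rw [h5] at hA0; rw [h6] at hA1; rw [h3] at hC0; rw [h4] at hC1
  simp only [mul_ne_zero_iff] at hA0 hA1 hC0 hC1
  refine ⟨by rw [h1]; exact mul_ne_zero hC0.1 hA1.2, by rw [h2]; exact mul_ne_zero hC1.1 hA0.2, ?_⟩
  rw [h1, h2, h3, h4, h5, h6]
  have : (a : ℚ) ≠ 0 := mod_cast hA1.2
  have : (a' : ℚ) ≠ 0 := mod_cast hA0.2
  have : (c' : ℚ) ≠ 0 := mod_cast hA1.1
  have : (c : ℚ) ≠ 0 := mod_cast hA0.1
  have : (b' : ℚ) ≠ 0 := mod_cast hC1.1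
  push_cast
  field_simp

theorem HasHerbrand.pi {ι : Type*} [Fintype ι] {M : ι → Type*} [∀ j, CommGroup (M j)]
    {f g : ∀ j, M j →* M j} {q : ι → ℚ} (h : ∀ j, HasHerbrand (f j) (g j) (q j)) :
    HasHerbrand (MonoidHom.piMap f) (MonoidHom.piMap g) (∏ j, q j) := by
  have key : ∀ f g : ∀ j, M j →* M j,
      (MonoidHom.piMap g).range.relIndex (MonoidHom.piMap f).ker =
        ∏ j, (g j).range.relIndex (f j).ker := by
    intro f g
    let φ : (MonoidHom.piMap f).ker →*
        ∀ j, (f j).ker ⧸ (g j).range.subgroupOf (f j).ker :=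
      MonoidHom.pi fun j ↦ (QuotientGroup.mk' _).comp
        (((Pi.evalMonoidHom M j).comp (MonoidHom.piMap f).ker.subtype).codRestrict (f j).ker
          fun x ↦ congrFun x.2 j)
    have hφ : Function.Surjective φ := by
      intro y
      choose z hz using fun j ↦ QuotientGroup.mk'_surjective _ (y j)
      refine ⟨⟨fun j ↦ (z j : M j), funext fun j ↦ (z j).2⟩, funext fun j ↦ ?_⟩
      exact hz j
    have hker : (MonoidHom.piMap g).range.subgroupOf (MonoidHom.piMap f).ker = φ.ker := by
      ext x
      rw [Subgroup.mem_subgroupOf, MonoidHom.mem_ker, funext_iff]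
      have : ∀ j, φ x j = 1 ↔ ∃ y, g j y = x.1 j := by
        intro j
        refine (QuotientGroup.eq_one_iff _).trans ?_
        exact Iff.rfl
      simp only [Pi.one_apply, this]
      constructor
      · rintro ⟨y, hy⟩ j
        exact ⟨y j, congrFun hy j⟩
      · intro hx
        choose y hy using hx
        exact ⟨y, funext hy⟩
    rw [Subgroup.relIndex, hker, Subgroup.index_ker, MonoidHom.range_eq_top.2 hφ,
      Subgroup.card_top, Nat.card_pi]
    rfl
  refine ⟨?_, ?_, ?_⟩
  · rw [key f g]
    exact Finset.prod_ne_zero_iff.2 fun j _ ↦ (h j).ne_zero_left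
  · rw [key g f]
    exact Finset.prod_ne_zero_iff.2 fun j _ ↦ (h j).ne_zero_right
  · rw [key f g, key g f]
    push_cast
    rw [← Finset.prod_div_distrib]
    exact Finset.prod_congr rfl fun j _ ↦ (h j).div_eq

end Herbrand

/-! ### Modules over a cyclic group, given by one endomorphism of finite order. -/

section CyclicAction

variable {M M' : Type*} [CommGroup M'] [CommGroup M]

/-- The endomorphism `x ↦ s x / x` attached to an endomorphism `s`. -/
def cycDiff (s : M →* M) : M →* M where
  toFun x := s x / x
  map_one' := by simp
  map_mul' x y := by rw [map_mul, mul_div_mul_comm]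

/-- The endomorphism `x ↦ x * s x * ⋯ * s^(n-1) x` attached to an endomorphism `s`. -/
def cycNorm (n : ℕ) (s : M →* M) : M →* M where
  toFun x := ∏ j ∈ Finset.range n, s^[j] x
  map_one' := by simp
  map_mul' x y := by
    rw [← Finset.prod_mul_distrib]
    exact Finset.prod_congr rfl fun j _ ↦ iterate_map_mul s j x y

theorem cycDiff_apply (s : M →* M) (x : M) : cycDiff s x = s x / x := rfl

theorem cycNorm_apply (n : ℕ) (s : M →* M) (x : M) :
    cycNorm n s x = ∏ j ∈ Finset.range n, s^[j] x := rfl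

theorem mem_ker_cycDiff {s : M →* M} {x : M} : x ∈ (cycDiff s).ker ↔ s x = x := by
  rw [MonoidHom.mem_ker, cycDiff_apply, div_eq_one]

theorem map_cycNorm {n : ℕ} {s : M →* M} (hs : ∀ x, s^[n] x = x) (x : M) :
    s (cycNorm n s x) = cycNorm n s x := by
  rw [cycNorm_apply, map_prod]
  have h : ∀ j, s (s^[j] x) = s^[j + 1] x := fun j ↦ (Function.iterate_succ_apply' _ _ _).symm
  simp only [h]
  have h1 := Finset.prod_range_succ (fun j ↦ s^[j] x) n
  rw [Finset.prod_range_succ', hs] at h1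
  exact mul_right_cancel h1

theorem cycDiff_comp_cycNorm {n : ℕ} {s : M →* M} (hs : ∀ x, s^[n] x = x) :
    (cycDiff s).comp (cycNorm n s) = 1 := by
  ext x
  exact div_eq_one.2 (map_cycNorm hs x)

theorem cycNorm_map {n : ℕ} {s : M →* M} (hs : ∀ x, s^[n] x = x) (x : M) :
    cycNorm n s (s x) = cycNorm n s x := by
  rw [← map_cycNorm hs x, cycNorm_apply, cycNorm_apply, map_prod]
  refine Finset.prod_congr rfl fun j _ ↦ ?_
  rw [← Function.iterate_succ_apply, Function.iterate_succ_apply']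

theorem cycNorm_comp_cycDiff {n : ℕ} {s : M →* M} (hs : ∀ x, s^[n] x = x) :
    (cycNorm n s).comp (cycDiff s) = 1 := by
  ext x
  change cycNorm n s (s x / x) = 1
  rw [map_div, cycNorm_map hs, div_self']

theorem comp_cycDiff {s : M →* M} {s' : M' →* M'} {φ : M →* M'} (h : ∀ x, φ (s x) = s' (φ x)) :
    φ.comp (cycDiff s) = (cycDiff s').comp φ := by
  ext x
  change φ (s x / x) = s' (φ x) / φ x
  rw [map_div, h]

theorem map_iterate_of_equivariant {s : M →* M} {s' : M' →* M'} {φ : M →* M'}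
    (h : ∀ x, φ (s x) = s' (φ x)) (j : ℕ) (x : M) : φ (s^[j] x) = s'^[j] (φ x) :=
  (Function.Semiconj.iterate_right (f := φ) h j) x

theorem comp_cycNorm (n : ℕ) {s : M →* M} {s' : M' →* M'} {φ : M →* M'}
    (h : ∀ x, φ (s x) = s' (φ x)) : φ.comp (cycNorm n s) = (cycNorm n s').comp φ := by
  ext x
  change φ (∏ j ∈ Finset.range n, s^[j] x) = ∏ j ∈ Finset.range n, s'^[j] (φ x)
  rw [map_prod]
  exact Finset.prod_congr rfl fun j _ ↦ map_iterate_of_equivariant h j x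

/-- A commutative group with an endomorphism `s`, regarded as a module over the cyclic group of
order `n`, has Herbrand quotient `q`. -/
def HerbrandQuot (n : ℕ) (s : M →* M) (q : ℚ) : Prop := HasHerbrand (cycDiff s) (cycNorm n s) q

/-- The restriction of an endomorphism to a stable subgroup. -/
def restrictEnd (s : M →* M) (H : Subgroup M) (h : ∀ x ∈ H, s x ∈ H) : H →* H :=
  (s.comp H.subtype).codRestrict H fun x ↦ h x x.2

theorem iterate_eq_of_injective {n : ℕ} {s : M →* M} {s' : M' →* M'} {φ : M →* M'}
    (hφ : Function.Injective φ) (h : ∀ x, φ (s x) = s' (φ x)) (hs : ∀ x, s'^[n] x = x) (x : M) :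
    s^[n] x = x :=
  hφ (by rw [map_iterate_of_equivariant h, hs])

theorem iterate_eq_of_surjective {n : ℕ} {s : M →* M} {s' : M' →* M'} {φ : M →* M'}
    (hφ : Function.Surjective φ) (h : ∀ x, φ (s x) = s' (φ x)) (hs : ∀ x, s^[n] x = x) (x : M') :
    s'^[n] x = x := by
  obtain ⟨x, rfl⟩ := hφ x
  rw [← map_iterate_of_equivariant h, hs]

variable {A B C : Type*} [CommGroup A] [CommGroup B] [CommGroup C]

/-- If `A` is the kernel and the range has finite index, then `q(C) = q(B) / q(A)`. -/
theorem HerbrandQuot.of_finiteIndex_range {n : ℕ} {sA : A →* A} {sB : B →* B} {sC : C →* C}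
    {i : A →* B} {φ : B →* C} (hi : Function.Injective i) (hex : φ.ker = i.range)
    [φ.range.FiniteIndex] (hsi : ∀ x, i (sA x) = sB (i x)) (hsφ : ∀ x, φ (sB x) = sC (φ x))
    (hB : ∀ x, sB^[n] x = x) (hC : ∀ x, sC^[n] x = x) {q r : ℚ} (hqA : HerbrandQuot n sA q)
    (hqB : HerbrandQuot n sB r) : HerbrandQuot n sC (r / q) := by
  have hst : ∀ x ∈ φ.range, sC x ∈ φ.range := by
    rintro _ ⟨b, rfl⟩
    exact ⟨sB b, hsφ b⟩
  let sR := restrictEnd sC φ.range hst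
  have hR : HerbrandQuot n sR (r / q) :=
    hasHerbrand_right hi φ.rangeRestrict_surjective (by rw [MonoidHom.ker_rangeRestrict, hex])
      (comp_cycDiff hsi) (comp_cycNorm n hsi)
      (comp_cycDiff (s' := sR) fun x ↦ Subtype.ext (hsφ x))
      (comp_cycNorm n (s' := sR) fun x ↦ Subtype.ext (hsφ x))
      (cycDiff_comp_cycNorm hB) (cycNorm_comp_cycDiff hB) hqA hqB
  let sQ : C ⧸ φ.range →* C ⧸ φ.range := QuotientGroup.map _ _ sC hst
  have hsQ : ∀ x, QuotientGroup.mk' φ.range (sC x) = sQ (QuotientGroup.mk' φ.range x) :=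
    fun x ↦ rfl
  have hQ : ∀ x, sQ^[n] x = x :=
    iterate_eq_of_surjective (QuotientGroup.mk'_surjective φ.range) hsQ hC
  have hq : HerbrandQuot n sQ 1 :=
    HasHerbrand.of_finite (cycDiff_comp_cycNorm hQ) (cycNorm_comp_cycDiff hQ)
  have := hasHerbrand_middle (i := φ.range.subtype) (p := QuotientGroup.mk' φ.range)
    φ.range.subtype_injective
    (QuotientGroup.mk'_surjective _) (by simp) (comp_cycDiff (s := sR) fun x ↦ rfl)
    (comp_cycNorm n (s := sR) fun x ↦ rfl)
    (comp_cycDiff hsQ) (comp_cycNorm n hsQ) (cycDiff_comp_cycNorm hC) (cycNorm_comp_cycDiff hC)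
    hR hq
  rwa [mul_one] at this

theorem HerbrandQuot.of_finiteIndex_subgroup {n : ℕ} {s : M →* M} {H : Subgroup M}
    [H.FiniteIndex] (hst : ∀ x ∈ H, s x ∈ H) (hs : ∀ x, s^[n] x = x) {q : ℚ}
    (hq : HerbrandQuot n (restrictEnd s H hst) q) : HerbrandQuot n s q := by
  -- The inclusion of `H` is a map with trivial kernel and range of finite index, so the previous
  -- result applies with the trivial group as kernel.
  have h1 : HerbrandQuot n (1 : Unit →* Unit) 1 :=
    HasHerbrand.of_finite (MonoidHom.ext fun _ ↦ rfl) (MonoidHom.ext fun _ ↦ rfl)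
  have : H.subtype.range.FiniteIndex := by rwa [Subgroup.range_subtype]
  have := HerbrandQuot.of_finiteIndex_range (i := (1 : Unit →* H)) (φ := H.subtype) (sC := s)
    (fun _ _ _ ↦ rfl) ?_ (fun x ↦ by simp) (fun x ↦ rfl)
    (iterate_eq_of_injective H.subtype_injective (fun x ↦ rfl) hs) hs h1 hq
  · rwa [div_one] at this
  · rw [(MonoidHom.ker_eq_bot_iff _).2 H.subtype_injective]
    ext x
    simp only [Subgroup.mem_bot, MonoidHom.mem_range, MonoidHom.one_apply]
    exact ⟨fun h ↦ ⟨(), h.symm⟩, fun ⟨_, h⟩ ↦ h.symm⟩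

theorem herbrandQuot_prod {n : ℕ} {s : M →* M} {s' : M' →* M'} (hs : ∀ x, s^[n] x = x)
    (hs' : ∀ x, s'^[n] x = x) {q r : ℚ} (h : HerbrandQuot n s q) (h' : HerbrandQuot n s' r) :
    HerbrandQuot n (s.prodMap s') (q * r) := by
  have hit : ∀ x, (s.prodMap s')^[n] x = x := by
    intro x
    have h1 := map_iterate_of_equivariant (s := s.prodMap s') (s' := s)
      (φ := MonoidHom.fst M M') (fun _ ↦ rfl) n x
    have h2 := map_iterate_of_equivariant (s := s.prodMap s') (s' := s')
      (φ := MonoidHom.snd M M') (fun _ ↦ rfl) n x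
    rw [hs] at h1
    rw [hs'] at h2
    exact Prod.ext h1 h2
  have h1 : ∀ x, MonoidHom.inl M M' (s x) = (s.prodMap s') (MonoidHom.inl M M' x) :=
    fun x ↦ Prod.ext rfl (map_one s').symm
  have h2 : ∀ x, MonoidHom.snd M M' ((s.prodMap s') x) = s' (MonoidHom.snd M M' x) :=
    fun x ↦ rfl
  refine hasHerbrand_middle (i := MonoidHom.inl M M') (p := MonoidHom.snd M M')
    (fun x y h ↦ congrArg Prod.fst h) (fun y ↦ ⟨(1, y), rfl⟩) ?_
    (comp_cycDiff h1) (comp_cycNorm n h1) (comp_cycDiff h2) (comp_cycNorm n h2)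
    (cycDiff_comp_cycNorm hit) (cycNorm_comp_cycDiff hit) h h'
  ext ⟨x, y⟩
  constructor
  · intro h
    exact ⟨x, Prod.ext rfl (Eq.symm h)⟩
  · rintro ⟨z, hz⟩
    exact (congrArg Prod.snd hz).symm

theorem HerbrandQuot.pi {n : ℕ} {ι : Type*} [Fintype ι] {M : ι → Type*} [∀ j, CommGroup (M j)]
    {s : ∀ j, M j →* M j} {q : ι → ℚ} (h : ∀ j, HerbrandQuot n (s j) (q j)) :
    HerbrandQuot n (MonoidHom.piMap s) (∏ j, q j) := by
  have h1 : cycDiff (MonoidHom.piMap s) = MonoidHom.piMap fun j ↦ cycDiff (s j) := rfl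
  have h2 : cycNorm n (MonoidHom.piMap s) = MonoidHom.piMap fun j ↦ cycNorm n (s j) := by
    ext x j
    have : ∀ i, (MonoidHom.piMap s)^[i] x j = (s j)^[i] (x j) := fun i ↦
      map_iterate_of_equivariant (s := MonoidHom.piMap s) (s' := s j)
        (φ := Pi.evalMonoidHom M j) (fun _ ↦ rfl) i x
    simp [cycNorm_apply, this]
  rw [HerbrandQuot, h1, h2]
  exact HasHerbrand.pi h

/-- The first cohomology group of the action vanishes: every element of norm one is a
quotient `s y / y`. -/
def HOneTrivial (n : ℕ) (s : M →* M) : Prop := ∀ x, cycNorm n s x = 1 → ∃ y, cycDiff s y = x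

/-- The zeroth Tate cohomology group of the action vanishes: every fixed element is a norm. -/
def HZeroTrivial (n : ℕ) (s : M →* M) : Prop := ∀ x, s x = x → ∃ y, cycNorm n s y = x

theorem relIndex_right_of_hOneTrivial {n : ℕ} {s : M →* M} (h : HOneTrivial n s) :
    (cycDiff s).range.relIndex (cycNorm n s).ker = 1 :=
  Subgroup.relIndex_eq_one.2 fun x hx ↦ h x hx

theorem HerbrandQuot.of_trivial {n : ℕ} {s : M →* M} (h0 : HZeroTrivial n s)
    (h1 : HOneTrivial n s) : HerbrandQuot n s 1 := by
  have h0' : (cycNorm n s).range.relIndex (cycDiff s).ker = 1 :=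
    Subgroup.relIndex_eq_one.2 fun x hx ↦ h0 x (mem_ker_cycDiff.1 hx)
  have hone := relIndex_right_of_hOneTrivial h1
  exact ⟨by simp [h0'], by simp [hone], by simp [h0', hone]⟩

/-- At almost all primes this yields surjectivity of the norm on local units from Hilbert 90 alone,
with no study of norms and traces of residue fields. -/
theorem HerbrandQuot.hZeroTrivial {n : ℕ} {s : M →* M} (h : HerbrandQuot n s 1)
    (h1 : HOneTrivial n s) : HZeroTrivial n s := by
  have h2 := h.div_eq
  rw [relIndex_right_of_hOneTrivial h1, Nat.cast_one, div_one, Nat.cast_eq_one] at h2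
  exact fun x hx ↦ Subgroup.relIndex_eq_one.1 h2 (mem_ker_cycDiff.2 hx)

/-- A function with zero sum on a set permuted transitively by the powers of `e` is a
difference `b ∘ e - b`. -/
theorem exists_sub_eq_of_sum_eq_zero {X R : Type*} [Fintype X] [AddCommGroup R] (e : X → X)
    (he : Function.Bijective e) (htr : ∀ x y, ∃ j : ℕ, e^[j] x = y) (a : X → R)
    (ha : ∑ x, a x = 0) : ∃ b : X → R, ∀ x, a x = b (e x) - b x := by
  classical
  rcases isEmpty_or_nonempty X with hX | ⟨⟨x₀⟩⟩
  · exact ⟨0, fun x ↦ (hX.false x).elim⟩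
  let D : AddSubgroup (X → R) :=
    { carrier := {a | ∃ b : X → R, ∀ x, a x = b (e x) - b x}
      zero_mem' := ⟨0, by simp⟩
      add_mem' := by
        rintro a a' ⟨b, hb⟩ ⟨b', hb'⟩
        exact ⟨b + b', fun x ↦ by simp [hb, hb']; abel⟩
      neg_mem' := by
        rintro a ⟨b, hb⟩
        exact ⟨-b, fun x ↦ by simp [hb]; abel⟩ }
  -- Modulo differences, a point mass may be moved along `e`, hence by transitivity to `x₀`. Every
  -- function is thus equivalent to its total sum placed at `x₀`.
  have hstep : ∀ x r, Pi.single (e x) r - Pi.single x r ∈ D := by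
    intro x r
    refine ⟨-Pi.single (e x) r, fun y ↦ ?_⟩
    have : (Pi.single (e x) r : X → R) (e y) = (Pi.single x r : X → R) y := by
      by_cases h : y = x
      · subst h; simp
      · rw [Pi.single_eq_of_ne h, Pi.single_eq_of_ne (fun h' ↦ h (he.1 h'))]
    simp only [Pi.sub_apply, Pi.neg_apply, this]
    abel
  have hpow : ∀ (j : ℕ) r, Pi.single (e^[j] x₀) r - Pi.single x₀ r ∈ D := by
    intro j r
    induction j with
    | zero => simp [D.zero_mem]
    | succ j ih =>
      rw [Function.iterate_succ_apply']
      have := D.add_mem (hstep (e^[j] x₀) r) ih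
      simpa using this
  have hall : ∀ x r, Pi.single x r - Pi.single x₀ r ∈ D := by
    intro x r
    obtain ⟨j, rfl⟩ := htr x₀ x
    exact hpow j r
  have hsum : a = ∑ x, (Pi.single x (a x) - Pi.single x₀ (a x)) := by
    have h2 : ∑ x, (Pi.single x₀ (a x) : X → R) = 0 := by
      have := map_sum (AddMonoidHom.single (fun _ : X ↦ R) x₀) a Finset.univ
      simp only [AddMonoidHom.single_apply] at this
      rw [← this, ha, Pi.single_zero]
    rw [Finset.sum_sub_distrib, h2, sub_zero, Finset.univ_sum_single]
  have : a ∈ D := by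
    rw [hsum]
    exact D.sum_mem fun x _ ↦ hall x _
  exact this

end CyclicAction

set_option linter.unusedSectionVars false

/-! ### The norm of a finite product of field extensions. -/

section NormPi

theorem det_blockDiagonal'_eq_prod {R ι : Type*} [CommRing R] [Fintype ι] [DecidableEq ι]
    {m : ι → Type*} [∀ w, Fintype (m w)] [∀ w, DecidableEq (m w)]
    (d : ∀ w, Matrix (m w) (m w) R) : (Matrix.blockDiagonal' d).det = ∏ w, (d w).det := by
  -- The order is arbitrary; it only serves to read the block diagonal matrix as block triangular.
  let : LinearOrder ι := LinearOrder.lift' (Fintype.equivFin ι) (Fintype.equivFin ι).injective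
  rw [(Matrix.blockTriangular_blockDiagonal' d).det_fintype]
  refine Finset.prod_congr (Finset.ext fun _ ↦ by simp) fun w _ ↦ ?_
  rw [← Matrix.det_submatrix_equiv_self (Equiv.sigmaSubtype w).symm]
  congr 1
  ext a b
  simp [Matrix.toSquareBlock, Matrix.toSquareBlockProp, Equiv.sigmaSubtype]

theorem norm_pi_apply {k ι : Type*} [Field k] [Fintype ι] {ℓ : ι → Type*} [∀ w, Field (ℓ w)]
    [∀ w, Algebra k (ℓ w)] [∀ w, FiniteDimensional k (ℓ w)] (x : ∀ w, ℓ w) :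
    Algebra.norm k x = ∏ w, Algebra.norm k (x w) := by
  classical
  let b := fun w ↦ Module.finBasis k (ℓ w)
  have : Algebra.leftMulMatrix (Pi.basis b) x =
      Matrix.blockDiagonal' fun w ↦ Algebra.leftMulMatrix (b w) (x w) := by
    ext ⟨w, a⟩ ⟨w', a'⟩
    rw [Algebra.leftMulMatrix_eq_repr_mul, Pi.basis_repr, Pi.basis_apply]
    by_cases h : w = w'
    · subst h
      rw [Matrix.blockDiagonal'_apply_eq, Algebra.leftMulMatrix_eq_repr_mul]
      simp
    · rw [Matrix.blockDiagonal'_apply_ne _ _ _ h]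
      simp [Pi.single_eq_of_ne h]
  rw [Algebra.norm_eq_matrix_det (Pi.basis b), this, det_blockDiagonal'_eq_prod]
  exact Finset.prod_congr rfl fun w _ ↦ (Algebra.norm_eq_matrix_det (b w) _).symm

end NormPi

/-! ### Norm and trace of a cyclic extension as products and sums over powers of the generator. -/

section CyclicGalois

variable {K L : Type*} [Field K] [Field L] [Algebra K L] [FiniteDimensional K L] [IsGalois K L]
  {σ : Gal(L/K)}

theorem orderOf_eq_finrank (hσ : ∀ τ, τ ∈ Subgroup.zpowers σ) :
    orderOf σ = Module.finrank K L := by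
  rw [orderOf_eq_card_of_forall_mem_zpowers hσ, IsGalois.card_aut_eq_finrank]

theorem iterate_eq_pow_apply (σ : Gal(L/K)) (j : ℕ) (x : L) : σ^[j] x = (σ ^ j) x := by
  rw [AlgEquiv.coe_pow]

theorem iterate_finrank (hσ : ∀ τ, τ ∈ Subgroup.zpowers σ) (x : L) :
    σ^[Module.finrank K L] x = x := by
  rw [iterate_eq_pow_apply, ← orderOf_eq_finrank hσ, pow_orderOf_eq_one, AlgEquiv.one_apply]

theorem exists_iterate_eq (hσ : ∀ τ, τ ∈ Subgroup.zpowers σ) (τ : Gal(L/K)) :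
    ∃ j : ℕ, ∀ x, τ x = σ^[j] x := by
  obtain ⟨j, rfl⟩ := mem_powers_iff_mem_zpowers.2 (hσ τ)
  exact ⟨j, fun x ↦ by rw [iterate_eq_pow_apply]⟩

theorem exists_iterate_ne (hσ : ∀ τ, τ ∈ Subgroup.zpowers σ) {j j' : ℕ}
    (hj : j < Module.finrank K L) (hj' : j' < Module.finrank K L) (hne : j ≠ j') :
    ∃ x, σ^[j] x ≠ σ^[j'] x := by
  by_contra! h
  refine hne (pow_injOn_Iio_orderOf (x := σ) ?_ ?_ (AlgEquiv.ext fun x ↦ ?_))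
  · rwa [Set.mem_Iio, orderOf_eq_finrank hσ]
  · rwa [Set.mem_Iio, orderOf_eq_finrank hσ]
  · change (σ ^ j) x = (σ ^ j') x
    rw [← iterate_eq_pow_apply, ← iterate_eq_pow_apply, h]

theorem prod_gal_eq_prod_range {M : Type*} [CommMonoid M] (hσ : ∀ τ, τ ∈ Subgroup.zpowers σ)
    (f : Gal(L/K) → M) : ∏ τ, f τ = ∏ j ∈ Finset.range (Module.finrank K L), f (σ ^ j) := by
  classical
  rw [← IsCyclic.image_range_orderOf hσ, Finset.prod_image, orderOf_eq_finrank hσ]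
  intro i hi j hj h
  exact pow_injOn_Iio_orderOf (by simpa using hi) (by simpa using hj) h

theorem algebraMap_norm_eq_prod_iterate (hσ : ∀ τ, τ ∈ Subgroup.zpowers σ) (x : L) :
    algebraMap K L (Algebra.norm K x) = ∏ j ∈ Finset.range (Module.finrank K L), σ^[j] x := by
  rw [Algebra.norm_eq_prod_automorphisms, prod_gal_eq_prod_range hσ]
  exact Finset.prod_congr rfl fun j _ ↦ (iterate_eq_pow_apply σ j x).symm

theorem algebraMap_trace_eq_sum_iterate (hσ : ∀ τ, τ ∈ Subgroup.zpowers σ) (x : L) :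
    algebraMap K L (Algebra.trace K L x) = ∑ j ∈ Finset.range (Module.finrank K L), σ^[j] x := by
  rw [trace_eq_sum_automorphisms]
  have := prod_gal_eq_prod_range (M := Multiplicative L) hσ
    (fun τ ↦ Multiplicative.ofAdd (τ x))
  rw [← ofAdd_sum, ← ofAdd_sum] at this
  rw [Multiplicative.ofAdd.injective this]
  exact Finset.sum_congr rfl fun j _ ↦ (iterate_eq_pow_apply σ j x).symm

end CyclicGalois

/-! ### Lagrange resolvents. -/

section Resolvent

/-- The Lagrange resolvent used in Hilbert's Theorem 90. -/
def resolvent {A : Type*} [CommRing A] (n : ℕ) (s : A →+* A) (x c : A) : A :=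
  ∑ j ∈ Finset.range n, (∏ i ∈ Finset.range j, s^[i] x) * s^[j] c

/-- Applying `s` and multiplying by `x` moves each summand of the resolvent to the next one; the
summand of index `n` is again the first, because `s` has period `n` and `x` has norm one. -/
theorem mul_map_resolvent {A : Type*} [CommRing A] {n : ℕ} {s : A →+* A}
    (hs : ∀ a, s^[n] a = a) {x : A} (hx : ∏ i ∈ Finset.range n, s^[i] x = 1) (c : A) :
    x * s (resolvent n s x c) = resolvent n s x c := by
  let F : ℕ → A := fun j ↦ (∏ i ∈ Finset.range j, s^[i] x) * s^[j] c
  have h1 : x * s (resolvent n s x c) = ∑ j ∈ Finset.range n, F (j + 1) := by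
    rw [resolvent, map_sum, Finset.mul_sum]
    refine Finset.sum_congr rfl fun j _ ↦ ?_
    simp only [F]
    rw [map_mul, map_prod, Finset.prod_range_succ']
    simp only [Function.iterate_succ_apply', Function.iterate_zero, id_eq]
    ring
  have h2 := Finset.sum_range_succ F n
  rw [Finset.sum_range_succ'] at h2
  have h3 : F n = F 0 := by simp [F, hx, hs]
  rw [h3] at h2
  rw [h1, add_right_cancel h2]
  rfl

end Resolvent

/-! ### Descent for a topological algebra `A` over a complete field `k` in which `L` is dense. -/

section LocalAlgebra

variable {K L : Type*} [Field K] [Field L] [Algebra K L] [FiniteDimensional K L] [IsGalois K L]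
  {σ : Gal(L/K)}
  {k : Type*} [NontriviallyNormedField k] [CompleteSpace k] [Algebra K k]
  {A : Type*} [CommRing A] [Nontrivial A] [TopologicalSpace A] [IsTopologicalRing A] [T2Space A]
  [Algebra k A] [ContinuousSMul k A] [Algebra L A] [Algebra K A] [IsScalarTower K k A]
  [IsScalarTower K L A]

/-- A finite-dimensional subspace over a complete field is closed, and this one contains the dense
image of `L`. -/
theorem span_range_algebraMap_eq_top (hd : DenseRange (algebraMap L A)) {ι : Type*} [Finite ι]
    (b : Module.Basis ι K L) :
    Submodule.span k (Set.range fun i ↦ algebraMap L A (b i)) = ⊤ := by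
  set S := Submodule.span k (Set.range fun i ↦ algebraMap L A (b i))
  have : FiniteDimensional k S := FiniteDimensional.span_of_finite k (Set.finite_range _)
  have hc : IsClosed (S : Set A) := S.closed_of_finiteDimensional
  have hL : Set.range (algebraMap L A) ⊆ S := by
    rintro _ ⟨x, rfl⟩
    have := Fintype.ofFinite ι
    rw [← b.sum_repr x, map_sum]
    refine S.sum_mem fun i _ ↦ ?_
    have : algebraMap L A (b.repr x i • b i) =
        algebraMap K k (b.repr x i) • algebraMap L A (b i) := by
      rw [Algebra.smul_def, Algebra.smul_def, map_mul, ← IsScalarTower.algebraMap_apply,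
        ← IsScalarTower.algebraMap_apply]
    rw [this]
    exact S.smul_mem _ (Submodule.subset_span ⟨i, rfl⟩)
  rw [eq_top_iff]
  intro x _
  have := hc.closure_subset_iff.2 hL (hd x)
  exact this

theorem iterate_algebraMap {s : A →ₐ[k] A}
    (hs : ∀ x, s (algebraMap L A x) = algebraMap L A (σ x)) (j : ℕ) (x : L) :
    s^[j] (algebraMap L A x) = algebraMap L A (σ^[j] x) := by
  induction j generalizing x with
  | zero => rfl
  | succ j ih => rw [Function.iterate_succ_apply, hs, ih, Function.iterate_succ_apply]

theorem iterate_finrank_eq (hσ : ∀ τ, τ ∈ Subgroup.zpowers σ)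
    (hd : DenseRange (algebraMap L A)) {s : A →ₐ[k] A}
    (hs : ∀ x, s (algebraMap L A x) = algebraMap L A (σ x)) (x : A) :
    s^[Module.finrank K L] x = x := by
  have h : (s ^ Module.finrank K L).toLinearMap = LinearMap.id := by
    refine LinearMap.ext_on_range
      (span_range_algebraMap_eq_top (k := k) hd (Module.finBasis K L)) fun i ↦ ?_
    change (s ^ Module.finrank K L) _ = _
    rw [AlgHom.coe_pow, iterate_algebraMap hs, iterate_finrank hσ]
    rfl
  rw [← AlgHom.coe_pow]
  exact DFunLike.congr_fun h x

/-- The sum of the iterates of `s` over one period. -/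
def iterTrace (n : ℕ) (s : A →ₐ[k] A) : A →ₗ[k] A := ∑ j ∈ Finset.range n, (s ^ j).toLinearMap

theorem iterTrace_apply (n : ℕ) (s : A →ₐ[k] A) (x : A) :
    iterTrace n s x = ∑ j ∈ Finset.range n, s^[j] x := by
  simp [iterTrace, LinearMap.sum_apply]

theorem iterTrace_algebraMap (hσ : ∀ τ, τ ∈ Subgroup.zpowers σ) {s : A →ₐ[k] A}
    (hs : ∀ x, s (algebraMap L A x) = algebraMap L A (σ x)) (x : L) :
    iterTrace (Module.finrank K L) s (algebraMap L A x) =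
      algebraMap k A (algebraMap K k (Algebra.trace K L x)) := by
  rw [iterTrace_apply, ← IsScalarTower.algebraMap_apply, IsScalarTower.algebraMap_apply K L A,
    algebraMap_trace_eq_sum_iterate hσ, map_sum]
  exact Finset.sum_congr rfl fun j _ ↦ iterate_algebraMap hs j x

theorem iterTrace_mem_range (hσ : ∀ τ, τ ∈ Subgroup.zpowers σ)
    (hd : DenseRange (algebraMap L A)) {s : A →ₐ[k] A}
    (hs : ∀ x, s (algebraMap L A x) = algebraMap L A (σ x)) (x : A) :
    ∃ a, iterTrace (Module.finrank K L) s x = algebraMap k A a := by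
  have hx : x ∈ Submodule.span k (Set.range fun i ↦ algebraMap L A (Module.finBasis K L i)) := by
    rw [span_range_algebraMap_eq_top (k := k) hd]
    trivial
  induction hx using Submodule.span_induction with
  | mem x h =>
    obtain ⟨i, rfl⟩ := h
    exact ⟨_, iterTrace_algebraMap hσ hs _⟩
  | zero => exact ⟨0, by simp⟩
  | add x y _ _ hx hy =>
    obtain ⟨a, ha⟩ := hx
    obtain ⟨b, hb⟩ := hy
    exact ⟨a + b, by rw [map_add, map_add, ha, hb]⟩
  | smul c x _ hx =>
    obtain ⟨a, ha⟩ := hx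
    exact ⟨c * a, by rw [map_smul, ha, map_mul, Algebra.smul_def]⟩

/-- The fixed elements of `A` are those of the base field. -/
theorem mem_range_of_fixed (hσ : ∀ τ, τ ∈ Subgroup.zpowers σ)
    (hd : DenseRange (algebraMap L A)) {s : A →ₐ[k] A}
    (hs : ∀ x, s (algebraMap L A x) = algebraMap L A (σ x)) {x : A} (hx : s x = x) :
    ∃ a, x = algebraMap k A a := by
  -- If `x` is fixed and `t` has trace one, then the sum of the iterates of `x t` is `x` times the
  -- trace of `t`, that is `x` itself; and such sums lie in `k`.
  obtain ⟨t, ht⟩ := Algebra.trace_surjective K L 1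
  obtain ⟨a, ha⟩ := iterTrace_mem_range (k := k) hσ hd hs (x * algebraMap L A t)
  refine ⟨a, ha ▸ ?_⟩
  rw [iterTrace_apply]
  have h : ∀ j, s^[j] (x * algebraMap L A t) = x * s^[j] (algebraMap L A t) := by
    intro j
    rw [iterate_map_mul, Function.iterate_fixed hx]
  simp only [h]
  rw [← Finset.mul_sum, ← iterTrace_apply, iterTrace_algebraMap hσ hs, ht]
  simp

/-- Multiplying a relation by an element of the trace-dual basis of `L` and summing over the
iterates of `s` isolates one coefficient. Together with the spanning statement this gives `A` the
dimension `[L:K]` without identifying it with a tensor product. -/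
theorem linearIndependent_algebraMap (hσ : ∀ τ, τ ∈ Subgroup.zpowers σ) {s : A →ₐ[k] A}
    (hs : ∀ x, s (algebraMap L A x) = algebraMap L A (σ x)) {ι : Type*} [Finite ι]
    (b : Module.Basis ι K L) : LinearIndependent k fun i ↦ algebraMap L A (b i) := by
  classical
  have := Fintype.ofFinite ι
  rw [Fintype.linearIndependent_iff]
  intro g hg i
  have h1 : iterTrace (Module.finrank K L) s
      (algebraMap L A (b.traceDual i) * ∑ j, g j • algebraMap L A (b j)) = 0 := by
    rw [hg, mul_zero, map_zero]
  rw [Finset.mul_sum, map_sum] at h1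
  have h2 : ∀ j, iterTrace (Module.finrank K L) s
      (algebraMap L A (b.traceDual i) * g j • algebraMap L A (b j)) =
        if j = i then algebraMap k A (g j) else 0 := by
    intro j
    rw [mul_smul_comm, map_smul, ← map_mul, iterTrace_algebraMap hσ hs,
      Module.Basis.trace_traceDual_mul, Algebra.smul_def]
    split_ifs <;> simp
  simp only [h2, Finset.sum_ite_eq', Finset.mem_univ, if_true] at h1
  exact (map_eq_zero_iff _ (algebraMap k A).injective).1 h1

/-- A `K`-basis of `L` as a `k`-basis of `A`. -/
def baseChangeBasis (hσ : ∀ τ, τ ∈ Subgroup.zpowers σ)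
    (hd : DenseRange (algebraMap L A)) {s : A →ₐ[k] A}
    (hs : ∀ x, s (algebraMap L A x) = algebraMap L A (σ x)) {ι : Type*} [Finite ι]
    (b : Module.Basis ι K L) : Module.Basis ι k A :=
  Module.Basis.mk (linearIndependent_algebraMap hσ hs b) (span_range_algebraMap_eq_top hd b).ge

theorem baseChangeBasis_apply (hσ : ∀ τ, τ ∈ Subgroup.zpowers σ)
    (hd : DenseRange (algebraMap L A)) {s : A →ₐ[k] A}
    (hs : ∀ x, s (algebraMap L A x) = algebraMap L A (σ x)) {ι : Type*} [Finite ι]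
    (b : Module.Basis ι K L) (i : ι) :
    baseChangeBasis hσ hd hs b i = algebraMap L A (b i) := by
  simp [baseChangeBasis]

theorem norm_algebraMap_eq (hσ : ∀ τ, τ ∈ Subgroup.zpowers σ)
    (hd : DenseRange (algebraMap L A)) {s : A →ₐ[k] A}
    (hs : ∀ x, s (algebraMap L A x) = algebraMap L A (σ x)) (x : L) :
    Algebra.norm k (algebraMap L A x) = algebraMap K k (Algebra.norm K x) := by
  classical
  let b := Module.finBasis K L
  let B := baseChangeBasis hσ hd hs b
  have h : Algebra.leftMulMatrix B (algebraMap L A x) =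
      (algebraMap K k).mapMatrix (Algebra.leftMulMatrix b x) := by
    ext i j
    rw [Algebra.leftMulMatrix_eq_repr_mul, RingHom.mapMatrix_apply, Matrix.map_apply,
      Algebra.leftMulMatrix_eq_repr_mul, baseChangeBasis_apply, ← map_mul]
    have : algebraMap L A (x * b j) = ∑ i, algebraMap K k (b.repr (x * b j) i) • B i := by
      conv_lhs => rw [← b.sum_repr (x * b j), map_sum]
      refine Finset.sum_congr rfl fun i _ ↦ ?_
      rw [baseChangeBasis_apply, Algebra.smul_def, Algebra.smul_def, map_mul,
        ← IsScalarTower.algebraMap_apply, ← IsScalarTower.algebraMap_apply]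
    rw [this, Module.Basis.repr_sum_self]
  rw [Algebra.norm_eq_matrix_det B, h, ← RingHom.map_det, ← Algebra.norm_eq_matrix_det]

/-- The norm of `A` over the base field is the product of the iterates of `s`. -/
theorem algebraMap_norm_eq_prod (hσ : ∀ τ, τ ∈ Subgroup.zpowers σ)
    (hd : DenseRange (algebraMap L A)) {s : A →ₐ[k] A}
    (hs : ∀ x, s (algebraMap L A x) = algebraMap L A (σ x)) (x : A) :
    algebraMap k A (Algebra.norm k x) = ∏ j ∈ Finset.range (Module.finrank K L), s^[j] x := by
  let B := baseChangeBasis hσ hd hs (Module.finBasis K L)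
  have : FiniteDimensional k A := B.finiteDimensional_of_finite
  have hcs : Continuous s := LinearMap.continuous_of_finiteDimensional s.toLinearMap
  have hcit : ∀ j, Continuous s^[j] := fun j ↦ hcs.iterate j
  have hck : Continuous (algebraMap k A) := continuous_algebraMap k A
  have hcN : Continuous fun x : A ↦ Algebra.norm k x := by
    have : (fun x : A ↦ Algebra.norm k x) = fun x ↦ (Algebra.leftMulMatrix B x).det :=
      funext fun x ↦ Algebra.norm_eq_matrix_det B x
    rw [this]
    exact Continuous.matrix_det
      (LinearMap.continuous_of_finiteDimensional (Algebra.leftMulMatrix B).toLinearMap)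
  -- Both sides are continuous in `x`, and on the dense image of `L` they agree by the global
  -- formula.
  refine congrFun (hd.equalizer (hck.comp hcN) (continuous_finsetProd _ fun j _ ↦ hcit j)
    (funext fun y ↦ ?_)) x
  simp only [Function.comp_apply]
  rw [norm_algebraMap_eq hσ hd hs, ← IsScalarTower.algebraMap_apply,
    IsScalarTower.algebraMap_apply K L A, algebraMap_norm_eq_prod_iterate hσ, map_prod]
  exact Finset.prod_congr rfl fun j _ ↦ (iterate_algebraMap hs j y).symm

end LocalAlgebra

/-! ### Independence of characters and propagation along a transitive map. -/

section HilbertNinety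

/-- Dedekind's independence of characters. It produces an argument at which a Lagrange resolvent
does not vanish. -/
theorem exists_sum_mul_ne_zero {G F : Type*} [Monoid G] [Field F] {n : ℕ} (hn : 0 < n)
    (χ : ℕ → G →* F) (hχ : Set.InjOn χ (Set.Iio n)) (a : ℕ → F) (ha : a 0 ≠ 0) :
    ∃ c, ∑ j ∈ Finset.range n, a j * χ j c ≠ 0 := by
  by_contra! h
  have hli : LinearIndependent F fun j : Fin n ↦ (χ j : G → F) :=
    (linearIndependent_monoidHom G F).comp (fun j : Fin n ↦ χ j)
      fun i j hij ↦ Fin.ext (hχ i.2 j.2 hij)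
  rw [Fintype.linearIndependent_iff] at hli
  refine ha (hli (fun j ↦ a j) (funext fun c ↦ ?_) ⟨0, hn⟩)
  rw [Finset.sum_apply, Pi.zero_apply, ← h c, Finset.sum_range]
  rfl

theorem forall_of_transitive {ι : Type*} {e : ι → ι}
    (htr : ∀ w w', ∃ j : ℕ, e^[j] w = w') {P : ι → Prop} (hP : ∀ w, P w ↔ P (e w)) {w₀ : ι}
    (h₀ : P w₀) (w : ι) : P w := by
  obtain ⟨j, rfl⟩ := htr w₀ w
  induction j with
  | zero => exact h₀
  | succ j ih =>
    rw [Function.iterate_succ_apply']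
    exact (hP _).1 ih

end HilbertNinety

/-! ### Successive approximation in a compact group. -/

section CompactFiltration

/-- Successive approximation along a filtration of a compact group by closed subgroups. -/
theorem exists_map_eq_of_filtration {U : Type*} [CommGroup U] [TopologicalSpace U]
    [IsTopologicalGroup U] [CompactSpace U] (V : ℕ → Subgroup U) (hanti : ∀ j, V (j + 1) ≤ V j)
    (hclosed : ∀ j, IsClosed (V j : Set U)) (hsep : ∀ u, (∀ j, u ∈ V j) → u = 1) (F : U →* U)
    (hF : Continuous F) (Z : Subgroup U)
    (hstep : ∀ j, ∀ x ∈ V j, x ∈ Z → ∃ y ∈ V j, x / F y ∈ V (j + 1) ∧ x / F y ∈ Z)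
    {x : U} (hx : x ∈ V 0) (hxZ : x ∈ Z) : ∃ y ∈ V 0, F y = x := by
  have hanti' : ∀ j, V j ≤ V 0 := fun j ↦ by
    induction j with
    | zero => exact le_rfl
    | succ j ih => exact (hanti j).trans ih
  have hne : ∀ m, ∃ y ∈ V 0, x / F y ∈ V m ∧ x / F y ∈ Z := by
    intro m
    induction m with
    | zero => exact ⟨1, one_mem _, by simpa using ⟨hx, hxZ⟩⟩
    | succ m ih =>
      obtain ⟨y, hy, hym, hyZ⟩ := ih
      obtain ⟨y', hy', h1, h2⟩ := hstep m _ hym hyZ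
      refine ⟨y * y', mul_mem hy (hanti' m hy'), ?_⟩
      rw [map_mul, ← div_div]
      exact ⟨h1, h2⟩
  -- The approximate solutions to precision `m` form a decreasing sequence of nonempty closed sets.
  -- Compactness gives a common point, so no convergent product of the corrections has to be formed.
  -- The subgroup `Z` only serves to keep the error in the domain of `hstep`.
  let t : ℕ → Set U := fun m ↦ {y | y ∈ V 0 ∧ x / F y ∈ V m}
  have htc : ∀ m, IsClosed (t m) := fun m ↦
    (hclosed 0).inter ((hclosed m).preimage (continuous_const.div' hF))
  obtain ⟨y, hy⟩ := IsCompact.nonempty_iInter_of_sequence_nonempty_isCompact_isClosed t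
    (fun m y hy ↦ ⟨hy.1, hanti m hy.2⟩)
    (fun m ↦ (hne m).imp fun y hy ↦ ⟨hy.1, hy.2.1⟩) (htc 0).isCompact htc
  rw [Set.mem_iInter] at hy
  exact ⟨y, (hy 0).1, (div_eq_one.1 (hsep _ fun m ↦ (hy m).2)).symm⟩

end CompactFiltration

/-! ### Lattices on a permuted basis and the units congruent to one modulo them. -/

section Lattice

variable {G : Type*} [Group G] [Fintype G] {σ : G}
  {k : Type*} [NontriviallyNormedField k] [CompleteSpace k] [IsUltrametricDist k]
  {A : Type*} [CommRing A] [TopologicalSpace A] [IsTopologicalRing A] [T2Space A]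
  [Algebra k A] [ContinuousSMul k A]

/-- The lattice of elements with coordinates of norm at most `‖p‖ ^ j`. -/
def lattice (B : Module.Basis G k A) (p : k) (j : ℤ) : AddSubgroup A where
  carrier := {x | ∀ g, ‖B.repr x g‖ ≤ ‖p‖ ^ j}
  zero_mem' g := by simpa using zpow_nonneg (norm_nonneg p) j
  add_mem' {x y} hx hy g := by
    rw [map_add, Finsupp.add_apply]
    exact (IsUltrametricDist.norm_add_le_max _ _).trans (max_le (hx g) (hy g))
  neg_mem' {x} hx g := by
    rw [map_neg, Finsupp.neg_apply, norm_neg]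
    exact hx g

variable {B : Module.Basis G k A} {p : k}

theorem mem_lattice {j : ℤ} {x : A} : x ∈ lattice B p j ↔ ∀ g, ‖B.repr x g‖ ≤ ‖p‖ ^ j := Iff.rfl

theorem smul_mem_lattice {i j : ℤ} {c : k} (hc : ‖c‖ ≤ ‖p‖ ^ i) {x : A} (hp : p ≠ 0)
    (hx : x ∈ lattice B p j) : c • x ∈ lattice B p (i + j) := by
  intro g
  rw [map_smul, Finsupp.smul_apply, norm_smul, zpow_add₀ (norm_ne_zero_iff.2 hp)]
  exact mul_le_mul hc (hx g) (norm_nonneg _) (zpow_nonneg (norm_nonneg p) i)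

theorem lattice_anti (hp0 : p ≠ 0) (hp1 : ‖p‖ < 1) {i j : ℤ} (h : i ≤ j) :
    lattice B p j ≤ lattice B p i := fun _ hx g ↦
  (hx g).trans (zpow_le_zpow_right_of_le_one₀ (norm_pos_iff.2 hp0) hp1.le h)

theorem exists_mem_lattice (hp0 : p ≠ 0) (hp1 : ‖p‖ < 1) (x : A) :
    ∃ m : ℕ, x ∈ lattice B p (-m) := by
  have h : ∀ g, ∃ m : ℕ, ‖B.repr x g‖ ≤ ‖p‖ ^ (-(m : ℤ)) := by
    intro g
    obtain ⟨m, hm⟩ := pow_unbounded_of_one_lt ‖B.repr x g‖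
      ((one_lt_inv₀ (norm_pos_iff.2 hp0)).2 hp1)
    refine ⟨m, hm.le.trans ?_⟩
    rw [zpow_neg, zpow_natCast, inv_pow]
  choose m hm using h
  refine ⟨Finset.univ.sup m, fun g ↦ (hm g).trans ?_⟩
  refine zpow_le_zpow_right_of_le_one₀ (norm_pos_iff.2 hp0) hp1.le ?_
  have := Finset.le_sup (f := m) (Finset.mem_univ g)
  omega

theorem isOpen_lattice (hp0 : p ≠ 0) (j : ℤ) : IsOpen (lattice B p j : Set A) := by
  have : FiniteDimensional k A := B.finiteDimensional_of_finite
  have hB : ∀ g, Continuous fun x ↦ B.repr x g := fun g ↦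
    LinearMap.continuous_of_finiteDimensional (B.coord g)
  have : (lattice B p j : Set A) =
      ⋂ g, (fun x ↦ B.repr x g) ⁻¹' Metric.closedBall 0 (‖p‖ ^ j) := by
    ext x
    simp [mem_lattice]
  rw [this]
  exact isOpen_iInter_of_finite fun g ↦ (IsUltrametricDist.isOpen_closedBall _
    (zpow_ne_zero _ (norm_ne_zero_iff.2 hp0))).preimage (hB g)

/-- Rescaling by powers of `p` moves both factors into the lattice of exponent zero, where closure
under multiplication is assumed. -/
theorem mul_mem_lattice (hp0 : p ≠ 0)
    (hmul : ∀ x ∈ lattice B p 0, ∀ y ∈ lattice B p 0, x * y ∈ lattice B p 0) {i j : ℤ} {x y : A}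
    (hx : x ∈ lattice B p i) (hy : y ∈ lattice B p j) : x * y ∈ lattice B p (i + j) := by
  have hn : ∀ m : ℤ, ‖p ^ m‖ ≤ ‖p‖ ^ m := fun m ↦ (norm_zpow p m).le
  have h1 := smul_mem_lattice (hn (-i)) hp0 hx
  have h2 := smul_mem_lattice (hn (-j)) hp0 hy
  rw [neg_add_cancel] at h1 h2
  have h3 := smul_mem_lattice (hn (i + j)) hp0 (hmul _ h1 _ h2)
  rw [add_zero, smul_mul_smul_comm, smul_smul, ← zpow_add₀ hp0, ← zpow_add₀ hp0] at h3
  have : i + j + (-i + -j) = 0 := by ring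
  rwa [this, zpow_zero, one_smul] at h3

variable {s : A →ₐ[k] A}

theorem repr_map (hB : ∀ g, s (B g) = B (σ * g)) (x : A) (g : G) : B.repr (s x) (σ * g) = B.repr x g := by
  have h : (B.coord (σ * g)).comp s.toLinearMap = B.coord g := by
    refine B.ext fun g' ↦ ?_
    classical
    simp [hB, Finsupp.single_apply]
  exact DFunLike.congr_fun h x

theorem repr_map' (hB : ∀ g, s (B g) = B (σ * g)) (x : A) (g : G) : B.repr (s x) g = B.repr x (σ⁻¹ * g) := by
  rw [← repr_map hB x (σ⁻¹ * g), mul_inv_cancel_left]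

theorem map_mem_lattice (hB : ∀ g, s (B g) = B (σ * g)) {j : ℤ} {x : A} (hx : x ∈ lattice B p j) : s x ∈ lattice B p j := by
  intro g
  rw [repr_map' hB]
  exact hx _

theorem iterate_mem_lattice (hB : ∀ g, s (B g) = B (σ * g)) {j : ℤ} {x : A} (hx : x ∈ lattice B p j) (i : ℕ) :
    s^[i] x ∈ lattice B p j := by
  induction i with
  | zero => exact hx
  | succ i ih =>
    rw [Function.iterate_succ_apply']
    exact map_mem_lattice hB ih

theorem iterate_basis (hB : ∀ g, s (B g) = B (σ * g)) (i : ℕ) (g : G) : s^[i] (B g) = B (σ ^ i * g) := by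
  induction i with
  | zero => simp
  | succ i ih => rw [Function.iterate_succ_apply', ih, hB, pow_succ', mul_assoc]

theorem sum_iterate_basis (hB : ∀ g, s (B g) = B (σ * g)) (hσ : ∀ τ, τ ∈ Subgroup.zpowers σ) (g : G) :
    ∑ i ∈ Finset.range (Nat.card G), s^[i] (B g) = ∑ g, B g := by
  classical
  have h1 : ∑ τ, B (τ * g) = ∑ g, B g :=
    Fintype.sum_equiv (Equiv.mulRight g) _ _ fun _ ↦ rfl
  rw [← h1, ← IsCyclic.image_range_orderOf hσ, Finset.sum_image,
    orderOf_eq_card_of_forall_mem_zpowers hσ]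
  · exact Finset.sum_congr rfl fun i _ ↦ iterate_basis hB i g
  · intro i hi j hj h
    exact pow_injOn_Iio_orderOf (by simpa using hi) (by simpa using hj) h

theorem sum_iterate_eq (hB : ∀ g, s (B g) = B (σ * g)) (hσ : ∀ τ, τ ∈ Subgroup.zpowers σ) (x : A) :
    ∑ i ∈ Finset.range (Nat.card G), s^[i] x = (∑ g, B.repr x g) • ∑ g, B g := by
  have h : ∀ i, s^[i] x = ∑ g, B.repr x g • s^[i] (B g) := by
    intro i
    rw [← AlgHom.coe_pow]
    conv_lhs => rw [← B.sum_repr x, map_sum]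
    simp only [map_smul]
  simp only [h]
  rw [Finset.sum_comm, Finset.sum_smul]
  refine Finset.sum_congr rfl fun g _ ↦ ?_
  rw [← Finset.smul_sum, sum_iterate_basis hB hσ]

/-- The omitted terms are products of at least two of the `c i`, of exponent at least `2 j ≥ j + 1`;
this is where `1 ≤ j` enters. It makes the norm on units congruent to one look additively like a
trace. -/
theorem prod_one_add_sub_mem (hp0 : p ≠ 0) (hp1 : ‖p‖ < 1)
    (hmul : ∀ x ∈ lattice B p 0, ∀ y ∈ lattice B p 0, x * y ∈ lattice B p 0) {j : ℤ} (hj : 1 ≤ j)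
    (c : ℕ → A) (hc : ∀ i, c i ∈ lattice B p j) (m : ℕ) :
    ∏ i ∈ Finset.range m, (1 + c i) - (1 + ∑ i ∈ Finset.range m, c i) ∈ lattice B p (j + 1) := by
  induction m with
  | zero => simp [zero_mem]
  | succ m ih =>
    rw [Finset.prod_range_succ, Finset.sum_range_succ]
    set P := ∏ i ∈ Finset.range m, (1 + c i)
    set S := ∑ i ∈ Finset.range m, c i
    have hS : S ∈ lattice B p j := sum_mem fun i _ ↦ hc i
    have h1 : (P - (1 + S)) * c m ∈ lattice B p (j + 1) :=
      lattice_anti hp0 hp1 (by omega) (mul_mem_lattice hp0 hmul ih (hc m))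
    have h2 : S * c m ∈ lattice B p (j + 1) :=
      lattice_anti hp0 hp1 (by omega) (mul_mem_lattice hp0 hmul hS (hc m))
    have : P * (1 + c m) - (1 + (S + c m)) = (P - (1 + S)) + ((P - (1 + S)) * c m + S * c m) := by
      ring
    rw [this]
    exact add_mem ih (add_mem h1 h2)

/-- With `u = 1 + a` and `v = 1 + z` one has `z = -a - a z`. As `a` has exponent at least one, each
use of this equation improves a bound on `z` by one, starting from whatever lattice happens to
contain `z`. -/
theorem inv_sub_one_mem (hp0 : p ≠ 0) (hp1 : ‖p‖ < 1)
    (hmul : ∀ x ∈ lattice B p 0, ∀ y ∈ lattice B p 0, x * y ∈ lattice B p 0) {j : ℤ} (hj : 1 ≤ j)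
    {u v : A} (huv : u * v = 1) (hu : u - 1 ∈ lattice B p j) : v - 1 ∈ lattice B p j := by
  set a := u - 1
  set z := v - 1
  have hz : z = -a - a * z := by
    have : u * v = (1 + a) * (1 + z) := by ring
    rw [this] at huv
    linear_combination huv
  have key : ∀ t : ℕ, z ∈ lattice B p (-t) → z ∈ lattice B p j := by
    intro t
    induction t with
    | zero =>
      intro h
      rw [hz]
      refine sub_mem (neg_mem hu) ?_
      exact lattice_anti hp0 hp1 (by simp) (mul_mem_lattice hp0 hmul hu h)
    | succ t ih =>
      intro h
      refine ih ?_
      rw [hz]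
      refine sub_mem (neg_mem (lattice_anti hp0 hp1 (by omega) hu)) ?_
      exact lattice_anti hp0 hp1 (by push_cast; omega) (mul_mem_lattice hp0 hmul hu h)
  obtain ⟨m, hm⟩ := exists_mem_lattice (B := B) hp0 hp1 z
  exact key m hm

/-- The group of units of `R` congruent to one modulo a lattice. -/
def latticeUnits (R : Subring A) (hp0 : p ≠ 0) (hp1 : ‖p‖ < 1)
    (hmul : ∀ x ∈ lattice B p 0, ∀ y ∈ lattice B p 0, x * y ∈ lattice B p 0) (j : ℕ) :
    Subgroup Rˣ where
  carrier := {u | ((u : R) : A) - 1 ∈ lattice B p (j + 1)}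
  one_mem' := by simp [zero_mem]
  mul_mem' {u v} hu hv := by
    have : (((u * v : Rˣ) : R) : A) - 1 = (((u : R) : A) - 1) * (((v : R) : A) - 1) +
        ((((u : R) : A) - 1) + (((v : R) : A) - 1)) := by
      push_cast
      ring
    rw [Set.mem_ofPred_eq, this]
    exact add_mem (lattice_anti hp0 hp1 (by omega) (mul_mem_lattice hp0 hmul hu hv))
      (add_mem hu hv)
  inv_mem' {u} hu := by
    refine inv_sub_one_mem hp0 hp1 hmul (by omega) ?_ hu
    rw [← Subring.coe_mul, Units.mul_inv, Subring.coe_one]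

theorem mem_latticeUnits {R : Subring A} {hp0 : p ≠ 0} {hp1 : ‖p‖ < 1}
    {hmul : ∀ x ∈ lattice B p 0, ∀ y ∈ lattice B p 0, x * y ∈ lattice B p 0} {j : ℕ} {u : Rˣ} :
    u ∈ latticeUnits R hp0 hp1 hmul j ↔ ((u : R) : A) - 1 ∈ lattice B p (j + 1) := Iff.rfl

theorem div_mem_latticeUnits {R : Subring A} {hp0 : p ≠ 0} {hp1 : ‖p‖ < 1}
    {hmul : ∀ x ∈ lattice B p 0, ∀ y ∈ lattice B p 0, x * y ∈ lattice B p 0} {i j : ℕ} {u v : Rˣ}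
    (hv : v ∈ latticeUnits R hp0 hp1 hmul i)
    (huv : ((u : R) : A) - ((v : R) : A) ∈ lattice B p (j + 1)) :
    u / v ∈ latticeUnits R hp0 hp1 hmul j := by
  have hinv := inv_mem hv
  rw [mem_latticeUnits] at hinv ⊢
  have hv1 : ((v : R) : A) * (((v⁻¹ : Rˣ) : R) : A) = 1 := by
    rw [← Subring.coe_mul, Units.mul_inv, Subring.coe_one]
  have : (((u / v : Rˣ) : R) : A) - 1 = (((u : R) : A) - ((v : R) : A)) *
      ((((v⁻¹ : Rˣ) : R) : A) - 1) + (((u : R) : A) - ((v : R) : A)) := by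
    rw [div_eq_mul_inv]
    push_cast
    linear_combination hv1
  rw [this]
  exact add_mem (lattice_anti hp0 hp1 (by omega) (mul_mem_lattice hp0 hmul huv hinv)) huv

theorem coe_iterate_unitsMap {R : Subring A} {sR : R →+* R} (hsR : ∀ x, (sR x : A) = s x)
    (i : ℕ) (u : Rˣ) :
    ((((Units.map sR.toMonoidHom)^[i] u : Rˣ) : R) : A) = s^[i] ((u : R) : A) := by
  induction i with
  | zero => rfl
  | succ i ih =>
    rw [Function.iterate_succ_apply', Function.iterate_succ_apply', ← ih]
    exact hsR _

theorem coe_cycNorm_units {R : Subring A} {sR : R →+* R} (hsR : ∀ x, (sR x : A) = s x)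
    (n : ℕ) (u : Rˣ) :
    (((cycNorm n (Units.map sR.toMonoidHom) u : Rˣ) : R) : A) =
      ∏ i ∈ Finset.range n, s^[i] ((u : R) : A) := by
  rw [cycNorm_apply, Units.coe_prod, SubmonoidClass.coe_finsetProd]
  exact Finset.prod_congr rfl fun i _ ↦ coe_iterate_unitsMap hsR i u

/-- The unit group of a compact ring contains a cohomologically trivial subgroup of finite index,
namely the units congruent to one modulo a free lattice. -/
theorem exists_trivial_latticeUnits (hB : ∀ g, s (B g) = B (σ * g))
    (hσ : ∀ τ, τ ∈ Subgroup.zpowers σ) (hp0 : p ≠ 0)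
    (hp1 : ‖p‖ < 1)
    (hmul : ∀ x ∈ lattice B p 0, ∀ y ∈ lattice B p 0, x * y ∈ lattice B p 0) (R : Subring A)
    [CompactSpace R] (sR : R →+* R) (hsR : ∀ x, (sR x : A) = s x)
    (hR : ∀ a ∈ lattice B p 1, ∃ u : Rˣ, ((u : R) : A) = 1 + a)
    (hs : ∀ x, s^[Nat.card G] x = x) :
    ∃ (V : Subgroup Rˣ) (hV : ∀ x ∈ V, Units.map sR.toMonoidHom x ∈ V), V.FiniteIndex ∧
      HZeroTrivial (Nat.card G) (restrictEnd (Units.map sR.toMonoidHom) V hV) ∧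
      HOneTrivial (Nat.card G) (restrictEnd (Units.map sR.toMonoidHom) V hV) := by
  have : FiniteDimensional k A := B.finiteDimensional_of_finite
  have hcs : Continuous s := LinearMap.continuous_of_finiteDimensional s.toLinearMap
  have hcR : Continuous sR := by
    refine continuous_induced_rng.2 ?_
    have : (Subtype.val ∘ sR : R → A) = s ∘ Subtype.val := funext hsR
    rw [this]
    exact hcs.comp continuous_subtype_val
  set S : Rˣ →* Rˣ := Units.map sR.toMonoidHom with hS
  have hcS : Continuous S := hcR.units_map sR.toMonoidHom
  have hSn : ∀ u, S^[Nat.card G] u = u := by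
    intro u
    refine Units.ext (Subtype.ext ?_)
    rw [coe_iterate_unitsMap hsR, hs]
  let V : ℕ → Subgroup Rˣ := latticeUnits R hp0 hp1 hmul
  have hval : Continuous fun u : Rˣ ↦ ((u : R) : A) - 1 :=
    (continuous_subtype_val.comp Units.continuous_val).sub continuous_const
  have hVopen : ∀ j, IsOpen (V j : Set Rˣ) := fun j ↦ (isOpen_lattice hp0 _).preimage hval
  have hVclosed : ∀ j, IsClosed (V j : Set Rˣ) := fun j ↦
    (V j).isClosed_of_isOpen (hVopen j)
  have hanti : ∀ j, V (j + 1) ≤ V j := fun j u hu ↦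
    lattice_anti hp0 hp1 (by push_cast; omega) (mem_latticeUnits.1 hu)
  have hVst : ∀ j, ∀ u ∈ V j, S u ∈ V j := by
    intro j u hu
    have : (((S u : Rˣ) : R) : A) - 1 = s (((u : R) : A) - 1) := by
      rw [map_sub, map_one]
      exact congrArg (· - 1) (hsR _)
    rw [mem_latticeUnits, this]
    exact map_mem_lattice hB hu
  have hsep : ∀ u, (∀ j, u ∈ V j) → u = 1 := by
    intro u hu
    refine Units.ext (Subtype.ext (sub_eq_zero.1 ?_))
    rw [← B.repr.map_eq_zero_iff]
    ext g
    rw [Finsupp.zero_apply, ← norm_le_zero_iff]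
    refine ge_of_tendsto' ((tendsto_pow_atTop_nhds_zero_of_lt_one (norm_nonneg p) hp1).comp
      (Filter.tendsto_add_atTop_nat 1)) fun j ↦ ?_
    have := mem_latticeUnits.1 (hu j) g
    simpa [← zpow_natCast] using this
  have hcD : Continuous (cycDiff S) := hcS.div' continuous_id
  have hcN : Continuous (cycNorm (Nat.card G) S) := by
    change Continuous fun u ↦ ∏ j ∈ Finset.range (Nat.card G), S^[j] u
    exact continuous_finsetProd _ fun j _ ↦ hcS.iterate j
  have hDN := cycDiff_comp_cycNorm hSn
  have hND := cycNorm_comp_cycDiff hSn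
  have hunit : ∀ (j : ℕ) (b : A), b ∈ lattice B p (j + 1) →
      ∃ y ∈ V j, ((y : R) : A) = 1 + b := by
    intro j b hb
    obtain ⟨y, hy⟩ := hR b (lattice_anti hp0 hp1 (by omega) hb)
    refine ⟨y, ?_, hy⟩
    rw [mem_latticeUnits, hy, add_sub_cancel_left]
    exact hb
  have hnorm : ∀ (j : ℕ) (y : Rˣ), y ∈ V j →
      (((cycNorm (Nat.card G) S y : Rˣ) : R) : A) -
        (1 + (∑ g, B.repr (((y : R) : A) - 1) g) • ∑ g, B g) ∈ lattice B p (j + 1 + 1) := by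
    intro j y hy
    rw [coe_cycNorm_units hsR, ← sum_iterate_eq hB hσ]
    have := prod_one_add_sub_mem hp0 hp1 hmul (j := j + 1) (by omega)
      (fun i ↦ s^[i] (((y : R) : A) - 1)) (fun i ↦ iterate_mem_lattice hB hy i) (Nat.card G)
    have h2 : ∀ i, 1 + s^[i] (((y : R) : A) - 1) = s^[i] ((y : R) : A) := by
      intro i
      rw [← AlgHom.coe_pow, map_sub, map_one]
      ring
    simp only [h2] at this
    exact this
  -- Write `x = 1 + a`. Since `a` is fixed, its coordinates all equal one `α`, so `a` is the trace
  -- of `α • B 1`, and `y = 1 + α • B 1` has norm congruent to `1 + a` one level deeper.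
  have hzero : ∀ j, ∀ x ∈ V j, x ∈ (cycDiff S).ker →
      ∃ y ∈ V j, x / cycNorm (Nat.card G) S y ∈ V (j + 1) ∧
        x / cycNorm (Nat.card G) S y ∈ (cycDiff S).ker := by
    intro j x hx hxZ
    set a : A := ((x : R) : A) - 1 with ha
    have hsa : s a = a := by
      have : S x = x := mem_ker_cycDiff.1 hxZ
      rw [ha, map_sub, map_one, ← hsR]
      exact congrArg (fun u : Rˣ ↦ ((u : R) : A) - 1) this
    have hconst : ∀ g, B.repr a g = B.repr a 1 := by
      have h1 : ∀ g, B.repr a (σ * g) = B.repr a g := fun g ↦ by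
        conv_lhs => rw [← hsa]
        exact repr_map hB a g
      intro g
      obtain ⟨i, rfl⟩ := mem_powers_iff_mem_zpowers.2 (hσ g)
      change B.repr a (σ ^ i) = _
      induction i with
      | zero => simp
      | succ i ih => rw [pow_succ', h1, ih]
    set α := B.repr a 1
    have hα : ‖α‖ ≤ ‖p‖ ^ ((j : ℤ) + 1) := hx 1
    have hb : α • B 1 ∈ lattice B p (j + 1) := by
      classical
      intro g
      rw [map_smul, Module.Basis.repr_self, Finsupp.smul_apply, Finsupp.single_apply]
      split_ifs
      · simpa using hα
      · simpa using zpow_nonneg (norm_nonneg p) _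
    obtain ⟨y, hy, hy1⟩ := hunit j _ hb
    refine ⟨y, hy, ?_, ?_⟩
    · have h1 := hnorm j y hy
      have h2 : (∑ g, B.repr (((y : R) : A) - 1) g) = α := by
        classical
        rw [hy1, add_sub_cancel_left]
        simp [Finsupp.single_apply]
      have h3 : α • ∑ g, B g = a := by
        conv_rhs => rw [← B.sum_repr a]
        rw [Finset.smul_sum]
        exact Finset.sum_congr rfl fun g _ ↦ by rw [hconst]
      rw [h2, h3, ha, add_sub_cancel] at h1
      have hNy : cycNorm (Nat.card G) S y ∈ V j := by
        rw [cycNorm_apply]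
        refine prod_mem fun i hi ↦ ?_
        clear hi
        induction i with
        | zero => exact hy
        | succ i ih =>
          rw [Function.iterate_succ_apply']
          exact hVst _ _ ih
      refine div_mem_latticeUnits hNy ?_
      rw [← neg_sub]
      push_cast
      exact neg_mem h1
    · exact div_mem hxZ (DFunLike.congr_fun hDN y)
  -- Write `x = 1 + a`. As `x` has norm one, the coordinate sum `τ` of `a` already has the next
  -- exponent. Removing `τ` at the coordinate `1` leaves coordinates of sum zero, hence some `s b' -
  -- b'`, and `y = 1 + b'` is the correction.
  have hone : ∀ j, ∀ x ∈ V j, x ∈ (cycNorm (Nat.card G) S).ker →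
      ∃ y ∈ V j, x / cycDiff S y ∈ V (j + 1) ∧
        x / cycDiff S y ∈ (cycNorm (Nat.card G) S).ker := by
    classical
    intro j x hx hxZ
    set a : A := ((x : R) : A) - 1 with ha
    set τ := ∑ g, B.repr a g with hτ
    have hτp : ‖τ‖ ≤ ‖p‖ ^ ((j : ℤ) + 1 + 1) := by
      have h1 := hnorm j x hx
      rw [show cycNorm (Nat.card G) S x = 1 from hxZ] at h1
      have h2 := h1 1
      rw [← ha, ← hτ] at h2
      simpa [Finsupp.single_apply] using h2
    have hp1' : ‖p‖ ^ ((j : ℤ) + 1 + 1) ≤ ‖p‖ ^ ((j : ℤ) + 1) :=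
      zpow_le_zpow_right_of_le_one₀ (norm_pos_iff.2 hp0) hp1.le (by omega)
    -- The difference equation is solved with values in `Q` rather than in `k`, so that `b'` stays
    -- in the lattice of exponent `j + 1`.
    let Q : AddSubgroup k :=
      { carrier := {c | ‖c‖ ≤ ‖p‖ ^ ((j : ℤ) + 1)}
        zero_mem' := by simpa using zpow_nonneg (norm_nonneg p) _
        add_mem' := fun {c d} hc hd ↦
          (IsUltrametricDist.norm_add_le_max _ _).trans (max_le hc hd)
        neg_mem' := fun {c} hc ↦ by
          rw [Set.mem_ofPred_eq, norm_neg]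
          exact hc }
    have hτQ : τ ∈ Q := hτp.trans hp1'
    let a' : G → Q := fun g ↦ ⟨B.repr a g, hx g⟩ - Pi.single (M := fun _ : G ↦ Q) 1 ⟨τ, hτQ⟩ g
    have ha' : ∑ g, a' g = 0 := by
      rw [Finset.sum_sub_distrib, Finset.sum_pi_single']
      apply Subtype.ext
      simp [hτ]
    -- The permutation is by `σ⁻¹` because the coordinate of `s b'` at `g` is that of `b'` at `σ⁻¹ *
    -- g`.
    obtain ⟨b, hb⟩ := exists_sub_eq_of_sum_eq_zero (fun g ↦ σ⁻¹ * g)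
      (Group.mulLeft_bijective σ⁻¹) (by
        intro g g'
        have : g' * g⁻¹ ∈ Subgroup.zpowers σ⁻¹ := by
          rw [Subgroup.zpowers_inv]
          exact hσ _
        obtain ⟨i, hi⟩ := mem_powers_iff_mem_zpowers.2 this
        refine ⟨i, ?_⟩
        rw [mul_left_iterate]
        change σ⁻¹ ^ i = _ at hi
        simp only [hi, inv_mul_cancel_right]) a' ha'
    set b' : A := ∑ g, (b g : k) • B g with hb'
    have hrb : ∀ g, B.repr b' g = b g := fun g ↦ by rw [hb', Module.Basis.repr_sum_self]
    have hbl : b' ∈ lattice B p (j + 1) := fun g ↦ by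
      rw [hrb]
      exact (b g).2
    obtain ⟨y, hy, hy1⟩ := hunit j _ hbl
    have hdiff : a - (s b' - b') = τ • B 1 := by
      apply B.repr.injective
      ext g
      have h1 := congrArg Subtype.val (hb g)
      simp only [a', AddSubgroup.coe_sub] at h1
      have h2 : ((Pi.single (M := fun _ : G ↦ Q) 1 (⟨τ, hτQ⟩ : Q) g : Q) : k) =
          B.repr (τ • B 1) g := by
        rw [map_smul, Module.Basis.repr_self, Finsupp.smul_apply, Finsupp.single_apply]
        by_cases h : g = 1
        · subst h; simp
        · simp [Ne.symm h]
      rw [← h2, map_sub B.repr a, map_sub B.repr (s b'), Finsupp.sub_apply, Finsupp.sub_apply,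
        repr_map' hB, hrb, hrb, ← h1]
      abel
    refine ⟨y, hy, ?_, ?_⟩
    · have h1 : x / cycDiff S y = (x * y) / S y := by
        rw [cycDiff_apply, div_div_eq_mul_div]
      rw [h1]
      refine div_mem_latticeUnits (hVst _ _ hy) ?_
      have h2 : (((S y : Rˣ) : R) : A) = 1 + s b' := by
        have := hsR (y : R)
        rw [hy1, map_add, map_one] at this
        exact this
      have h3 : (((x * y : Rˣ) : R) : A) = (1 + a) * (1 + b') := by
        push_cast
        rw [hy1, ha]
        ring
      rw [h2, h3]
      have h4 : (1 + a) * (1 + b') - (1 + s b') = τ • B 1 + a * b' := by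
        rw [← hdiff]
        ring
      rw [h4]
      push_cast
      refine add_mem ?_ (lattice_anti hp0 hp1 (by omega) (mul_mem_lattice hp0 hmul hx hbl))
      intro g
      rw [map_smul, Module.Basis.repr_self, Finsupp.smul_apply, Finsupp.single_apply]
      split_ifs
      · simpa using hτp
      · simpa using zpow_nonneg (norm_nonneg p) _
    · exact div_mem hxZ (DFunLike.congr_fun hND y)
  have hcoe : ∀ y : V 0, (V 0).subtype (restrictEnd S (V 0) (hVst 0) y) = S ((V 0).subtype y) :=
    fun _ ↦ rfl
  refine ⟨V 0, hVst 0, ?_, ?_, ?_⟩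
  · have := Subgroup.quotient_finite_of_isOpen (V 0) (hVopen 0)
    exact Subgroup.finiteIndex_of_finite_quotient
  · rintro ⟨x, hx⟩ hsx
    obtain ⟨y, hy, hyx⟩ := exists_map_eq_of_filtration V hanti hVclosed hsep _ hcN _ hzero hx
      (mem_ker_cycDiff.2 (congrArg Subtype.val hsx))
    refine ⟨⟨y, hy⟩, Subtype.ext ?_⟩
    exact (DFunLike.congr_fun (comp_cycNorm (Nat.card G) hcoe) ⟨y, hy⟩).trans hyx
  · rintro ⟨x, hx⟩ hNx
    have hxk : cycNorm (Nat.card G) S x = 1 :=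
      (DFunLike.congr_fun (comp_cycNorm (Nat.card G) hcoe) ⟨x, hx⟩).symm.trans
        (congrArg Subtype.val hNx)
    obtain ⟨y, hy, hyx⟩ := exists_map_eq_of_filtration V hanti hVclosed hsep _ hcD _ hone hx hxk
    exact ⟨⟨y, hy⟩, Subtype.ext hyx⟩

end Lattice

/-! ### Scaling a permuted basis. -/

section ScaledLattice

variable {G : Type*} [Group G] [Fintype G] {σ : G}
  {k : Type*} [NontriviallyNormedField k] [CompleteSpace k] [IsUltrametricDist k]
  {A : Type*} [CommRing A] [TopologicalSpace A] [IsTopologicalRing A] [T2Space A]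
  [Algebra k A] [ContinuousSMul k A]

/-- A basis permuted by `s` can be scaled so that it spans a lattice closed under multiplication
and contained in a given open lattice. -/
theorem exists_scaled_basis (B₀ : Module.Basis G k A) {s : A →ₐ[k] A}
    (hB₀ : ∀ g, s (B₀ g) = B₀ (σ * g)) {p : k} (hp0 : p ≠ 0) (hp1 : ‖p‖ < 1)
    (J : AddSubgroup A) (hJ : IsOpen (J : Set A))
    (hJs : ∀ c : k, ‖c‖ ≤ 1 → ∀ x ∈ J, c • x ∈ J) :
    ∃ B : Module.Basis G k A, (∀ g, s (B g) = B (σ * g)) ∧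
      (∀ x ∈ lattice B p 0, ∀ y ∈ lattice B p 0, x * y ∈ lattice B p 0) ∧
      ∀ x ∈ lattice B p 0, x ∈ J := by
  have htend : Filter.Tendsto (fun c : ℕ ↦ p ^ c) Filter.atTop (nhds 0) :=
    tendsto_pow_atTop_nhds_zero_of_norm_lt_one hp1
  have h1 : ∀ᶠ c : ℕ in Filter.atTop, ∀ g, p ^ c • B₀ g ∈ J := by
    rw [Filter.eventually_all]
    intro g
    have := htend.smul_const (B₀ g)
    rw [zero_smul] at this
    exact this.eventually (hJ.mem_nhds J.zero_mem)
  -- Scaling the basis by `p ^ c` multiplies the structure constants by `p ^ c`: two factors from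
  -- the product, less one from the basis vector in which it is expanded.
  have h2 : ∀ᶠ c : ℕ in Filter.atTop, ∀ g h f, ‖p ^ c * B₀.repr (B₀ g * B₀ h) f‖ ≤ 1 := by
    simp only [Filter.eventually_all]
    intro g h f
    have := (htend.mul_const (B₀.repr (B₀ g * B₀ h) f)).norm
    rw [zero_mul, norm_zero] at this
    exact this.eventually_le_const one_pos
  obtain ⟨c, hc1, hc2⟩ := (h1.and h2).exists
  have hpc : p ^ c ≠ 0 := pow_ne_zero c hp0
  let B := B₀.unitsSMul fun _ ↦ Units.mk0 (p ^ c) hpc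
  have hBa : ∀ g, B g = p ^ c • B₀ g := fun g ↦ by
    rw [Module.Basis.unitsSMul_apply]; rfl
  have hsm : ∀ (a : k) x, ‖a‖ ≤ 1 → x ∈ lattice B p 0 → a • x ∈ lattice B p 0 := by
    intro a x ha hx
    have := smul_mem_lattice (i := 0) (by simpa using ha) hp0 hx
    simpa using this
  have hco : ∀ x ∈ lattice B p 0, ∀ g, ‖B.repr x g‖ ≤ 1 := fun x hx g ↦ by
    simpa using hx g
  have hmulB : ∀ g h, B g * B h ∈ lattice B p 0 := by
    intro g h f
    rw [hBa, hBa, smul_mul_smul_comm, map_smul, Finsupp.smul_apply,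
      Module.Basis.repr_unitsSMul, zpow_zero, Units.smul_def, smul_smul, Units.val_inv_eq_inv_val,
      Units.val_mk0, mul_inv_cancel_right₀ hpc, smul_eq_mul]
    exact hc2 g h f
  refine ⟨B, fun g ↦ by rw [hBa, hBa, map_smul, hB₀], fun x hx y hy ↦ ?_, fun x hx ↦ ?_⟩
  · rw [← B.sum_repr x, ← B.sum_repr y, Finset.sum_mul_sum]
    refine sum_mem fun g _ ↦ sum_mem fun h _ ↦ ?_
    rw [smul_mul_smul_comm]
    refine hsm _ _ ?_ (hmulB g h)
    rw [norm_mul]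
    exact mul_le_one₀ (hco x hx g) (norm_nonneg _) (hco y hy h)
  · rw [← B.sum_repr x]
    refine sum_mem fun g _ ↦ hJs _ (hco x hx g) _ ?_
    rw [hBa]
    exact hc1 g

end ScaledLattice

/-! ### The Galois action on finite places and their completions. -/

section FinitePlaceAction

variable {K L : Type*} [Field K] [NumberField K] [Field L] [NumberField L] [Algebra K L]

/-- The action of a field automorphism on the ring of integers. -/
def galInt (σ : Gal(L/K)) : 𝓞 L ≃+* 𝓞 L := RingOfIntegers.mapRingEquiv σ.toRingEquiv

theorem coe_galInt (σ : Gal(L/K)) (x : 𝓞 L) : ((galInt σ x : 𝓞 L) : L) = σ x := rfl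

/-- The preimage of a prime under a field automorphism. -/
def galPlace (σ : Gal(L/K)) (w : HeightOneSpectrum (𝓞 L)) : HeightOneSpectrum (𝓞 L) :=
  HeightOneSpectrum.comap (galInt σ).toRingHom (galInt σ).surjective w

theorem mem_galPlace {σ : Gal(L/K)} {w : HeightOneSpectrum (𝓞 L)} {x : 𝓞 L} :
    x ∈ (galPlace σ w).asIdeal ↔ galInt σ x ∈ w.asIdeal := Iff.rfl

theorem galPlace_injective (σ : Gal(L/K)) :
    Function.Injective (galPlace σ : HeightOneSpectrum (𝓞 L) → _) := by
  intro w w' h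
  refine HeightOneSpectrum.ext (Ideal.ext fun x ↦ ?_)
  have h' : (galInt σ).symm x ∈ (galPlace σ w).asIdeal ↔
      (galInt σ).symm x ∈ (galPlace σ w').asIdeal := by rw [h]
  simpa only [mem_galPlace, RingEquiv.apply_symm_apply] using h'

theorem galPlace_intValuation (σ : Gal(L/K)) (w : HeightOneSpectrum (𝓞 L)) (x : 𝓞 L) :
    (galPlace σ w).intValuation x = w.intValuation (galInt σ x) := by
  have hpow : ∀ m : ℕ, x ∈ (galPlace σ w).asIdeal ^ m ↔ galInt σ x ∈ w.asIdeal ^ m := by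
    intro m
    have h : (galPlace σ w).asIdeal = Ideal.map (galInt σ).symm w.asIdeal := by
      rw [Ideal.map_symm]
      rfl
    rw [h, ← Ideal.map_pow, Ideal.map_symm, Ideal.mem_comap]
  rcases eq_or_ne x 0 with rfl | hx
  · simp
  have hx' : galInt σ x ≠ 0 := (map_ne_zero_iff _ (galInt σ).injective).2 hx
  have hle : ∀ m : ℕ, (galPlace σ w).intValuation x ≤ WithZero.exp (-(m : ℤ)) ↔
      w.intValuation (galInt σ x) ≤ WithZero.exp (-(m : ℤ)) := by
    intro m
    rw [HeightOneSpectrum.intValuation_le_pow_iff_mem, HeightOneSpectrum.intValuation_le_pow_iff_mem,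
      hpow]
  rw [HeightOneSpectrum.intValuation_eq_exp_neg_multiplicity _ hx,
    HeightOneSpectrum.intValuation_eq_exp_neg_multiplicity _ hx'] at hle ⊢
  exact le_antisymm ((hle _).2 le_rfl) ((hle _).1 le_rfl)

theorem galPlace_valuation (σ : Gal(L/K)) (w : HeightOneSpectrum (𝓞 L)) (x : L) :
    (galPlace σ w).valuation L x = w.valuation L (σ x) := by
  obtain ⟨a, b, hb, rfl⟩ := IsFractionRing.div_surjective (A := 𝓞 L) x
  rw [map_div₀, map_div₀, map_div₀, HeightOneSpectrum.valuation_of_algebraMap,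
    HeightOneSpectrum.valuation_of_algebraMap, galPlace_intValuation, galPlace_intValuation]
  have h : ∀ a : 𝓞 L, σ (algebraMap (𝓞 L) L a) = algebraMap (𝓞 L) L (galInt σ a) := fun _ ↦ rfl
  rw [h, h, HeightOneSpectrum.valuation_of_algebraMap, HeightOneSpectrum.valuation_of_algebraMap]

theorem isOpen_setOf_valued_lt {F Γ : Type*} [Field F] [LinearOrderedCommGroupWithZero Γ]
    [Valued F Γ] (a : F) : IsOpen {y : F | Valued.v y < Valued.v a} := by
  have := Valued.isOpen_ball F (Valued.v.restrict a)
  simpa only [Valuation.restrict_lt_iff] using this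

theorem continuous_withValMap (σ : Gal(L/K)) (w : HeightOneSpectrum (𝓞 L)) :
    Continuous (WithVal.map ((galPlace σ w).valuation L) (w.valuation L) (σ : L →+* L)) := by
  refine continuous_of_continuousAt_zero _ ?_
  rw [ContinuousAt, map_zero]
  intro S hS
  obtain ⟨γ, hγ⟩ := Valued.mem_nhds_zero.1 hS
  rw [Filter.mem_map]
  have hδ : MonoidWithZeroHom.ValueGroup₀.embedding γ.1 ≠ 0 := by simp
  obtain ⟨a, ha⟩ := (galPlace σ w).valuation_surjective L
    (MonoidWithZeroHom.ValueGroup₀.embedding γ.1)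
  refine Filter.mem_of_superset ((isOpen_setOf_valued_lt
    (WithVal.toVal ((galPlace σ w).valuation L) a)).mem_nhds ?_) ?_
  · change Valued.v 0 < (galPlace σ w).valuation L a
    rw [ha, map_zero]
    exact zero_lt_iff.2 hδ
  · intro x hx
    refine hγ ?_
    rw [Set.mem_ofPred_eq, Valuation.restrict_lt_iff_lt_embedding]
    change (galPlace σ w).valuation L _ < (galPlace σ w).valuation L a at hx
    rw [ha, galPlace_valuation] at hx
    exact hx

/-- The extension of a field automorphism to the completions at finite places. -/
def galMap (σ : Gal(L/K)) (w : HeightOneSpectrum (𝓞 L)) :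
    (galPlace σ w).adicCompletion L →+* w.adicCompletion L :=
  ((HeightOneSpectrum.adicCompletion.equiv L w).symm.toRingHom.comp
    (UniformSpace.Completion.mapRingHom
      (WithVal.map ((galPlace σ w).valuation L) (w.valuation L) (σ : L →+* L))
      (continuous_withValMap σ w))).comp
    (HeightOneSpectrum.adicCompletion.equiv L (galPlace σ w)).toRingHom

theorem continuous_galMap (σ : Gal(L/K)) (w : HeightOneSpectrum (𝓞 L)) :
    Continuous (galMap σ w) :=
  (HeightOneSpectrum.adicCompletion.continuous_ofCompletion L w).comp <|
    UniformSpace.Completion.continuous_map.comp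
      (HeightOneSpectrum.adicCompletion.continuous_toCompletion L _)

theorem galMap_algebraMap (σ : Gal(L/K)) (w : HeightOneSpectrum (𝓞 L)) (x : L) :
    galMap σ w (algebraMap L _ x) = algebraMap L _ (σ x) := by
  apply HeightOneSpectrum.adicCompletion.ext
  exact UniformSpace.Completion.mapRingHom_coe (continuous_withValMap σ w) _

/-- A nonzero `x` and its image have locally constant valuations, and `F` is dense in its
completion. Identities between valuations on completions are thereby reduced to elements of the
number field. -/
theorem exists_valued_eq {F F' : Type*} [Field F] [NumberField F] [Field F'] [NumberField F']
    {w : HeightOneSpectrum (𝓞 F)} {w' : HeightOneSpectrum (𝓞 F')}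
    (φ : w.adicCompletion F →+* w'.adicCompletion F') (hφ : Continuous φ)
    {x : w.adicCompletion F} (hx : x ≠ 0) :
    ∃ l : F, Valued.v (algebraMap F (w.adicCompletion F) l) = Valued.v x ∧
      Valued.v (φ (algebraMap F (w.adicCompletion F) l)) = Valued.v (φ x) := by
  have h1 : IsOpen {y : w.adicCompletion F | Valued.v (y - x) < Valued.v x} :=
    (isOpen_setOf_valued_lt x).preimage (continuous_id.sub continuous_const)
  have h2 : IsOpen {y : w.adicCompletion F | Valued.v (φ y - φ x) < Valued.v (φ x)} :=
    (isOpen_setOf_valued_lt (φ x)).preimage (hφ.sub continuous_const)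
  obtain ⟨y, ⟨hy1, hy2⟩, l, rfl⟩ := (w.denseRange_algebraMap F).inter_open_nonempty _ (h1.inter h2)
    ⟨x, by simpa [zero_lt_iff] using hx, by simpa [zero_lt_iff] using hx⟩
  exact ⟨l, Valuation.map_eq_of_sub_lt _ hy1, Valuation.map_eq_of_sub_lt _ hy2⟩

theorem valued_galMap (σ : Gal(L/K)) (w : HeightOneSpectrum (𝓞 L))
    (x : (galPlace σ w).adicCompletion L) : Valued.v (galMap σ w x) = Valued.v x := by
  rcases eq_or_ne x 0 with rfl | hx
  · simp
  obtain ⟨l, h1, h2⟩ := exists_valued_eq _ (continuous_galMap σ w) hx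
  rw [← h1, ← h2, galMap_algebraMap]
  have := galPlace_valuation σ w l
  rw [← HeightOneSpectrum.valuedAdicCompletion_eq_valuation',
    ← HeightOneSpectrum.valuedAdicCompletion_eq_valuation'] at this
  exact this.symm

theorem valued_adicCompletionMap (v : HeightOneSpectrum (𝓞 K)) (w : HeightOneSpectrum (𝓞 L))
    [w.asIdeal.LiesOver v.asIdeal] (x : v.adicCompletion K) :
    Valued.v (adicCompletionMap K L v w x) =
      Valued.v x ^ v.asIdeal.ramificationIdx' w.asIdeal := by
  rcases eq_or_ne x 0 with rfl | hx
  · simp [Ideal.IsDedekindDomain.ramificationIdx'_ne_zero_of_liesOver w.asIdeal v.ne_bot]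
  obtain ⟨l, h1, h2⟩ := exists_valued_eq _ (continuous_adicCompletionMap K L v w) hx
  rw [← h1, ← h2, adicCompletionMap_algebraMap]
  have := HeightOneSpectrum.valuation_liesOver L v w l
  rw [← HeightOneSpectrum.valuedAdicCompletion_eq_valuation',
    ← HeightOneSpectrum.valuedAdicCompletion_eq_valuation'] at this
  exact this.symm

theorem galPlace_liesOver (σ : Gal(L/K)) (v : HeightOneSpectrum (𝓞 K))
    (w : HeightOneSpectrum (𝓞 L)) [hw : w.asIdeal.LiesOver v.asIdeal] :
    (galPlace σ w).asIdeal.LiesOver v.asIdeal := by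
  refine ⟨?_⟩
  rw [hw.over]
  ext x
  rw [Ideal.mem_under, Ideal.mem_under, mem_galPlace]
  have : galInt σ (algebraMap (𝓞 K) (𝓞 L) x) = algebraMap (𝓞 K) (𝓞 L) x := by
    apply RingOfIntegers.ext
    exact σ.commutes (x : K)
  rw [this]

/-- The preimage under a field automorphism, on the primes over a given prime. -/
def galOver (σ : Gal(L/K)) (v : HeightOneSpectrum (𝓞 K)) (w : PrimesOver K L v) :
    PrimesOver K L v :=
  ⟨galPlace σ w.1, haveI := w.2; galPlace_liesOver σ v w.1⟩

theorem galOver_iterate (σ : Gal(L/K)) (v : HeightOneSpectrum (𝓞 K)) (w : PrimesOver K L v)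
    (j : ℕ) : ((galOver σ v)^[j] w).1 = galPlace (σ ^ j) w.1 := by
  induction j with
  | zero =>
    refine HeightOneSpectrum.ext (Ideal.ext fun x ↦ ?_)
    exact Iff.rfl
  | succ j ih =>
    rw [Function.iterate_succ_apply']
    refine HeightOneSpectrum.ext (Ideal.ext fun x ↦ ?_)
    change galInt σ x ∈ ((galOver σ v)^[j] w).1.asIdeal ↔ _
    rw [ih, mem_galPlace, mem_galPlace]
    have : galInt (σ ^ j) (galInt σ x) = galInt (σ ^ (j + 1)) x := by
      apply RingOfIntegers.ext
      rw [coe_galInt, coe_galInt, coe_galInt, pow_succ]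
      rfl
    rw [this]

theorem galOver_transitive [IsGalois K L] {σ : Gal(L/K)} (hσ : ∀ τ, τ ∈ Subgroup.zpowers σ)
    (v : HeightOneSpectrum (𝓞 K)) (w w' : PrimesOver K L v) :
    ∃ j : ℕ, (galOver σ v)^[j] w = w' := by
  have := w.2
  have := w'.2
  obtain ⟨τ, hτ⟩ := Ideal.exists_smul_eq_of_isGaloisGroup v.asIdeal w.1.asIdeal w'.1.asIdeal
    Gal(L/K)
  -- The inverse appears because `galPlace` takes preimages, whereas the pointwise action on ideals
  -- takes images.
  obtain ⟨j, hj⟩ := mem_powers_iff_mem_zpowers.2 (hσ τ⁻¹)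
  refine ⟨j, Subtype.ext ?_⟩
  rw [galOver_iterate]
  refine HeightOneSpectrum.ext (Ideal.ext fun x ↦ ?_)
  change σ ^ j = τ⁻¹ at hj
  rw [mem_galPlace, hj, ← hτ, Ideal.mem_pointwise_smul_iff_inv_smul_mem]
  rfl

end FinitePlaceAction

open scoped Valued

/-! ### Finiteness of residue fields and compactness of the local integers. -/

section ResidueField

variable {L : Type*} [Field L] [NumberField L] (w : HeightOneSpectrum (𝓞 L))

/-- For `x = a / b`, strip the power of `w` from the ideal `(b)` and take `j` in the remaining
factor but outside `w`. That power of `w` divides `a`, so `b` divides `a j`. -/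
theorem exists_eq_div_of_valuation_le_one {x : L} (hx : w.valuation L x ≤ 1) :
    ∃ c j : 𝓞 L, j ∉ w.asIdeal ∧ x * algebraMap (𝓞 L) L j = algebraMap (𝓞 L) L c := by
  obtain ⟨a, b, hb, rfl⟩ := IsFractionRing.div_surjective (A := 𝓞 L) x
  have hb0 : b ≠ 0 := nonZeroDivisors.ne_zero hb
  have hbL : algebraMap (𝓞 L) L b ≠ 0 := by simpa using hb0
  have hspan : Ideal.span {b} ≠ ⊥ := by simpa using hb0
  obtain ⟨J, hJ, hJw⟩ := (FiniteMultiplicity.of_prime_left w.prime hspan).exists_eq_pow_mul_and_not_dvd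
  set m := multiplicity w.asIdeal (Ideal.span {b})
  obtain ⟨j, hjJ, hjw⟩ : ∃ j ∈ J, j ∉ w.asIdeal := by
    rw [Ideal.dvd_iff_le] at hJw
    exact SetLike.not_le_iff_exists.1 hJw
  have hvb : w.intValuation b ≤ WithZero.exp (-(m : ℤ)) := by
    rw [HeightOneSpectrum.intValuation_le_pow_iff_mem]
    have h : b ∈ Ideal.span {b} := Ideal.mem_span_singleton_self b
    rw [hJ] at h
    exact (Ideal.mul_le_left : w.asIdeal ^ m * J ≤ w.asIdeal ^ m) h
  have ha : a ∈ w.asIdeal ^ m := by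
    rw [← HeightOneSpectrum.intValuation_le_pow_iff_mem]
    refine le_trans ?_ hvb
    rw [map_div₀, div_le_one₀ (by simpa [zero_lt_iff] using hb0)] at hx
    simpa [HeightOneSpectrum.valuation_of_algebraMap] using hx
  have haj : a * j ∈ Ideal.span {b} := by
    rw [hJ]
    exact Ideal.mul_mem_mul ha hjJ
  obtain ⟨c, hc⟩ := Ideal.mem_span_singleton'.1 haj
  refine ⟨c, j, hjw, ?_⟩
  rw [div_mul_eq_mul_div, div_eq_iff hbL, ← map_mul, ← map_mul, hc]

/-- By density take `x` in `L`, written as a fraction with denominator outside `w`, then replace the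
inverse of the denominator by an inverse modulo `w`. Hence the residue field of the completion is a
quotient of the finite ring `𝓞 L ⧸ w.asIdeal`. -/
theorem exists_int_valued_sub_lt_one {x : w.adicCompletion L} (hx : Valued.v x ≤ 1) :
    ∃ a : 𝓞 L, Valued.v (x - algebraMap L _ (algebraMap (𝓞 L) L a)) < 1 := by
  have h1 : IsOpen {y : w.adicCompletion L | Valued.v (y - x) < Valued.v (1 : w.adicCompletion L)} :=
    (isOpen_setOf_valued_lt (1 : w.adicCompletion L)).preimage (continuous_id.sub continuous_const)
  obtain ⟨y, hy, l, rfl⟩ := (w.denseRange_algebraMap L).inter_open_nonempty _ h1 ⟨x, by simp⟩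
  rw [Set.mem_ofPred_eq, map_one] at hy
  have hl : w.valuation L l ≤ 1 := by
    rw [← HeightOneSpectrum.valuedAdicCompletion_eq_valuation']
    have := Valuation.map_add_le Valued.v hy.le hx
    rwa [sub_add_cancel] at this
  obtain ⟨c, j, hj, hcj⟩ := exists_eq_div_of_valuation_le_one w hl
  obtain ⟨j', i, hi, hji⟩ := w.isMaximal.exists_inv hj
  refine ⟨c * j', ?_⟩
  have hlc : l - algebraMap (𝓞 L) L (c * j') = l * algebraMap (𝓞 L) L i := by
    have : algebraMap (𝓞 L) L i = 1 - algebraMap (𝓞 L) L (j' * j) := by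
      rw [← map_one (algebraMap (𝓞 L) L), ← hji, map_add]; ring
    rw [this, map_mul, map_mul, ← hcj]; ring
  have h2 : Valued.v (algebraMap L (w.adicCompletion L) (l - algebraMap (𝓞 L) L (c * j'))) < 1 := by
    have := HeightOneSpectrum.valuedAdicCompletion_eq_valuation' w (l - algebraMap (𝓞 L) L (c * j'))
    refine this.trans_lt ?_
    rw [hlc, map_mul, HeightOneSpectrum.valuation_of_algebraMap]
    exact mul_lt_one_of_nonneg_of_lt_one_right hl zero_le
      ((w.intValuation_lt_one_iff_mem _).2 hi)
  rw [map_sub] at h2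
  rw [← Valuation.map_sub_swap] at hy
  have := Valuation.map_add_lt Valued.v hy h2
  rwa [sub_add_sub_cancel] at this

instance : Finite (IsLocalRing.ResidueField (w.adicCompletionIntegers L)) := by
  let f : 𝓞 L →+* IsLocalRing.ResidueField (w.adicCompletionIntegers L) :=
    (IsLocalRing.residue _).comp (algebraMap (𝓞 L) (w.adicCompletionIntegers L))
  have hf : Function.Surjective f := by
    intro z
    obtain ⟨x, rfl⟩ := IsLocalRing.residue_surjective z
    obtain ⟨a, ha⟩ := exists_int_valued_sub_lt_one w x.2
    refine ⟨a, ?_⟩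
    rw [RingHom.comp_apply, ← sub_eq_zero, ← map_sub, IsLocalRing.residue_eq_zero_iff,
      ← neg_mem_iff, neg_sub]
    exact (Valuation.mem_maximalIdeal_iff _ _).2 ha
  have hker : w.asIdeal ≤ RingHom.ker f := by
    intro a ha
    rw [RingHom.mem_ker, RingHom.comp_apply, IsLocalRing.residue_eq_zero_iff]
    refine (Valuation.mem_maximalIdeal_iff _ _).2 ?_
    have := HeightOneSpectrum.valuedAdicCompletion_eq_valuation' w (algebraMap (𝓞 L) L a)
    refine this.trans_lt ?_
    rw [HeightOneSpectrum.valuation_of_algebraMap]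
    exact (w.intValuation_lt_one_iff_mem _).2 ha
  have : Finite (𝓞 L ⧸ w.asIdeal) := w.asIdeal.finiteQuotientOfFreeOfNeBot w.ne_bot
  exact Finite.of_surjective (Ideal.Quotient.lift w.asIdeal f hker)
    (Ideal.Quotient.lift_surjective_of_surjective _ _ hf)

instance : CompactSpace (w.adicCompletionIntegers L) := by
  refine Valued.integer.compactSpace_iff_completeSpace_and_isDiscreteValuationRing_and_finite_residueField.2
    ⟨?_, inferInstanceAs (IsDiscreteValuationRing (w.adicCompletionIntegers L)),
      inferInstanceAs (Finite (IsLocalRing.ResidueField (w.adicCompletionIntegers L)))⟩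
  exact (Valued.isClosed_integer (w.adicCompletion L)).completeSpace_coe

end ResidueField

/-! ### The product of the completions over a finite place. -/

section LocalAlgebra

variable {K L : Type*} [Field K] [NumberField K] [Field L] [NumberField L] [Algebra K L]
  (v : HeightOneSpectrum (𝓞 K))

instance (w : PrimesOver K L v) : Algebra (v.adicCompletion K) (w.1.adicCompletion L) :=
  haveI := w.2
  (adicCompletionMap K L v w.1).toAlgebra

theorem algebraMap_primesOver (w : PrimesOver K L v) :
    haveI := w.2
    algebraMap (v.adicCompletion K) (w.1.adicCompletion L) = adicCompletionMap K L v w.1 := rfl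

instance (w : PrimesOver K L v) : IsScalarTower K (v.adicCompletion K) (w.1.adicCompletion L) :=
  .of_algebraMap_eq fun x ↦ by
    have := w.2
    rw [algebraMap_primesOver, adicCompletionMap_algebraMap]
    exact IsScalarTower.algebraMap_apply K L (w.1.adicCompletion L) x

instance (w : PrimesOver K L v) : ContinuousSMul (v.adicCompletion K) (w.1.adicCompletion L) :=
  haveI := w.2
  ⟨((continuous_adicCompletionMap K L v w.1).comp continuous_fst).mul continuous_snd⟩

instance (w : PrimesOver K L v) :
    FiniteDimensional (v.adicCompletion K) (w.1.adicCompletion L) :=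
  haveI := w.2
  inferInstance

variable (L) in
/-- The product of the completions of `L` at the primes over `v`. -/
abbrev LocalAlg : Type _ := ∀ w : PrimesOver K L v, w.1.adicCompletion L

theorem prod_finiteLocalNorm (x : LocalAlg L v) :
    (∏ w : PrimesOver K L v, haveI := w.2; finiteLocalNorm K L v w.1 (x w)) =
      Algebra.norm (v.adicCompletion K) x :=
  (norm_pi_apply x).symm

/-- Weak approximation: the absolute values of distinct primes are nontrivial and inequivalent. The
result is then transported from `L` with these absolute values to the completions. -/
theorem denseRange_localAlg : DenseRange (algebraMap L (LocalAlg L v)) := by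
  have h1 : DenseRange (algebraMap L (∀ w : PrimesOver K L v,
      WithAbs (HeightOneSpectrum.adicAbv L w.1))) := by
    refine AbsoluteValue.denseRange_algebraMap_pi (fun w ↦ ?_) fun w w' hne h ↦ hne ?_
    · obtain ⟨a, ha, ha0⟩ := Submodule.exists_mem_ne_zero_of_ne_bot w.1.ne_bot
      refine ⟨algebraMap (𝓞 L) L a, by simpa using ha0, ?_⟩
      exact ((w.1.adicAbv_coe_lt_one_iff _ a).2 ha).ne
    · refine Subtype.ext (HeightOneSpectrum.ext (Ideal.ext fun a ↦ ?_))
      have := h.lt_one_iff (x := algebraMap (𝓞 L) L a)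
      exact (w.1.adicAbv_coe_lt_one_iff _ a).symm.trans
        (this.trans (w'.1.adicAbv_coe_lt_one_iff _ a))
  let f : ∀ w : PrimesOver K L v, WithAbs (HeightOneSpectrum.adicAbv L w.1) →+*
      w.1.adicCompletion L := fun w ↦
    (algebraMap L (w.1.adicCompletion L)).comp (WithAbs.equiv _).toRingHom
  have hf : ∀ w, Continuous (f w) := fun w ↦ by
    refine (AddMonoidHomClass.isometry_of_norm (f w) fun x ↦ ?_).continuous
    exact FinitePlace.norm_embedding w.1 _
  have hfd : ∀ w, DenseRange (f w) := fun w ↦ by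
    have := w.1.denseRange_algebraMap L
    rwa [DenseRange, ← (WithAbs.equiv (HeightOneSpectrum.adicAbv L w.1)).surjective.range_comp]
      at this
  exact (DenseRange.piMap hfd).comp h1 (Continuous.piMap hf)

end LocalAlgebra

/-- Hilbert 90 for a ring whose units are detected by a family of residue fields permuted
transitively by the action. -/
theorem hOneTrivial_units_of_residues {R ι : Type*} [CommRing R] {F : ι → Type*}
    [∀ w, Field (F w)] {n : ℕ} (hn : 0 < n) {s : R →+* R} (π : ∀ w, R →+* F w)
    (hu : ∀ x, (∀ w, π w x ≠ 0) → IsUnit x) {e : ι → ι}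
    (htr : ∀ w w', ∃ j : ℕ, e^[j] w = w') (hse : ∀ x w, π w (s x) = 0 ↔ π (e w) x = 0)
    (hs : ∀ x, s^[n] x = x) (w₀ : ι)
    (hne : ∀ i < n, ∀ j < n, i ≠ j → ∃ x, π w₀ (s^[i] x) ≠ π w₀ (s^[j] x)) :
    HOneTrivial n (Units.map s.toMonoidHom) := by
  intro x hx
  have hit : ∀ (j : ℕ) (u : Rˣ), (((Units.map s.toMonoidHom)^[j] u : Rˣ) : R) = s^[j] u := by
    intro j u
    induction j with
    | zero => rfl
    | succ j ih => rw [Function.iterate_succ_apply', Function.iterate_succ_apply', ← ih]; rfl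
  have hx' : ∏ i ∈ Finset.range n, s^[i] (x : R) = 1 := by
    have := congrArg Units.val hx
    rw [cycNorm_apply, Units.coe_prod] at this
    simpa only [hit, Units.val_one] using this
  obtain ⟨c, hc⟩ := exists_sum_mul_ne_zero hn
    (fun j ↦ ((π w₀).comp (s ^ j)).toMonoidHom) (by
      intro i hi j hj hij
      by_contra h
      obtain ⟨y, hy⟩ := hne i hi j hj h
      refine hy ?_
      have := DFunLike.congr_fun hij y
      simpa [RingHom.coe_pow] using this)
    (fun j ↦ π w₀ (∏ i ∈ Finset.range j, s^[i] (x : R))) (by simp)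
  have hc' : π w₀ (resolvent n s x c) ≠ 0 := by
    rw [resolvent, map_sum]
    simpa [RingHom.coe_pow] using hc
  have hr := mul_map_resolvent hs hx' c
  set r := resolvent n s x c
  -- Since `x * s r = r` with `x` a unit, `r` vanishes at `w` exactly when `s r` does, that is when
  -- `r` vanishes at `e w`. Nonvanishing at `w₀` therefore spreads to all `w`, and `r` is a unit.
  have hall : ∀ w, π w r ≠ 0 := forall_of_transitive htr (P := fun w ↦ π w r ≠ 0) (fun w ↦ by
    rw [← not_iff_not, not_not, not_not, ← hse r w]
    conv_lhs => rw [← hr, map_mul]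
    rw [mul_eq_zero, or_iff_right (x.isUnit.map (π w)).ne_zero]) hc'
  obtain ⟨u, hu'⟩ := hu r hall
  refine ⟨u⁻¹, ?_⟩
  rw [cycDiff_apply, map_inv, inv_div_inv, div_eq_iff_eq_mul]
  apply Units.ext
  rw [Units.val_mul, hu', ← hr, ← hu']
  rfl

/-! ### The action of `σ` on the completions and integers over a finite place. -/

section LocalAction

variable {K L : Type*} [Field K] [NumberField K] [Field L] [NumberField L] [Algebra K L]
  (σ : Gal(L/K)) (v : HeightOneSpectrum (𝓞 K))

theorem galMap_adicCompletionMap (w : HeightOneSpectrum (𝓞 L)) [w.asIdeal.LiesOver v.asIdeal]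
    [(galPlace σ w).asIdeal.LiesOver v.asIdeal] (x : v.adicCompletion K) :
    galMap σ w (adicCompletionMap K L v (galPlace σ w) x) = adicCompletionMap K L v w x := by
  refine (v.denseRange_algebraMap K).induction_on x (isClosed_eq
    ((continuous_galMap σ w).comp (continuous_adicCompletionMap K L v _))
    (continuous_adicCompletionMap K L v w)) fun a ↦ ?_
  rw [adicCompletionMap_algebraMap, galMap_algebraMap, adicCompletionMap_algebraMap, σ.commutes]

/-- The action of a field automorphism on the product of the completions over `v`. -/
def localAct : LocalAlg L v →ₐ[v.adicCompletion K] LocalAlg L v :=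
  AlgHom.mk
    { toFun := fun x w ↦ galMap σ w.1 (x (galOver σ v w))
      map_one' := funext fun w ↦ map_one (galMap σ w.1)
      map_mul' := fun _ _ ↦ funext fun w ↦ map_mul (galMap σ w.1) _ _
      map_zero' := funext fun w ↦ map_zero (galMap σ w.1)
      map_add' := fun _ _ ↦ funext fun w ↦ map_add (galMap σ w.1) _ _ } fun a ↦ funext fun w ↦
    haveI := w.2
    haveI := galPlace_liesOver σ v w.1
    galMap_adicCompletionMap σ v w.1 a

theorem localAct_algebraMap (x : L) :
    localAct σ v (algebraMap L _ x) = algebraMap L _ (σ x) :=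
  funext fun w ↦ galMap_algebraMap σ w.1 x

theorem valued_localAct (x : LocalAlg L v) (w : PrimesOver K L v) :
    Valued.v (localAct σ v x w) = Valued.v (x (galOver σ v w)) :=
  valued_galMap σ w.1 _

variable (L) in
/-- The product of the valuation rings at the primes over `v`. -/
def localInt : Subring (LocalAlg L v) where
  carrier := {x | ∀ w, Valued.v (x w) ≤ 1}
  mul_mem' hx hy w := mul_mem (s := w.1.adicCompletionIntegers L) (hx w) (hy w)
  one_mem' w := one_mem (w.1.adicCompletionIntegers L)
  add_mem' hx hy w := add_mem (s := w.1.adicCompletionIntegers L) (hx w) (hy w)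
  zero_mem' w := zero_mem (w.1.adicCompletionIntegers L)
  neg_mem' {x} hx w := (Valuation.map_neg Valued.v (x w)).trans_le (hx w)

instance : CompactSpace (localInt L v) := by
  refine (isCompact_iff_compactSpace (s := (localInt L v : Set (LocalAlg L v)))).1 ?_
  have h : IsCompact (Set.univ.pi fun w : PrimesOver K L v ↦
      (w.1.adicCompletionIntegers L : Set (w.1.adicCompletion L))) :=
    isCompact_univ_pi fun w ↦ isCompact_iff_compactSpace.2
      (inferInstanceAs (CompactSpace (w.1.adicCompletionIntegers L)))
  convert h using 1
  ext x
  simp only [Set.mem_univ_pi]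
  rfl

/-- The action of a field automorphism on the product of the valuation rings over `v`. -/
def localActInt : localInt L v →+* localInt L v :=
  (localAct σ v : LocalAlg L v →+* LocalAlg L v).restrict _ _ fun x hx w ↦
    (valued_localAct σ v x w).trans_le (hx _)

theorem coe_localActInt (x : localInt L v) : (localActInt σ v x : LocalAlg L v) = localAct σ v x :=
  rfl

theorem coe_localActInt_iterate (j : ℕ) (x : localInt L v) :
    (((localActInt σ v)^[j] x : localInt L v) : LocalAlg L v) = (localAct σ v)^[j] x := by
  induction j with
  | zero => rfl
  | succ j ih => rw [Function.iterate_succ_apply', Function.iterate_succ_apply', coe_localActInt, ih]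

variable {v} in
theorem exists_unit_localInt {x : LocalAlg L v} (h : ∀ w, Valued.v (x w) = 1) :
    ∃ u : (localInt L v)ˣ, ((u : localInt L v) : LocalAlg L v) = x := by
  have h0 : ∀ w, x w ≠ 0 := fun w h' ↦ by simpa [h'] using h w
  refine ⟨⟨⟨x, fun w ↦ (h w).le⟩, ⟨fun w ↦ (x w)⁻¹, fun w ↦ ?_⟩, ?_, ?_⟩, rfl⟩
  · rw [map_inv₀, h w, inv_one]
  · exact Subtype.ext (funext fun w ↦ mul_inv_cancel₀ (h0 w))
  · exact Subtype.ext (funext fun w ↦ inv_mul_cancel₀ (h0 w))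

variable {v} in
theorem valued_unit_localInt (u : (localInt L v)ˣ) (w : PrimesOver K L v) :
    Valued.v (((u : localInt L v) : LocalAlg L v) w) = 1 := by
  refine le_antisymm ((u : localInt L v).2 w) ?_
  have h1 : ((u : localInt L v) : LocalAlg L v) w * ((u⁻¹ : (localInt L v)ˣ) : localInt L v).1 w
      = 1 := congrFun (congrArg Subtype.val u.mul_inv) w
  have h2 := congrArg Valued.v h1
  rw [map_mul, map_one] at h2
  rw [← h2]
  exact mul_le_of_le_one_right' (((u⁻¹ : (localInt L v)ˣ) : localInt L v).2 w)

variable (L) in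
/-- The product of the maximal ideals at the primes over `v`. -/
def localRad : AddSubgroup (LocalAlg L v) where
  carrier := {x | ∀ w, Valued.v (x w) < 1}
  add_mem' hx hy w := Valuation.map_add_lt _ (hx w) (hy w)
  zero_mem' w := by simp
  neg_mem' hx w := by simpa using hx w

theorem isOpen_localRad : IsOpen (localRad L v : Set (LocalAlg L v)) := by
  have h : (localRad L v : Set (LocalAlg L v)) =
      ⋂ w, (fun x : LocalAlg L v ↦ x w) ⁻¹' {y | Valued.v y < Valued.v (1 : w.1.adicCompletion L)} := by
    ext x
    simp only [Set.mem_iInter, Set.mem_preimage, Set.mem_ofPred_eq, map_one]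
    rfl
  rw [h]
  exact isOpen_iInter_of_finite fun w ↦ (isOpen_setOf_valued_lt (1 : w.1.adicCompletion L)).preimage
    (continuous_apply w)

theorem smul_mem_localRad {c : v.adicCompletion K} (hc : ‖c‖ ≤ 1) {x : LocalAlg L v}
    (hx : x ∈ localRad L v) : c • x ∈ localRad L v := by
  intro w
  have := w.2
  have h1 : Valued.v c ≤ 1 := (Valued.toNormedField.norm_le_one_iff).1 hc
  rw [Pi.smul_apply, Algebra.smul_def, map_mul, algebraMap_primesOver, valued_adicCompletionMap]
  exact mul_lt_one_of_nonneg_of_lt_one_right (pow_le_one' h1 _) zero_le (hx w)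

variable [IsGalois K L]

instance : Nonempty (PrimesOver K L v) := by
  obtain ⟨P, hP⟩ := (inferInstance : Nonempty (v.asIdeal.primesOver (𝓞 L)))
  have := hP.2
  exact ⟨⟨⟨P, hP.1, Ideal.ne_bot_of_liesOver_of_ne_bot v.ne_bot P⟩, hP.2⟩⟩

variable {σ}

theorem localAct_iterate_finrank (hσ : ∀ τ, τ ∈ Subgroup.zpowers σ) (x : LocalAlg L v) :
    (localAct σ v)^[Module.finrank K L] x = x :=
  iterate_finrank_eq hσ (denseRange_localAlg v) (localAct_algebraMap σ v) x

theorem algebraMap_norm_localAlg (hσ : ∀ τ, τ ∈ Subgroup.zpowers σ) (x : LocalAlg L v) :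
    algebraMap (v.adicCompletion K) (LocalAlg L v) (Algebra.norm (v.adicCompletion K) x) =
      ∏ j ∈ Finset.range (Module.finrank K L), (localAct σ v)^[j] x :=
  algebraMap_norm_eq_prod hσ (denseRange_localAlg v) (localAct_algebraMap σ v) x

/-- The normal basis theorem supplies a basis permuted by `σ`. It is scaled into the product of the
maximal ideals, so that `1 + a` is a unit for every `a` in the lattice. Ramification plays no part.
-/
theorem exists_trivial_localInt_units (hσ : ∀ τ, τ ∈ Subgroup.zpowers σ) :
    ∃ (V : Subgroup (localInt L v)ˣ)
      (hV : ∀ x ∈ V, Units.map (localActInt σ v).toMonoidHom x ∈ V), V.FiniteIndex ∧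
      HZeroTrivial (Module.finrank K L)
        (restrictEnd (Units.map (localActInt σ v).toMonoidHom) V hV) ∧
      HOneTrivial (Module.finrank K L)
        (restrictEnd (Units.map (localActInt σ v).toMonoidHom) V hV) := by
  have hs := localAct_algebraMap σ v
  let b := IsGalois.normalBasis K L
  let B₀ := baseChangeBasis (k := v.adicCompletion K) hσ (denseRange_localAlg v) hs b
  have hB₀ : ∀ g, localAct σ v (B₀ g) = B₀ (σ * g) := by
    intro g
    simp only [B₀, baseChangeBasis_apply, hs]
    rw [IsGalois.normalBasis_apply g, IsGalois.normalBasis_apply (σ * g)]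
    rfl
  obtain ⟨p, hp0, hp1⟩ := NormedField.exists_norm_lt_one (v.adicCompletion K)
  obtain ⟨B, hB, hmul, hBJ⟩ := exists_scaled_basis B₀ hB₀ (norm_pos_iff.1 hp0) hp1
    (localRad L v) (isOpen_localRad v) fun c hc x hx ↦ smul_mem_localRad v hc hx
  have hcard : Nat.card Gal(L/K) = Module.finrank K L := IsGalois.card_aut_eq_finrank K L
  have := exists_trivial_latticeUnits hB hσ (norm_pos_iff.1 hp0) hp1 hmul (localInt L v)
    (localActInt σ v) (coe_localActInt σ v) (fun a ha ↦ exists_unit_localInt fun w ↦ ?_)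
    (by rw [hcard]; exact localAct_iterate_finrank v hσ)
  · rwa [hcard] at this
  · have ha0 : a ∈ lattice B p 0 := fun g ↦ (ha g).trans (by simpa using hp1.le)
    rw [Pi.add_apply, Pi.one_apply]
    exact Valuation.map_one_add_of_lt _ (hBJ a ha0 w)

/-- General Hilbert 90 with the factors `L_w` as residue fields; distinct powers of `σ` already
differ on `L`. -/
theorem hOneTrivial_localAlg_units (hσ : ∀ τ, τ ∈ Subgroup.zpowers σ) :
    HOneTrivial (Module.finrank K L)
      (Units.map (localAct σ v : LocalAlg L v →+* LocalAlg L v).toMonoidHom) := by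
  obtain ⟨w₀⟩ := (inferInstance : Nonempty (PrimesOver K L v))
  refine hOneTrivial_units_of_residues (ι := PrimesOver K L v) (Module.finrank_pos)
    (fun w ↦ Pi.evalRingHom _ w) (fun x hx ↦ Pi.isUnit_iff.2 fun w ↦ (hx w).isUnit)
    (galOver_transitive hσ v) (fun x w ↦ map_eq_zero (galMap σ w.1))
    (localAct_iterate_finrank v hσ) w₀ fun i hi j hj hij ↦ ?_
  obtain ⟨a, ha⟩ := exists_iterate_ne hσ hi hj hij
  refine ⟨algebraMap L _ a, fun h ↦ ha ?_⟩
  have h1 := iterate_algebraMap (localAct_algebraMap σ v) i a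
  have h2 := iterate_algebraMap (localAct_algebraMap σ v) j a
  refine (algebraMap L (w₀.1.adicCompletion L)).injective ?_
  exact (congrFun h1 w₀).symm.trans (h.trans (congrFun h2 w₀))

variable (σ) in
/-- A prime `v` at which distinct powers of `σ` stay distinct on the residue rings. -/
def IsGood : Prop := ∀ w : PrimesOver K L v, ∀ i < Module.finrank K L, ∀ j < Module.finrank K L,
  i ≠ j → ∃ a : 𝓞 L, (galInt σ)^[i] a - (galInt σ)^[j] a ∉ w.1.asIdeal

/-- For each of the finitely many pairs of distinct powers choose an integer which they separate.
The difference of the two images is nonzero and lies in only finitely many primes. Good primes are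
those with trivial inertia above them, but this form is what Hilbert 90 uses. -/
theorem eventually_isGood (hσ : ∀ τ, τ ∈ Subgroup.zpowers σ) :
    ∀ᶠ v : HeightOneSpectrum (𝓞 K) in Filter.cofinite, IsGood (L := L) σ v := by
  let n := Module.finrank K L
  have h1 : ∀ p : Fin n × Fin n, ∃ a : 𝓞 L, p.1 ≠ p.2 →
      (galInt σ)^[p.1] a - (galInt σ)^[p.2] a ≠ 0 := by
    rintro ⟨i, j⟩
    by_cases hij : i = j
    · exact ⟨0, fun h ↦ (h hij).elim⟩
    obtain ⟨x, hx⟩ := exists_iterate_ne hσ i.2 j.2 (Fin.val_ne_of_ne hij)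
    obtain ⟨a, b, hb, rfl⟩ := IsFractionRing.div_surjective (A := 𝓞 L) x
    have hit : ∀ (m : ℕ) (a : 𝓞 L), σ^[m] (algebraMap (𝓞 L) L a) =
        algebraMap (𝓞 L) L ((galInt σ)^[m] a) := by
      intro m
      induction m with
      | zero => exact fun a ↦ rfl
      | succ m ih => exact fun a ↦ ih (galInt σ a)
    by_contra! h
    refine hx ?_
    have h' : ∀ a, (galInt σ)^[i] a = (galInt σ)^[j] a := fun a ↦ sub_eq_zero.1 (h a).2
    rw [iterate_eq_pow_apply, iterate_eq_pow_apply, map_div₀, map_div₀, ← iterate_eq_pow_apply,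
      ← iterate_eq_pow_apply, ← iterate_eq_pow_apply, ← iterate_eq_pow_apply, hit, hit, hit, hit,
      h', h']
  choose a ha using h1
  have hfin : {w : HeightOneSpectrum (𝓞 L) | ∃ p : Fin n × Fin n, p.1 ≠ p.2 ∧
      (galInt σ)^[p.1] (a p) - (galInt σ)^[p.2] (a p) ∈ w.asIdeal}.Finite := by
    simp only [Set.ofPred_exists]
    refine Set.finite_iUnion fun p ↦ ?_
    by_cases hp : p.1 = p.2
    · simp [hp]
    refine (Ideal.finite_factors (I := Ideal.span {(galInt σ)^[p.1] (a p) - (galInt σ)^[p.2] (a p)})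
      (by simpa using ha p hp)).subset fun w hw ↦ ?_
    rw [Set.mem_ofPred_eq, Ideal.dvd_span_singleton]
    exact hw.2
  refine Set.Finite.subset
    (hfin.biUnion (t := fun w ↦ {v | w.asIdeal.LiesOver v.asIdeal}) fun w _ ↦ ?_) ?_
  · refine Set.Subsingleton.finite fun v hv v' hv' ↦ HeightOneSpectrum.ext ?_
    rw [hv.over, hv'.over]
  · intro v hv
    by_contra h
    refine hv fun w i hi j hj hij ↦ ⟨a (⟨i, hi⟩, ⟨j, hj⟩), fun hmem ↦ h ?_⟩
    exact Set.mem_biUnion ⟨(⟨i, hi⟩, ⟨j, hj⟩), by simpa using hij, hmem⟩ w.2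

variable {v} in
theorem hOneTrivial_localInt_units (hσ : ∀ τ, τ ∈ Subgroup.zpowers σ) (hv : IsGood (L := L) σ v) :
    HOneTrivial (Module.finrank K L) (Units.map (localActInt σ v).toMonoidHom) := by
  obtain ⟨w₀⟩ := (inferInstance : Nonempty (PrimesOver K L v))
  let ev : ∀ w : PrimesOver K L v, localInt L v →+* w.1.adicCompletionIntegers L := fun w ↦
    { toFun := fun x ↦ ⟨x.1 w, x.2 w⟩
      map_one' := rfl
      map_mul' := fun _ _ ↦ rfl
      map_zero' := rfl
      map_add' := fun _ _ ↦ rfl }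
  let π : ∀ w : PrimesOver K L v, localInt L v →+*
      IsLocalRing.ResidueField (w.1.adicCompletionIntegers L) := fun w ↦
    (IsLocalRing.residue _).comp (ev w)
  have hπ : ∀ w x, π w x = 0 ↔ Valued.v (x.1 w) < 1 := fun w x ↦
    (IsLocalRing.residue_eq_zero_iff _).trans (Valuation.mem_maximalIdeal_iff _ _)
  refine hOneTrivial_units_of_residues (Module.finrank_pos) π (fun x hx ↦ ?_)
    (galOver_transitive hσ v) (fun x w ↦ ?_) (fun x ↦ Subtype.ext ?_) w₀ fun i hi j hj hij ↦ ?_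
  · obtain ⟨u, hu⟩ := exists_unit_localInt (x := x.1) fun w ↦
      le_antisymm (x.2 w) (not_lt.1 fun h ↦ hx w ((hπ w x).2 h))
    exact ⟨u, Subtype.ext hu⟩
  · rw [hπ, hπ, coe_localActInt, valued_localAct]
  · rw [coe_localActInt_iterate, localAct_iterate_finrank v hσ]
  · obtain ⟨a, ha⟩ := hv w₀ i hi j hj hij
    let x : localInt L v := ⟨algebraMap L _ (algebraMap (𝓞 L) L a), fun w ↦
      HeightOneSpectrum.coe_algebraMap_mem (R := 𝓞 L) L w.1 a⟩
    have hit : ∀ m : ℕ, ((localActInt σ v)^[m] x).1 w₀ =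
        algebraMap L (w₀.1.adicCompletion L) (algebraMap (𝓞 L) L ((galInt σ)^[m] a)) := by
      intro m
      rw [coe_localActInt_iterate]
      have : (localAct σ v)^[m] x.1 = _ := iterate_algebraMap (localAct_algebraMap σ v) m _
      rw [this]
      change algebraMap L (w₀.1.adicCompletion L) _ = _
      congr 1
      clear this
      generalize a = b
      induction m generalizing b with
      | zero => rfl
      | succ m ih => exact ih (galInt σ b)
    refine ⟨x, fun h ↦ ha ?_⟩
    rw [← sub_eq_zero, ← map_sub, hπ] at h
    rw [← HeightOneSpectrum.intValuation_lt_one_iff_mem,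
      ← HeightOneSpectrum.valuation_of_algebraMap (K := L)]
    refine lt_of_eq_of_lt ?_ h
    rw [← HeightOneSpectrum.valuedAdicCompletion_eq_valuation']
    have h2 : (((localActInt σ v)^[i] x - (localActInt σ v)^[j] x : localInt L v) :
        LocalAlg L v) w₀ = ((localActInt σ v)^[i] x).1 w₀ - ((localActInt σ v)^[j] x).1 w₀ := rfl
    rw [h2, hit, hit, ← map_sub, ← map_sub]
    rfl

end LocalAction

/-! ### Herbrand quotients of infinite products. -/

section Product

variable {ι : Type*} {M : ι → Type*} [∀ v, CommGroup (M v)] {n : ℕ}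

theorem iterate_piMap_apply (s : ∀ v, M v →* M v) (i : ℕ) (x : ∀ v, M v) (v : ι) :
    (MonoidHom.piMap s)^[i] x v = (s v)^[i] (x v) :=
  map_iterate_of_equivariant (s := MonoidHom.piMap s) (s' := s v) (φ := Pi.evalMonoidHom M v)
    (fun _ ↦ rfl) i x

theorem cycNorm_piMap_apply (s : ∀ v, M v →* M v) (x : ∀ v, M v) (v : ι) :
    cycNorm n (MonoidHom.piMap s) x v = cycNorm n (s v) (x v) := by
  rw [cycNorm_apply, cycNorm_apply, Finset.prod_apply]
  exact Finset.prod_congr rfl fun i _ ↦ iterate_piMap_apply s i x v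

theorem coe_cycNorm_restrictEnd {G : Type*} [CommGroup G] {s : G →* G} {H : Subgroup G}
    (h : ∀ x ∈ H, s x ∈ H) (x : H) : (cycNorm n (restrictEnd s H h) x : G) = cycNorm n s x :=
  DFunLike.congr_fun (comp_cycNorm (s := restrictEnd s H h) (s' := s) (φ := H.subtype) n
    fun _ ↦ rfl) x

/-- A product of groups, each having a cohomologically trivial stable subgroup of finite index
which is the whole group for almost all factors, has Herbrand quotient `1`. -/
theorem herbrandQuot_piMap_of_trivial {s : ∀ v, M v →* M v} (hs : ∀ v x, (s v)^[n] x = x)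
    {S : Set ι} (hS : S.Finite) (h0 : ∀ v ∉ S, HZeroTrivial n (s v))
    (h1 : ∀ v ∉ S, HOneTrivial n (s v))
    (hV : ∀ v, ∃ (V : Subgroup (M v)) (hV : ∀ x ∈ V, s v x ∈ V), V.FiniteIndex ∧
      HZeroTrivial n (restrictEnd (s v) V hV) ∧ HOneTrivial n (restrictEnd (s v) V hV)) :
    HerbrandQuot n (MonoidHom.piMap s) 1 := by
  classical
  choose V hV hfin hV0 hV1 using hV
  have : Finite S := hS
  -- Conditions are imposed only at the finite set `S`, so `W` has finite index, and `W` is trivial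
  -- factor by factor. Quotient `1` in every factor would not be enough: infinitely many nontrivial
  -- indices could not be compared.
  let W : Subgroup (∀ v, M v) := ⨅ v : S, (V v).comap (Pi.evalMonoidHom M v)
  have hmemW : ∀ x, x ∈ W ↔ ∀ v ∈ S, x v ∈ V v := fun x ↦ by
    simp only [W, Subgroup.mem_iInf, Subgroup.mem_comap, Subtype.forall]
    rfl
  have hWfin : W.FiniteIndex := Subgroup.finiteIndex_iInf fun v ↦ by
    refine ⟨?_⟩
    rw [Subgroup.index_comap_of_surjective _ (Function.surjective_eval v.1)]
    exact (hfin v).index_ne_zero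
  have hWst : ∀ x ∈ W, MonoidHom.piMap s x ∈ W := fun x hx ↦ by
    rw [hmemW] at hx ⊢
    exact fun v hv ↦ hV v _ (hx v hv)
  refine HerbrandQuot.of_finiteIndex_subgroup hWst (fun x ↦ funext fun v ↦ ?_)
    (HerbrandQuot.of_trivial ?_ ?_)
  · rw [iterate_piMap_apply, hs]
  · rintro ⟨x, hx⟩ hsx
    have hsx' : ∀ v, s v (x v) = x v := fun v ↦ congrFun (congrArg Subtype.val hsx) v
    have hy : ∀ v, ∃ y, cycNorm n (s v) y = x v ∧ (v ∈ S → y ∈ V v) := by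
      intro v
      by_cases hv : v ∈ S
      · obtain ⟨y, hy⟩ := hV0 v ⟨x v, (hmemW x).1 hx v hv⟩ (Subtype.ext (hsx' v))
        exact ⟨y, (coe_cycNorm_restrictEnd (hV v) y).symm.trans (congrArg Subtype.val hy),
          fun _ ↦ y.2⟩
      · obtain ⟨y, hy⟩ := h0 v hv (x v) (hsx' v)
        exact ⟨y, hy, fun h ↦ (hv h).elim⟩
    choose y hy hyV using hy
    refine ⟨⟨y, (hmemW y).2 hyV⟩, Subtype.ext ?_⟩
    rw [coe_cycNorm_restrictEnd]
    exact funext fun v ↦ (cycNorm_piMap_apply s y v).trans (hy v)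
  · rintro ⟨x, hx⟩ hsx
    have hsx' : ∀ v, cycNorm n (s v) (x v) = 1 := fun v ↦ by
      rw [← cycNorm_piMap_apply, ← coe_cycNorm_restrictEnd hWst ⟨x, hx⟩, hsx]
      rfl
    have hy : ∀ v, ∃ y, cycDiff (s v) y = x v ∧ (v ∈ S → y ∈ V v) := by
      intro v
      by_cases hv : v ∈ S
      · obtain ⟨y, hy⟩ := hV1 v ⟨x v, (hmemW x).1 hx v hv⟩
          (Subtype.ext ((coe_cycNorm_restrictEnd (hV v) _).trans (hsx' v)))
        exact ⟨y, congrArg Subtype.val hy, fun _ ↦ y.2⟩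
      · obtain ⟨y, hy⟩ := h1 v hv (x v) (hsx' v)
        exact ⟨y, hy, fun h ↦ (hv h).elim⟩
    choose y hy hyV using hy
    exact ⟨⟨y, (hmemW y).2 hyV⟩, Subtype.ext (funext hy)⟩

end Product

/-! ### Units of the integers at all finite places. -/

section FiniteIntegralIdeles

variable {K L : Type*} [Field K] [NumberField K] [Field L] [NumberField L] [Algebra K L]
  [IsGalois K L] {σ : Gal(L/K)}

/-- The action on the units of the product of the valuation rings over `v`. -/
abbrev localUnitsAct (σ : Gal(L/K)) (v : HeightOneSpectrum (𝓞 K)) :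
    (localInt L v)ˣ →* (localInt L v)ˣ := Units.map (localActInt σ v).toMonoidHom

theorem localUnitsAct_iterate_finrank (hσ : ∀ τ, τ ∈ Subgroup.zpowers σ)
    (v : HeightOneSpectrum (𝓞 K)) (x : (localInt L v)ˣ) :
    (localUnitsAct σ v)^[Module.finrank K L] x = x := by
  refine Units.ext (Subtype.ext ?_)
  rw [coe_iterate_unitsMap (s := localAct σ v) (coe_localActInt σ v), localAct_iterate_finrank v hσ]

theorem herbrandQuot_localInt_units (hσ : ∀ τ, τ ∈ Subgroup.zpowers σ)
    (v : HeightOneSpectrum (𝓞 K)) :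
    HerbrandQuot (Module.finrank K L) (localUnitsAct (L := L) σ v) 1 := by
  obtain ⟨V, hV, hfin, h0, h1⟩ := exists_trivial_localInt_units (L := L) v hσ
  exact HerbrandQuot.of_finiteIndex_subgroup hV (localUnitsAct_iterate_finrank hσ v)
    (HerbrandQuot.of_trivial h0 h1)

theorem herbrandQuot_pi_localInt_units (hσ : ∀ τ, τ ∈ Subgroup.zpowers σ) :
    HerbrandQuot (Module.finrank K L)
      (MonoidHom.piMap fun v : HeightOneSpectrum (𝓞 K) ↦ localUnitsAct (L := L) σ v) 1 := by
  refine herbrandQuot_piMap_of_trivial (S := {v | ¬ IsGood (L := L) σ v})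
    (localUnitsAct_iterate_finrank hσ) (eventually_isGood hσ) (fun v hv ↦ ?_) (fun v hv ↦ ?_)
    fun v ↦ exists_trivial_localInt_units v hσ
  · exact (herbrandQuot_localInt_units hσ v).hZeroTrivial
      (hOneTrivial_localInt_units hσ (not_not.1 hv))
  · exact hOneTrivial_localInt_units hσ (not_not.1 hv)

end FiniteIntegralIdeles

open scoped NumberField.LiesOver

/-! ### The Galois action on infinite places and their completions. -/

section InfinitePlaceAction

variable {K L : Type*} [Field K] [NumberField K] [Field L] [NumberField L] [Algebra K L]

instance (v : InfinitePlace K) : NontriviallyNormedField v.Completion :=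
  { (inferInstance : NormedField v.Completion) with
    non_trivial := ⟨2, by
      have h := (InfinitePlace.Completion.isometry_extensionEmbedding v).norm_map_of_map_zero
        (map_zero _) 2
      rw [map_ofNat] at h
      rw [← h]
      norm_num⟩ }

theorem isometry_galInf (σ : Gal(L/K)) (w : InfinitePlace L) :
    Isometry (((WithAbs.equiv w.1).symm.toRingHom.comp (σ : L →+* L)).comp
      (WithAbs.equiv (w.comap (σ : L →+* L)).1).toRingHom) :=
  AddMonoidHomClass.isometry_of_norm _ fun _ ↦ rfl

/-- The extension of a field automorphism to the completions at infinite places. -/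
def galInfMap (σ : Gal(L/K)) (w : InfinitePlace L) :
    (w.comap (σ : L →+* L)).Completion →+* w.Completion :=
  ((InfinitePlace.Completion.equiv w).symm.toRingHom.comp (isometry_galInf σ w).mapRingHom).comp
    (InfinitePlace.Completion.equiv (w.comap (σ : L →+* L))).toRingHom

theorem continuous_galInfMap (σ : Gal(L/K)) (w : InfinitePlace L) :
    Continuous (galInfMap σ w) :=
  (InfinitePlace.Completion.continuous_ofCompletion w).comp <|
    UniformSpace.Completion.continuous_map.comp (InfinitePlace.Completion.continuous_toCompletion _)

theorem galInfMap_algebraMap (σ : Gal(L/K)) (w : InfinitePlace L) (x : L) :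
    galInfMap σ w (algebraMap L _ x) = algebraMap L _ (σ x) :=
  InfinitePlace.Completion.ext <| (isometry_galInf σ w).mapRingHom_coe _

theorem denseRange_algebraMap_infinite {F : Type*} [Field F] (v : InfinitePlace F) :
    DenseRange (algebraMap F v.Completion) := by
  have := InfinitePlace.Completion.denseRange_coe v
  rwa [DenseRange, ← (WithAbs.equiv v.1).symm.surjective.range_comp] at this

variable (K L) in
/-- The infinite places of `L` over an infinite place of `K`. -/
abbrev InfOver (v : InfinitePlace K) : Type _ := {w : InfinitePlace L // w.LiesOver v}

theorem comap_liesOver (σ : Gal(L/K)) (v : InfinitePlace K) (w : InfinitePlace L)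
    [w.LiesOver v] : (w.comap (σ : L →+* L)).LiesOver v := by
  refine ⟨?_⟩
  refine AbsoluteValue.ext fun x ↦ ?_
  have h : σ (algebraMap K L x) = algebraMap K L x := σ.commutes x
  have h2 := InfinitePlace.comp_of_comap_eq (InfinitePlace.LiesOver.comap_eq w v) x
  refine Eq.trans ?_ h2
  change w (σ (algebraMap K L x)) = _
  rw [h]

/-- The action of a field automorphism on the infinite places over `v`. -/
def infOver (σ : Gal(L/K)) (v : InfinitePlace K) (w : InfOver K L v) : InfOver K L v :=
  ⟨w.1.comap (σ : L →+* L), haveI := w.2; comap_liesOver σ v w.1⟩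

theorem infOver_injective (σ : Gal(L/K)) (v : InfinitePlace K) :
    Function.Injective (infOver (L := L) σ v) := by
  intro w w' h
  refine Subtype.ext (InfinitePlace.ext _ _ fun x ↦ ?_)
  have h1 := DFunLike.congr_fun (congrArg Subtype.val h) (σ.symm x)
  change w.1 (σ (σ.symm x)) = w'.1 (σ (σ.symm x)) at h1
  rwa [AlgEquiv.apply_symm_apply] at h1

theorem infOver_iterate (σ : Gal(L/K)) (v : InfinitePlace K) (w : InfOver K L v) (j : ℕ) (x : L) :
    ((infOver σ v)^[j] w).1 x = w.1 ((σ ^ j) x) := by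
  induction j generalizing x with
  | zero => rfl
  | succ j ih =>
    rw [Function.iterate_succ_apply', pow_succ, AlgEquiv.mul_apply, ← ih]
    rfl

theorem infOver_transitive [IsGalois K L] {σ : Gal(L/K)} (hσ : ∀ τ, τ ∈ Subgroup.zpowers σ)
    (v : InfinitePlace K) (w w' : InfOver K L v) : ∃ j : ℕ, (infOver σ v)^[j] w = w' := by
  have := w.2
  have := w'.2
  obtain ⟨τ, hτ⟩ := InfinitePlace.exists_smul_eq_of_comap_eq (k := K) (w := w.1) (w' := w'.1)
    ((InfinitePlace.LiesOver.comap_eq w.1 v).trans (InfinitePlace.LiesOver.comap_eq w'.1 v).symm)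
  obtain ⟨j, hj⟩ := mem_powers_iff_mem_zpowers.2 (hσ τ⁻¹)
  refine ⟨j, Subtype.ext (InfinitePlace.ext _ _ fun x ↦ ?_)⟩
  change σ ^ j = τ⁻¹ at hj
  rw [infOver_iterate, hj, ← hτ]
  rfl

variable (L) in
/-- The product of the completions of `L` at the infinite places over `v`. -/
abbrev InfLocalAlg (v : InfinitePlace K) : Type _ := ∀ w : InfOver K L v, w.1.Completion

instance (v : InfinitePlace K) (w : InfOver K L v) : Algebra v.Completion w.1.Completion :=
  haveI := w.2; inferInstance

instance (v : InfinitePlace K) (w : InfOver K L v) :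
    IsScalarTower K v.Completion w.1.Completion :=
  haveI := w.2; inferInstance

instance (v : InfinitePlace K) (w : InfOver K L v) : ContinuousSMul v.Completion w.1.Completion :=
  haveI := w.2; inferInstance

instance (w : InfinitePlace L) : IsScalarTower K L w.Completion :=
  .of_algebraMap_eq fun x ↦ by
    apply InfinitePlace.Completion.ext
    rw [InfinitePlace.Completion.algebraMap_toCompletion,
      InfinitePlace.Completion.algebraMap_toCompletion]
    simp only [UniformSpace.Completion.algebraMap_def]
    rfl

theorem galInfMap_completionMap (σ : Gal(L/K)) (v : InfinitePlace K) (w : InfOver K L v)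
    (x : v.Completion) :
    galInfMap σ w.1 (algebraMap v.Completion (infOver σ v w).1.Completion x) =
      algebraMap v.Completion w.1.Completion x := by
  refine (denseRange_algebraMap_infinite v).induction_on x (isClosed_eq
    ((continuous_galInfMap σ w.1).comp
      (continuous_algebraMap v.Completion (infOver σ v w).1.Completion))
    (continuous_algebraMap _ _)) fun a ↦ ?_
  rw [← IsScalarTower.algebraMap_apply, ← IsScalarTower.algebraMap_apply,
    IsScalarTower.algebraMap_apply K L w.1.Completion]
  refine Eq.trans ?_ ((galInfMap_algebraMap σ w.1 (algebraMap K L a)).trans ?_)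
  · exact congrArg (galInfMap σ w.1)
      (IsScalarTower.algebraMap_apply K L (infOver σ v w).1.Completion a)
  · rw [σ.commutes]

/-- The action of a field automorphism on the product of the completions over `v`. -/
def infAct (σ : Gal(L/K)) (v : InfinitePlace K) :
    InfLocalAlg L v →ₐ[v.Completion] InfLocalAlg L v :=
  AlgHom.mk
    { toFun := fun x w ↦ galInfMap σ w.1 (x (infOver σ v w))
      map_one' := funext fun w ↦ map_one (galInfMap σ w.1)
      map_mul' := fun _ _ ↦ funext fun w ↦ map_mul (galInfMap σ w.1) _ _
      map_zero' := funext fun w ↦ map_zero (galInfMap σ w.1)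
      map_add' := fun _ _ ↦ funext fun w ↦ map_add (galInfMap σ w.1) _ _ } fun a ↦ funext fun w ↦
    galInfMap_completionMap σ v w a

theorem infAct_algebraMap (σ : Gal(L/K)) (v : InfinitePlace K) (x : L) :
    infAct σ v (algebraMap L _ x) = algebraMap L _ (σ x) :=
  funext fun w ↦ galInfMap_algebraMap σ w.1 x

theorem denseRange_infLocalAlg (v : InfinitePlace K) :
    DenseRange (algebraMap L (InfLocalAlg L v)) := by
  let p : InfiniteAdeleRing L → InfLocalAlg L v := fun x w ↦ x w.1
  have hp : Continuous p := continuous_pi fun w ↦ continuous_apply w.1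
  have hps : Function.Surjective p := by
    classical
    intro y
    refine ⟨fun w ↦ if h : w.LiesOver v then y ⟨w, h⟩ else 0, funext fun w ↦ ?_⟩
    simp [p, w.2]
  exact hps.denseRange.comp (InfiniteAdeleRing.denseRange_algebraMap L) hp

instance (v : InfinitePlace K) (w : InfOver K L v) :
    FiniteDimensional v.Completion w.1.Completion := by
  have := w.2
  refine Module.finite_of_finrank_pos ?_
  rcases w.1.isUnramified_or_isRamified K with h | h
  · have := h.finrank_eq_one v
    exact this.symm ▸ one_pos
  · have := h.finrank_eq_two v
    exact this.symm ▸ two_pos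

variable [IsGalois K L] {σ : Gal(L/K)} (v : InfinitePlace K)

instance : Nonempty (InfOver K L v) := by
  obtain ⟨w, hw⟩ := InfinitePlace.comap_surjective (K := L) v
  exact ⟨⟨w, ⟨AbsoluteValue.ext fun x ↦ DFunLike.congr_fun hw x⟩⟩⟩

theorem infAct_iterate_finrank (hσ : ∀ τ, τ ∈ Subgroup.zpowers σ) (x : InfLocalAlg L v) :
    (infAct σ v)^[Module.finrank K L] x = x :=
  iterate_finrank_eq hσ (denseRange_infLocalAlg v) (infAct_algebraMap σ v) x

theorem hOneTrivial_infLocalAlg_units (hσ : ∀ τ, τ ∈ Subgroup.zpowers σ) :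
    HOneTrivial (Module.finrank K L)
      (Units.map (infAct σ v : InfLocalAlg L v →+* InfLocalAlg L v).toMonoidHom) := by
  obtain ⟨w₀⟩ := (inferInstance : Nonempty (InfOver K L v))
  refine hOneTrivial_units_of_residues (ι := InfOver K L v) (Module.finrank_pos)
    (fun w ↦ Pi.evalRingHom _ w) (fun x hx ↦ Pi.isUnit_iff.2 fun w ↦ (hx w).isUnit)
    (infOver_transitive hσ v) (fun x w ↦ map_eq_zero (galInfMap σ w.1))
    (infAct_iterate_finrank v hσ) w₀ fun i hi j hj hij ↦ ?_
  obtain ⟨a, ha⟩ := exists_iterate_ne hσ hi hj hij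
  refine ⟨algebraMap L _ a, fun h ↦ ha ?_⟩
  have h1 := iterate_algebraMap (infAct_algebraMap σ v) i a
  have h2 := iterate_algebraMap (infAct_algebraMap σ v) j a
  refine (algebraMap L w₀.1.Completion).injective ?_
  exact (congrFun h1 w₀).symm.trans (h.trans (congrFun h2 w₀))

end InfinitePlaceAction

/-! ### Norm index and Tate cohomology of the units of a local algebra. -/

section LocalUnits

variable {K L : Type*} [Field K] [Field L] [Algebra K L] [FiniteDimensional K L] [IsGalois K L]
  {σ : Gal(L/K)}
  {k : Type*} [NontriviallyNormedField k] [CompleteSpace k] [Algebra K k]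
  {A : Type*} [CommRing A] [Nontrivial A] [TopologicalSpace A] [IsTopologicalRing A] [T2Space A]
  [Algebra k A] [ContinuousSMul k A] [Algebra L A] [Algebra K A] [IsScalarTower K k A]
  [IsScalarTower K L A]

theorem coe_iterate_units_map (s : A →ₐ[k] A) (i : ℕ) (u : Aˣ) :
    (((Units.map (s : A →+* A).toMonoidHom)^[i] u : Aˣ) : A) = s^[i] (u : A) := by
  induction i with
  | zero => rfl
  | succ i ih => rw [Function.iterate_succ_apply', Function.iterate_succ_apply', ← ih]; rfl

theorem cycNorm_units_map (hσ : ∀ τ, τ ∈ Subgroup.zpowers σ)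
    (hd : DenseRange (algebraMap L A)) {s : A →ₐ[k] A}
    (hs : ∀ x, s (algebraMap L A x) = algebraMap L A (σ x)) (u : Aˣ) :
    cycNorm (Module.finrank K L) (Units.map (s : A →+* A).toMonoidHom) u =
      Units.map (algebraMap k A).toMonoidHom (Units.map (Algebra.norm k : A →* k) u) := by
  apply Units.ext
  rw [cycNorm_apply, Units.coe_prod]
  simp only [coe_iterate_units_map]
  exact (algebraMap_norm_eq_prod hσ hd hs (u : A)).symm

theorem ker_cycDiff_units_map (hσ : ∀ τ, τ ∈ Subgroup.zpowers σ)
    (hd : DenseRange (algebraMap L A)) {s : A →ₐ[k] A}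
    (hs : ∀ x, s (algebraMap L A x) = algebraMap L A (σ x)) :
    (cycDiff (Units.map (s : A →+* A).toMonoidHom)).ker =
      (Units.map (algebraMap k A).toMonoidHom).range := by
  ext u
  rw [mem_ker_cycDiff, MonoidHom.mem_range]
  constructor
  · intro hu
    obtain ⟨a, ha⟩ := mem_range_of_fixed (k := k) hσ hd hs (x := (u : A)) (congrArg Units.val hu)
    have ha0 : a ≠ 0 := by
      rintro rfl
      exact u.ne_zero (by rw [ha, map_zero])
    exact ⟨Units.mk0 a ha0, Units.ext ha.symm⟩
  · rintro ⟨a, rfl⟩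
    exact Units.ext (s.commutes a)

/-- The fixed units are the units of `k`, and the product of the iterates is the algebra norm, so
both groups are pulled back along the injection of units of `k`. -/
theorem relIndex_cycNorm_units_map (hσ : ∀ τ, τ ∈ Subgroup.zpowers σ)
    (hd : DenseRange (algebraMap L A)) {s : A →ₐ[k] A}
    (hs : ∀ x, s (algebraMap L A x) = algebraMap L A (σ x)) :
    (cycNorm (Module.finrank K L) (Units.map (s : A →+* A).toMonoidHom)).range.relIndex
      (cycDiff (Units.map (s : A →+* A).toMonoidHom)).ker =
        (Units.map (Algebra.norm k : A →* k)).range.index := by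
  have h1 : (cycNorm (Module.finrank K L) (Units.map (s : A →+* A).toMonoidHom)).range =
      (Units.map (Algebra.norm k : A →* k)).range.map (Units.map (algebraMap k A).toMonoidHom) := by
    rw [MonoidHom.map_range]
    congr 1
    exact MonoidHom.ext fun u ↦ cycNorm_units_map hσ hd hs u
  rw [h1, ker_cycDiff_units_map hσ hd hs, MonoidHom.range_eq_map (Units.map (algebraMap k A).toMonoidHom),
    Subgroup.relIndex_map_map_of_injective, Subgroup.relIndex_top_right]
  exact Units.map_injective (algebraMap k A).injective

end LocalUnits

/-! ### The local norm index at an infinite place. -/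

section InfiniteIndex

open scoped NumberField.LiesOver

variable {K L : Type*} [Field K] [NumberField K] [Field L] [NumberField L] [Algebra K L]
  [IsGalois K L] {σ : Gal(L/K)} (v : InfinitePlace K)

open scoped Classical in
theorem norm_mulSingle_infLocalAlg (w : InfOver K L v) (b : v.Completion) :
    Algebra.norm v.Completion (Pi.mulSingle w (algebraMap v.Completion w.1.Completion b) :
      InfLocalAlg L v) = b ^ Module.finrank v.Completion w.1.Completion := by
  rw [norm_pi_apply, Finset.prod_eq_single w, Pi.mulSingle_eq_same, Algebra.norm_algebraMap]
  · intro w' _ h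
    rw [Pi.mulSingle_eq_of_ne h, map_one]
  · simp

theorem exists_norm_unit_infLocalAlg (w : InfOver K L v) (b : v.Completionˣ) :
    b ^ Module.finrank v.Completion w.1.Completion ∈
      (Units.map (Algebra.norm v.Completion : InfLocalAlg L v →* v.Completion)).range := by
  classical
  refine ⟨(Pi.isUnit_iff (x := (Pi.mulSingle w (algebraMap v.Completion w.1.Completion b) :
      InfLocalAlg L v)).2 fun w' ↦ ?_).unit, Units.ext ?_⟩
  · by_cases h : w' = w
    · subst h
      rw [Pi.mulSingle_eq_same]
      exact b.isUnit.map _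
    · rw [Pi.mulSingle_eq_of_ne h]
      exact isUnit_one
  · rw [Units.coe_map, IsUnit.unit_spec]
    exact norm_mulSingle_infLocalAlg v w b

open InfinitePlace.Completion in
theorem norm_pos_of_isRamified (hv : v.IsReal) (w : InfOver K L v) (hw : w.1.IsRamified K)
    {x : w.1.Completion} (hx : x ≠ 0) :
    0 < ringEquivRealOfIsReal hv (Algebra.norm v.Completion x) := by
  have := w.2
  have := InfinitePlace.LiesOver.extensionEmbedding_liesOver_of_isReal w.1 hv
  rw [Algebra.norm_eq_of_equiv_equiv (ringEquivRealOfIsReal hv)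
      (ringEquivComplexOfIsComplex hw.isComplex) (by ext; simp), RingEquiv.apply_symm_apply,
    Algebra.norm_complex_apply, Complex.normSq_pos]
  simpa using hx

theorem finrank_infOver_eq (hσ : ∀ τ, τ ∈ Subgroup.zpowers σ) (w w' : InfOver K L v) :
    Module.finrank v.Completion w'.1.Completion = Module.finrank v.Completion w.1.Completion := by
  have hm : ∀ u : InfOver K L v,
      v.mult * Module.finrank v.Completion u.1.Completion = u.1.mult := fun u ↦
    haveI := u.2
    InfinitePlace.mult_mul_finrank v u.1
  refine Nat.eq_of_mul_eq_mul_left v.mult_pos ?_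
  rw [hm, hm]
  refine forall_of_transitive (infOver_transitive hσ v) (P := fun u ↦ u.1.mult = w.1.mult)
    (fun u ↦ ?_) rfl w'
  have : (infOver σ v u).1.mult = u.1.mult := by
    have h : (infOver σ v u).1.IsReal ↔ u.1.IsReal :=
      InfinitePlace.isReal_comap_iff (f := σ.toRingEquiv)
    unfold InfinitePlace.mult
    split_ifs <;> tauto
  rw [this]

/-- The local degrees over `v` add up to `[L:K]` and are equal to each other, since the action on
the places over `v` is transitive. -/
theorem card_infOver_mul_finrank (hσ : ∀ τ, τ ∈ Subgroup.zpowers σ) (w : InfOver K L v) :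
    Nat.card (InfOver K L v) * Module.finrank v.Completion w.1.Completion =
      Module.finrank K L := by
  classical
  rw [← InfinitePlace.sum_inertiaDeg_eq_finrank K L v,
    Finset.sum_congr rfl (g := fun _ ↦ Module.finrank v.Completion w.1.Completion),
    Finset.sum_const, smul_eq_mul, Set.toFinset_card, Nat.card_eq_fintype_card]
  · rfl
  · intro u hu
    rw [Set.mem_toFinset] at hu
    have : u.LiesOver v := hu
    rw [InfinitePlace.inertiaDeg_eq_finrank]
    exact finrank_infOver_eq v hσ w ⟨u, hu⟩

/-- In local degree one, elements supported at a single place already give every norm. In local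
degree two all completions over the real place `v` are complex, and the norms are exactly the
positive reals: positive as products of squared moduli, and all of them by taking square roots. -/
theorem index_norm_infLocalAlg (hσ : ∀ τ, τ ∈ Subgroup.zpowers σ) (w : InfOver K L v) :
    (Units.map (Algebra.norm v.Completion : InfLocalAlg L v →* v.Completion)).range.index =
      Module.finrank v.Completion w.1.Completion := by
  have := w.2
  rcases w.1.isUnramified_or_isRamified K with h | h
  · have h1 : Module.finrank v.Completion w.1.Completion = 1 := h.finrank_eq_one v
    rw [h1, Subgroup.index_eq_one, eq_top_iff]
    intro b _
    have := exists_norm_unit_infLocalAlg v w b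
    rwa [h1, pow_one] at this
  · have h2 : Module.finrank v.Completion w.1.Completion = 2 := h.finrank_eq_two v
    have hv : v.IsReal := by
      have := h.isReal
      rwa [InfinitePlace.LiesOver.comap_eq w.1 v] at this
    let r := InfinitePlace.Completion.ringEquivRealOfIsReal hv
    have hram : ∀ u : InfOver K L v, u.1.IsRamified K := fun u ↦ by
      have := u.2
      refine (u.1.isUnramified_or_isRamified K).resolve_left fun hu ↦ ?_
      have h3 : Module.finrank v.Completion u.1.Completion = 1 := hu.finrank_eq_one v
      rw [finrank_infOver_eq v hσ w u, h2] at h3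
      omega
    have hmem : ∀ b : v.Completionˣ, b ∈
        (Units.map (Algebra.norm v.Completion : InfLocalAlg L v →* v.Completion)).range ↔
          0 < r b := by
      intro b
      constructor
      · classical
        rintro ⟨x, rfl⟩
        rw [Units.coe_map]
        change 0 < r (Algebra.norm v.Completion (x : InfLocalAlg L v))
        rw [norm_pi_apply, map_prod]
        exact Finset.prod_pos fun u _ ↦ norm_pos_of_isRamified v hv u (hram u)
          (Pi.isUnit_iff.1 x.isUnit u).ne_zero
      · intro hb
        have hs0 : r.symm (Real.sqrt (r b)) ≠ 0 := by
          simpa using (Real.sqrt_pos.2 hb).ne'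
        have := exists_norm_unit_infLocalAlg v w (Units.mk0 _ hs0)
        rw [h2] at this
        convert this using 1
        apply Units.ext
        rw [Units.val_pow_eq_pow_val, Units.val_mk0, ← map_pow, Real.sq_sqrt hb.le,
          RingEquiv.symm_apply_apply]
    rw [h2, Subgroup.index_eq_two_iff]
    refine ⟨-1, fun b ↦ ?_⟩
    rw [hmem, hmem]
    have hb : r b ≠ 0 := by simp
    have : r ((b * -1 : v.Completionˣ) : v.Completion) = - r b := by simp
    rw [this]
    rcases hb.lt_or_gt with h | h
    · exact Or.inl ⟨by linarith, by linarith⟩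
    · exact Or.inr ⟨by linarith, by linarith⟩

/-- The action on the units of the product of the completions over an infinite place. -/
abbrev infUnitsAct (σ : Gal(L/K)) (v : InfinitePlace K) :
    (InfLocalAlg L v)ˣ →* (InfLocalAlg L v)ˣ :=
  Units.map (infAct σ v : InfLocalAlg L v →+* InfLocalAlg L v).toMonoidHom

theorem infUnitsAct_iterate_finrank (hσ : ∀ τ, τ ∈ Subgroup.zpowers σ) (x : (InfLocalAlg L v)ˣ) :
    (infUnitsAct σ v)^[Module.finrank K L] x = x := by
  apply Units.ext
  rw [coe_iterate_units_map, infAct_iterate_finrank v hσ]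

theorem herbrandQuot_infLocalAlg_units (hσ : ∀ τ, τ ∈ Subgroup.zpowers σ) :
    HerbrandQuot (Module.finrank K L) (infUnitsAct (L := L) σ v)
      (Module.finrank K L / Nat.card (InfOver K L v)) := by
  obtain ⟨w⟩ := (inferInstance : Nonempty (InfOver K L v))
  have h0 := relIndex_cycNorm_units_map (k := v.Completion) hσ (denseRange_infLocalAlg v)
    (infAct_algebraMap σ v)
  have h1 := relIndex_right_of_hOneTrivial (hOneTrivial_infLocalAlg_units (L := L) v hσ)
  have hcard := card_infOver_mul_finrank v hσ w
  rw [index_norm_infLocalAlg v hσ w] at h0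
  have hne : Module.finrank v.Completion w.1.Completion ≠ 0 := Module.finrank_pos.ne'
  refine ⟨h0.trans_ne hne, h1.trans_ne one_ne_zero, ?_⟩
  rw [h0, h1, ← hcard]
  have : (Nat.card (InfOver K L v) : ℚ) ≠ 0 := Nat.cast_ne_zero.2 Nat.card_pos.ne'
  push_cast
  field_simp

end InfiniteIndex

/-! ### Permutation modules and an integral relation lemma. -/

section Permutation

theorem index_range_pow_multiplicative_int {d : ℕ} (hd : 0 < d) :
    (powMonoidHom d : Multiplicative ℤ →* Multiplicative ℤ).range.index = d := by
  let f : Multiplicative ℤ →* Multiplicative (ZMod d) :=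
    AddMonoidHom.toMultiplicative (Int.castAddHom (ZMod d))
  have hf : Function.Surjective f := ZMod.intCast_surjective
  have hker : f.ker = (powMonoidHom d : Multiplicative ℤ →* Multiplicative ℤ).range := by
    ext x
    have h : x ∈ f.ker ↔ (d : ℤ) ∣ x.toAdd := ZMod.intCast_zmod_eq_zero_iff_dvd _ _
    rw [h]
    constructor
    · rintro ⟨c, hc⟩
      exact ⟨Multiplicative.ofAdd c, Multiplicative.toAdd.injective (by simp [hc])⟩
    · rintro ⟨c, rfl⟩
      exact ⟨c.toAdd, by simp⟩
  have : NeZero d := ⟨hd.ne'⟩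
  rw [← hker, Subgroup.index_ker, MonoidHom.range_eq_top.2 hf, Subgroup.card_top]
  exact Nat.card_zmod d

theorem herbrandQuot_trivial_int {n : ℕ} (hn : 0 < n) :
    HerbrandQuot n (MonoidHom.id (Multiplicative ℤ)) n := by
  have hD : cycDiff (MonoidHom.id (Multiplicative ℤ)) = 1 := by
    ext
    simp [cycDiff_apply]
  have hN : cycNorm n (MonoidHom.id (Multiplicative ℤ)) = powMonoidHom n := by
    refine MonoidHom.ext fun x ↦ ?_
    simp [cycNorm_apply, MonoidHom.coe_id]
  have hker : (powMonoidHom n : Multiplicative ℤ →* Multiplicative ℤ).ker = ⊥ := by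
    rw [Subgroup.eq_bot_iff_forall]
    intro x hx
    have h := congrArg Multiplicative.toAdd (show x ^ n = 1 from hx)
    rw [toAdd_pow, toAdd_one, smul_eq_zero] at h
    exact Multiplicative.toAdd.injective (h.resolve_left hn.ne')
  have h0 := index_range_pow_multiplicative_int hn
  have hn' : (n : ℚ) ≠ 0 := Nat.cast_ne_zero.2 hn.ne'
  unfold HerbrandQuot
  rw [hD, hN]
  refine ⟨?_, ?_, ?_⟩ <;>
    simp [hker, MonoidHom.ker_one, h0, Subgroup.relIndex_top_right, hn.ne']

/-- The action on integral functions induced by a self-map of the underlying set. -/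
def permAct {X : Type*} (e : X → X) : (X → Multiplicative ℤ) →* (X → Multiplicative ℤ) where
  toFun f := f ∘ e
  map_one' := rfl
  map_mul' _ _ := rfl

theorem permAct_iterate {X : Type*} (e : X → X) (j : ℕ) (f : X → Multiplicative ℤ) (x : X) :
    (permAct e)^[j] f x = f (e^[j] x) := by
  induction j generalizing f with
  | zero => rfl
  | succ j ih => rw [Function.iterate_succ_apply, ih, Function.iterate_succ_apply']; rfl

theorem herbrandQuot_permAct {X : Type*} [Fintype X] [Nonempty X] {e : X → X}
    (he : Function.Bijective e) (htr : ∀ x y, ∃ j : ℕ, e^[j] x = y) {n d : ℕ} (hd : 0 < d)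
    (hen : ∀ x, e^[n] x = x) (hcard : Fintype.card X * d = n) :
    HerbrandQuot n (permAct e) d := by
  have hs : ∀ f, (permAct e)^[n] f = f := fun f ↦ funext fun x ↦ by rw [permAct_iterate, hen]
  have hconst : ∀ f : X → Multiplicative ℤ, permAct e f = f → ∀ x y, f x = f y := by
    intro f hf x y
    obtain ⟨j, rfl⟩ := htr x y
    rw [← permAct_iterate e j f x, Function.iterate_fixed hf]
  -- The norm of `f` is fixed, hence constant. Its product over `X` is `(∏ y, f y) ^ n`, and `n =
  -- |X| d`; since `ℤ` is torsion free the `|X|`-th root may be taken.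
  have hN : ∀ f x, cycNorm n (permAct e) f x = (∏ y, f y) ^ d := by
    intro f x
    have h1 : permAct e (cycNorm n (permAct e) f) = cycNorm n (permAct e) f :=
      mem_ker_cycDiff.1 (DFunLike.congr_fun (cycDiff_comp_cycNorm hs) f)
    have h2 : ∏ y, cycNorm n (permAct e) f y = (∏ y, f y) ^ n := by
      simp only [cycNorm_apply, Finset.prod_apply, permAct_iterate]
      rw [Finset.prod_comm, Finset.prod_congr rfl fun j _ ↦ (he.iterate j).prod_comp f,
        Finset.prod_const, Finset.card_range]
    rw [Finset.prod_congr rfl fun y _ ↦ hconst _ h1 y x, Finset.prod_const, Finset.card_univ]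
      at h2
    have h3 : (∏ y, f y) ^ n = ((∏ y, f y) ^ d) ^ Fintype.card X := by
      rw [← hcard, mul_comm, pow_mul]
    exact pow_left_injective (Fintype.card_ne_zero (α := X)) (h2.trans h3)
  have h1 : HOneTrivial n (permAct e) := by
    intro f hf
    obtain ⟨x⟩ := (inferInstance : Nonempty X)
    have h2 : (∏ y, f y) ^ d = 1 := by rw [← hN f x, hf]; rfl
    have h3 : ∏ y, f y = 1 := by
      rw [← one_pow d] at h2
      exact pow_left_injective hd.ne' h2
    obtain ⟨b, hb⟩ := exists_sub_eq_of_sum_eq_zero e he htr (fun x ↦ (f x).toAdd)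
      (by rw [← toAdd_prod, h3, toAdd_one])
    exact ⟨fun x ↦ Multiplicative.ofAdd (b x), funext fun x ↦
      Multiplicative.toAdd.injective (hb x).symm⟩
  let c : Multiplicative ℤ →* (X → Multiplicative ℤ) := Pi.constMonoidHom X (Multiplicative ℤ)
  have hc : Function.Injective c := Function.const_injective
  have hker : (cycDiff (permAct e)).ker = (⊤ : Subgroup _).map c := by
    ext f
    rw [mem_ker_cycDiff, ← MonoidHom.range_eq_map, MonoidHom.mem_range]
    constructor
    · intro hf
      obtain ⟨x⟩ := (inferInstance : Nonempty X)
      exact ⟨f x, funext fun y ↦ hconst f hf x y⟩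
    · rintro ⟨a, rfl⟩
      rfl
  have hran : (cycNorm n (permAct e)).range =
      (powMonoidHom d : Multiplicative ℤ →* Multiplicative ℤ).range.map c := by
    classical
    ext f
    constructor
    · rintro ⟨f, rfl⟩
      exact ⟨_, ⟨∏ y, f y, rfl⟩, funext fun x ↦ (hN f x).symm⟩
    · rintro ⟨_, ⟨a, rfl⟩, rfl⟩
      obtain ⟨x⟩ := (inferInstance : Nonempty X)
      refine ⟨Pi.mulSingle x a, funext fun y ↦ ?_⟩
      rw [hN, Finset.prod_pi_mulSingle']
      simp [c]
  have h0 : (cycNorm n (permAct e)).range.relIndex (cycDiff (permAct e)).ker = d := by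
    rw [hker, hran, Subgroup.relIndex_map_map_of_injective _ _ hc, Subgroup.relIndex_top_right,
      index_range_pow_multiplicative_int hd]
  have hone := relIndex_right_of_hOneTrivial h1
  exact ⟨h0.trans_ne hd.ne', hone.trans_ne one_ne_zero, by simp [h0, hone]⟩

/-- An integral relation between the columns of a real matrix with negative entries outside the
diagonal and vanishing column sums is trivial as soon as its coefficients add up to zero. -/
theorem eq_zero_of_sum_eq_zero {X : Type*} [Fintype X] {a : X → X → ℝ}
    (hneg : ∀ u w, u ≠ w → a u w < 0) (hcol : ∀ w, ∑ u, a u w = 0) {f : X → ℤ}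
    (hf : ∀ u, ∑ w, a u w * f w = 0) (hsum : ∑ w, f w = 0) : f = 0 := by
  classical
  -- Add the relations of the rows where `g` is positive. In a column with `g w > 0` the partial
  -- column sum is positive, because the omitted entries are negative and at least one exists. In
  -- the other columns every entry is negative and `g w ≤ 0`. If `g` were positive somewhere, the
  -- total would be positive rather than zero.
  have key : ∀ g : X → ℤ, (∀ u, ∑ w, a u w * g w = 0) → ∑ w, g w = 0 → ∀ w, g w ≤ 0 := by
    intro g hg hgs w₁
    by_contra! hw₁
    obtain ⟨w₂, hw₂⟩ : ∃ w₂, g w₂ ≤ 0 := by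
      by_contra! h
      exact (Finset.sum_pos (fun w _ ↦ h w) ⟨w₁, Finset.mem_univ w₁⟩).ne' hgs
    have h1 : ∑ u with 0 < g u, ∑ w, a u w * g w = 0 := Finset.sum_eq_zero fun u _ ↦ hg u
    rw [Finset.sum_comm] at h1
    simp only [← Finset.sum_mul] at h1
    have hP : ∀ w, 0 < g w → 0 < ∑ u with 0 < g u, a u w := by
      intro w hw
      have h2 := Finset.sum_filter_add_sum_filter_not Finset.univ (fun u ↦ 0 < g u) (a · w)
      rw [hcol] at h2
      have h3 : ∑ u with ¬ 0 < g u, a u w < 0 :=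
        Finset.sum_neg (fun u hu ↦ hneg u w (by rintro rfl; simp at hu; omega))
          ⟨w₂, by simpa using hw₂⟩
      linarith
    refine (Finset.sum_pos' (fun w _ ↦ ?_) ⟨w₁, Finset.mem_univ _, ?_⟩).ne' h1
    · rcases lt_or_ge 0 (g w) with hw | hw
      · exact (mul_pos (hP w hw) (by exact_mod_cast hw)).le
      · refine mul_nonneg_of_nonpos_of_nonpos (Finset.sum_nonpos fun u hu ↦ (hneg u w ?_).le)
          (by exact_mod_cast hw)
        rintro rfl
        simp at hu
        omega
    · exact mul_pos (hP w₁ hw₁) (by exact_mod_cast hw₁)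
  funext w
  refine le_antisymm (key f hf hsum w) ?_
  have := key (-f) (fun u ↦ by simpa using hf u) (by simpa using hsum) w
  simpa using this

end Permutation

/-! ### A Galois-compatible family of units indexed by the infinite places. -/

section GlobalUnits

variable {K L : Type*} [Field K] [NumberField K] [Field L] [NumberField L] [Algebra K L]
  [IsGalois K L] {σ : Gal(L/K)}

/-- The action of a field automorphism on the units of the ring of integers. -/
abbrev galUnits (σ : Gal(L/K)) : (𝓞 L)ˣ →* (𝓞 L)ˣ := Units.map (galInt σ).toRingHom.toMonoidHom

theorem galUnits_mul (σ τ : Gal(L/K)) (u : (𝓞 L)ˣ) :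
    galUnits σ (galUnits τ u) = galUnits (σ * τ) u := rfl

theorem galUnits_iterate_finrank (hσ : ∀ τ, τ ∈ Subgroup.zpowers σ) (u : (𝓞 L)ˣ) :
    (galUnits σ)^[Module.finrank K L] u = u := by
  have h : ∀ j : ℕ, (galUnits σ)^[j] u = galUnits (σ ^ j) u := by
    intro j
    induction j with
    | zero => rfl
    | succ j ih => rw [Function.iterate_succ_apply', ih, galUnits_mul, pow_succ']
  rw [h, ← orderOf_eq_finrank hσ, pow_orderOf_eq_one]
  rfl

instance (v : InfinitePlace K) : Fintype (InfOver K L v) := Fintype.ofFinite _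

variable (L) in
/-- A chosen infinite place of `L` over an infinite place of `K`. -/
def basePlace (v : InfinitePlace K) : InfOver K L v := Classical.arbitrary _

variable (L) in
/-- A unit of `L` which is small at all infinite places except the chosen one over `v`. -/
def baseUnit (v : InfinitePlace K) : (𝓞 L)ˣ :=
  (NumberField.Units.dirichletUnitTheorem.exists_unit L (basePlace L v).1).choose

theorem log_baseUnit_neg (v : InfinitePlace K) {w : InfinitePlace L} (hw : w ≠ (basePlace L v).1) :
    Real.log (w (baseUnit L v)) < 0 :=
  (NumberField.Units.dirichletUnitTheorem.exists_unit L (basePlace L v).1).choose_spec w hw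

open scoped Classical in
/-- The automorphisms taking an infinite place to the chosen one. -/
def toBase (x : Σ v : InfinitePlace K, InfOver K L v) : Finset Gal(L/K) :=
  Finset.univ.filter fun τ : Gal(L/K) ↦ x.2.1.comap (τ : L →+* L) = (basePlace L x.1).1

theorem mem_toBase {x : Σ v : InfinitePlace K, InfOver K L v} {τ : Gal(L/K)} :
    τ ∈ toBase x ↔ x.2.1.comap (τ : L →+* L) = (basePlace L x.1).1 := by
  simp [toBase]

/-- A family of units indexed by the infinite places, compatible with the Galois action. -/
def placeUnit (x : Σ v : InfinitePlace K, InfOver K L v) : (𝓞 L)ˣ :=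
  ∏ τ ∈ toBase x, galUnits τ (baseUnit L x.1)

/-- Left multiplication by `σ` matches the automorphisms carrying the two places to the base place.
Taking the product over all of them avoids choosing one representative for each place, which would
not be compatible with the action. -/
theorem galUnits_placeUnit (v : InfinitePlace K) (w : InfOver K L v) :
    galUnits σ (placeUnit ⟨v, infOver σ v w⟩) = placeUnit ⟨v, w⟩ := by
  unfold placeUnit
  rw [map_prod]
  refine Finset.prod_equiv (Equiv.mulLeft σ) (fun τ ↦ ?_) fun τ _ ↦ rfl
  rw [mem_toBase, mem_toBase]
  rfl

/-- If `τ` takes the place of `x` to the base place, it takes `u` to a different one, where the base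
unit is small. The product is not empty, by transitivity. -/
theorem log_placeUnit_neg (hσ : ∀ τ, τ ∈ Subgroup.zpowers σ)
    (x : Σ v : InfinitePlace K, InfOver K L v) {u : InfinitePlace L} (hu : u ≠ x.2.1) :
    Real.log (u (placeUnit x)) < 0 := by
  have h1 : u (placeUnit x) = ∏ τ ∈ toBase x,
      (u.comap (τ : L →+* L)) (baseUnit L x.1) := by
    unfold placeUnit
    rw [Units.coe_prod, map_prod, map_prod]
    rfl
  rw [h1, Real.log_prod fun τ _ ↦ (NumberField.Units.pos_at_place _ _).ne']
  refine Finset.sum_neg (fun τ hτ ↦ log_baseUnit_neg _ fun h ↦ hu ?_) ?_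
  · rw [mem_toBase, ← h] at hτ
    refine (InfinitePlace.ext _ _ fun y ↦ ?_).symm
    have := DFunLike.congr_fun hτ (τ.symm y)
    change x.2.1 (τ (τ.symm y)) = u (τ (τ.symm y)) at this
    rwa [AlgEquiv.apply_symm_apply] at this
  · obtain ⟨j, hj⟩ := infOver_transitive hσ x.1 x.2 (basePlace L x.1)
    refine ⟨σ ^ j, mem_toBase.2 (InfinitePlace.ext _ _ fun y ↦ ?_)⟩
    rw [← hj, infOver_iterate]
    rfl

theorem bijective_place : Function.Bijective
    (fun x : Σ v : InfinitePlace K, InfOver K L v ↦ (x.2.1 : InfinitePlace L)) := by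
  constructor
  · rintro ⟨v, w, hw⟩ ⟨v', w', hw'⟩ h
    obtain rfl : w = w' := h
    obtain rfl : v = v' := (InfinitePlace.LiesOver.comap_eq w v).symm.trans
      (InfinitePlace.LiesOver.comap_eq w v')
    rfl
  · intro w
    exact ⟨⟨w.comap (algebraMap K L), w, ⟨rfl⟩⟩, rfl⟩

variable (K L) in
/-- The map from functions on the infinite places to units given by the family `placeUnit`. -/
def placeUnitHom : (∀ v : InfinitePlace K, InfOver K L v → Multiplicative ℤ) →* (𝓞 L)ˣ where
  toFun f := ∏ v, ∏ w, placeUnit ⟨v, w⟩ ^ (f v w).toAdd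
  map_one' := by simp
  map_mul' f g := by simp [zpow_add, Finset.prod_mul_distrib]

theorem placeUnitHom_apply (f : ∀ v : InfinitePlace K, InfOver K L v → Multiplicative ℤ) :
    placeUnitHom K L f = ∏ v, ∏ w, placeUnit ⟨v, w⟩ ^ (f v w).toAdd := rfl

theorem bijective_infOver (σ : Gal(L/K)) (v : InfinitePlace K) :
    Function.Bijective (infOver (L := L) σ v) :=
  Finite.injective_iff_bijective.1 (infOver_injective σ v)

theorem placeUnitHom_permAct (f : ∀ v : InfinitePlace K, InfOver K L v → Multiplicative ℤ) :
    placeUnitHom K L (MonoidHom.piMap (fun v ↦ permAct (infOver σ v)) f) =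
      galUnits σ (placeUnitHom K L f) := by
  rw [placeUnitHom_apply, placeUnitHom_apply, map_prod]
  refine Finset.prod_congr rfl fun v _ ↦ ?_
  rw [map_prod, ← (bijective_infOver σ v).prod_comp fun w ↦
    galUnits σ (placeUnit ⟨v, w⟩ ^ (f v w).toAdd)]
  refine Finset.prod_congr rfl fun w _ ↦ ?_
  rw [map_zpow, galUnits_placeUnit]
  rfl

/-- The sum of the values of a function on the infinite places. -/
def placeSum : (∀ v : InfinitePlace K, InfOver K L v → Multiplicative ℤ) →* Multiplicative ℤ where
  toFun f := ∏ v, ∏ w, f v w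
  map_one' := by simp
  map_mul' f g := by simp [Finset.prod_mul_distrib]

/-- Taking logarithms weighted by the multiplicities turns the relation among units into the
integral relation lemma: entries off the diagonal are negative, and columns sum to zero by the
product formula for units. -/
theorem eq_one_of_placeSum_eq_one (hσ : ∀ τ, τ ∈ Subgroup.zpowers σ)
    {f : ∀ v : InfinitePlace K, InfOver K L v → Multiplicative ℤ} (hf : placeUnitHom K L f = 1)
    (hs : placeSum f = 1) : f = 1 := by
  let X := Σ v : InfinitePlace K, InfOver K L v
  let a : X → X → ℝ := fun u w ↦ u.2.1.mult * Real.log (u.2.1 (placeUnit w))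
  let g : X → ℤ := fun x ↦ (f x.1 x.2).toAdd
  have hg : g = 0 := by
    refine eq_zero_of_sum_eq_zero (a := a) (fun u w hne ↦ ?_) (fun w ↦ ?_) (fun u ↦ ?_) ?_
    · refine mul_neg_of_pos_of_neg (by exact_mod_cast u.2.1.mult_pos) (log_placeUnit_neg hσ w ?_)
      exact fun h ↦ hne (bijective_place.injective h)
    · rw [← NumberField.Units.sum_mult_mul_log (placeUnit w)]
      exact bijective_place.sum_comp
        fun u : InfinitePlace L ↦ (u.mult : ℝ) * Real.log (u (placeUnit w))
    · have h1 : Real.log (u.2.1 (placeUnitHom K L f)) = 0 := by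
        rw [hf]
        simp
      have h2 : placeUnitHom K L f = ∏ x : X, placeUnit x ^ g x := by
        rw [placeUnitHom_apply, Fintype.prod_sigma]
      have h3 : u.2.1 (placeUnitHom K L f) = ∏ x : X, u.2.1 (placeUnit x) ^ g x := by
        rw [h2, Units.coe_prod, map_prod, map_prod]
        refine Finset.prod_congr rfl fun x _ ↦ ?_
        rw [← map_zpow₀, ← NumberField.Units.coe_zpow]
      rw [h3, Real.log_prod fun x _ ↦ zpow_ne_zero _ (NumberField.Units.pos_at_place _ _).ne'] at h1
      have h4 : ∑ w, a u w * g w = u.2.1.mult * ∑ x : X, Real.log (u.2.1 (placeUnit x) ^ g x) := by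
        rw [Finset.mul_sum]
        refine Finset.sum_congr rfl fun x _ ↦ ?_
        rw [Real.log_zpow]
        simp only [a]
        ring
      rw [h4, h1, mul_zero]
    · have h1 := congrArg Multiplicative.toAdd hs
      rw [toAdd_one] at h1
      rw [← h1, Fintype.sum_sigma]
      simp [g, placeSum]
  funext v w
  exact Multiplicative.toAdd.injective (congrFun hg ⟨v, w⟩)

end GlobalUnits

/-! ### Finite index, and the Herbrand quotient of the global units. -/

section GlobalUnits

variable {K L : Type*} [Field K] [NumberField K] [Field L] [NumberField L] [Algebra K L]
  [IsGalois K L] {σ : Gal(L/K)}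

variable (K L) in
theorem card_sigma_infOver : Fintype.card (Σ v : InfinitePlace K, InfOver K L v) =
    NumberField.Units.rank L + 1 := by
  rw [Fintype.card_of_bijective bijective_place, NumberField.Units.rank,
    Nat.sub_add_cancel Fintype.card_pos]

variable (K L) in
/-- The additive version of `placeUnitHom`. -/
def placeUnitLin : ((Σ v : InfinitePlace K, InfOver K L v) → ℤ) →ₗ[ℤ] Additive (𝓞 L)ˣ :=
  AddMonoidHom.toIntLinearMap
    { toFun := fun g ↦ Additive.ofMul (placeUnitHom K L fun v w ↦ Multiplicative.ofAdd (g ⟨v, w⟩))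
      map_zero' := map_one (placeUnitHom K L)
      map_add' := fun _ _ ↦ map_mul (placeUnitHom K L) _ _ }

theorem finrank_le_rank_add_finrank_ker {M : Type*} [AddCommGroup M] [Module.Finite ℤ M]
    (f : M →ₗ[ℤ] Additive (𝓞 L)ˣ) :
    Module.finrank ℤ M ≤ NumberField.Units.rank L + Module.finrank ℤ (LinearMap.ker f) := by
  rw [← Submodule.finrank_quotient_add_finrank (LinearMap.ker f), f.quotKerEquivRange.finrank_eq,
    ← NumberField.Units.finrank_eq]
  exact Nat.add_le_add_right (Submodule.finrank_le _) _

variable (K L) in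
/-- The sum of the values, as a linear map. -/
def sumLin : ((Σ v : InfinitePlace K, InfOver K L v) → ℤ) →ₗ[ℤ] ℤ :=
  ∑ x, LinearMap.proj x

theorem eq_zero_of_sumLin_eq_zero (hσ : ∀ τ, τ ∈ Subgroup.zpowers σ)
    {g : (Σ v : InfinitePlace K, InfOver K L v) → ℤ} (hg : placeUnitLin K L g = 0)
    (hs : sumLin K L g = 0) : g = 0 := by
  have h := eq_one_of_placeSum_eq_one hσ
    (f := fun v w ↦ Multiplicative.ofAdd (g ⟨v, w⟩)) hg (by
      apply Multiplicative.toAdd.injective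
      rw [toAdd_one, ← hs]
      simp [placeSum, sumLin, Fintype.sum_sigma])
  funext ⟨v, w⟩
  exact congrArg Multiplicative.toAdd (congrFun (congrFun h v) w)

variable (K L) in
theorem exists_placeUnitHom_eq_one :
    ∃ f : ∀ v : InfinitePlace K, InfOver K L v → Multiplicative ℤ,
      f ≠ 1 ∧ placeUnitHom K L f = 1 := by
  have h1 := finrank_le_rank_add_finrank_ker (placeUnitLin K L)
  rw [Module.finrank_fintype_fun_eq_card, card_sigma_infOver] at h1
  -- There is one more infinite place than the unit rank.
  have h3 : LinearMap.ker (placeUnitLin K L) ≠ ⊥ := by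
    intro h
    rw [h, finrank_bot] at h1
    omega
  obtain ⟨g, hg, hg0⟩ := Submodule.exists_mem_ne_zero_of_ne_bot h3
  refine ⟨fun v w ↦ Multiplicative.ofAdd (g ⟨v, w⟩), fun h ↦ hg0 ?_, hg⟩
  funext ⟨v, w⟩
  exact congrArg Multiplicative.toAdd (congrFun (congrFun h v) w)

/-- Adjoining `u` as a further generator gives a source of rank two more than the unit rank, so
relations of rank at least two. If no nonzero power of `u` were in the image, every relation would
have exponent zero at `u` and be determined by its coefficient sum, leaving rank at most one. -/
theorem exists_zpow_mem_range_placeUnitHom (hσ : ∀ τ, τ ∈ Subgroup.zpowers σ) (u : (𝓞 L)ˣ) :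
    ∃ m : ℤ, m ≠ 0 ∧ u ^ m ∈ (placeUnitHom K L).range := by
  let Ψ : (((Σ v : InfinitePlace K, InfOver K L v) → ℤ) × ℤ) →ₗ[ℤ] Additive (𝓞 L)ˣ :=
    (placeUnitLin K L).coprod (LinearMap.toSpanSingleton ℤ _ (Additive.ofMul u))
  have h1 := finrank_le_rank_add_finrank_ker Ψ
  rw [Module.finrank_prod, Module.finrank_fintype_fun_eq_card, card_sigma_infOver,
    Module.finrank_self] at h1
  by_contra! hu
  have h3 : ∀ g m, Ψ (g, m) = 0 → m = 0 := by
    intro g m h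
    by_contra hm
    refine hu m hm ⟨(fun v w ↦ Multiplicative.ofAdd (g ⟨v, w⟩))⁻¹, ?_⟩
    rw [map_inv, inv_eq_iff_mul_eq_one]
    exact h
  let S : LinearMap.ker Ψ →ₗ[ℤ] ℤ :=
    (sumLin K L).comp ((LinearMap.fst ℤ _ _).comp (LinearMap.ker Ψ).subtype)
  have hS : Function.Injective S := by
    rw [← LinearMap.ker_eq_bot, LinearMap.ker_eq_bot']
    rintro ⟨⟨g, m⟩, hgm⟩ h
    obtain rfl := h3 g m hgm
    have hg : g = 0 := eq_zero_of_sumLin_eq_zero hσ (by simpa [Ψ] using hgm) h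
    subst hg
    rfl
  have h4 := LinearMap.finrank_le_finrank_of_injective hS
  rw [Module.finrank_self] at h4
  omega

theorem finiteIndex_range_placeUnitHom (hσ : ∀ τ, τ ∈ Subgroup.zpowers σ) :
    (placeUnitHom K L).range.FiniteIndex := by
  have : Finite ((𝓞 L)ˣ ⧸ (placeUnitHom K L).range) := by
    have : Group.FG (𝓞 L)ˣ := Group.fg_iff_monoid_fg.2 inferInstance
    refine CommGroup.finite_of_fg_isMulTorsion _ fun x ↦ ?_
    obtain ⟨u, rfl⟩ := QuotientGroup.mk_surjective x
    obtain ⟨m, hm, hu⟩ := exists_zpow_mem_range_placeUnitHom (K := K) hσ u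
    have h : (u : (𝓞 L)ˣ ⧸ (placeUnitHom K L).range) ^ m = 1 := (QuotientGroup.eq_one_iff _).2 hu
    exact (isOfFinOrder_iff_zpow_eq_one (G := (𝓞 L)ˣ ⧸ (placeUnitHom K L).range)).2 ⟨m, hm, h⟩
  exact Subgroup.finiteIndex_of_finite_quotient

theorem herbrandQuot_units (hσ : ∀ τ, τ ∈ Subgroup.zpowers σ) :
    HerbrandQuot (Module.finrank K L) (galUnits σ)
      ((∏ v : InfinitePlace K, (Module.finrank K L / Nat.card (InfOver K L v) : ℚ)) /
        Module.finrank K L) := by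
  let Φ := placeUnitHom K L
  let S : (∀ v : InfinitePlace K, InfOver K L v → Multiplicative ℤ) →* _ :=
    MonoidHom.piMap fun v ↦ permAct (infOver σ v)
  have hen : ∀ (v : InfinitePlace K) (w : InfOver K L v),
      (infOver σ v)^[Module.finrank K L] w = w := by
    intro v w
    refine Subtype.ext (InfinitePlace.ext _ _ fun x ↦ ?_)
    rw [infOver_iterate, ← iterate_eq_pow_apply, iterate_finrank hσ]
  have hS : ∀ f, S^[Module.finrank K L] f = f := fun f ↦ funext fun v ↦ funext fun w ↦ by
    rw [iterate_piMap_apply, permAct_iterate, hen]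
  have hsum : ∀ f, placeSum (S f) = placeSum f := fun f ↦
    Finset.prod_congr rfl fun v _ ↦ (bijective_infOver σ v).prod_comp (f v)
  have hker : Function.Injective (placeSum.comp Φ.ker.subtype) := by
    rw [injective_iff_map_eq_one]
    rintro ⟨f, hf⟩ h
    exact Subtype.ext (eq_one_of_placeSum_eq_one hσ hf h)
  -- The action preserves the sum of the values, and that sum is injective on the kernel.
  have htriv : ∀ f ∈ Φ.ker, S f = f := by
    intro f hf
    have h1 : S f ∈ Φ.ker := by
      rw [MonoidHom.mem_ker, placeUnitHom_permAct, hf, map_one]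
    have := @hker ⟨S f, h1⟩ ⟨f, hf⟩ (hsum f)
    exact congrArg Subtype.val this
  have := isCyclic_of_injective _ hker
  obtain ⟨⟨f₀, hf₀⟩, hgen⟩ := IsCyclic.exists_generator (α := Φ.ker)
  have hf₀1 : f₀ ≠ 1 := by
    rintro rfl
    obtain ⟨f, hf1, hf⟩ := exists_placeUnitHom_eq_one K L
    obtain ⟨m, hm⟩ := hgen ⟨f, hf⟩
    exact hf1 ((congrArg Subtype.val hm).symm.trans (one_zpow m))
  let i : Multiplicative ℤ →* (∀ v : InfinitePlace K, InfOver K L v → Multiplicative ℤ) :=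
    zpowersHom _ f₀
  have hi : Function.Injective i := by
    rw [injective_iff_map_eq_one]
    intro m hm
    by_contra hm1
    refine hf₀1 (funext fun v ↦ funext fun w ↦ ?_)
    have h1 : (f₀ v w) ^ m.toAdd = 1 := congrFun (congrFun hm v) w
    have h2 := congrArg Multiplicative.toAdd h1
    rw [toAdd_zpow, toAdd_one, smul_eq_zero] at h2
    exact Multiplicative.toAdd.injective (h2.resolve_left hm1)
  have hex : Φ.ker = i.range := by
    ext f
    constructor
    · intro hf
      obtain ⟨m, hm⟩ := hgen ⟨f, hf⟩
      exact ⟨Multiplicative.ofAdd m, congrArg Subtype.val hm⟩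
    · rintro ⟨m, rfl⟩
      exact Φ.ker.zpow_mem hf₀ m.toAdd
  have := finiteIndex_range_placeUnitHom (K := K) hσ
  refine HerbrandQuot.of_finiteIndex_range (φ := Φ) (sB := S) hi hex (fun m ↦ ?_)
    (placeUnitHom_permAct (σ := σ)) hS (galUnits_iterate_finrank hσ)
    (herbrandQuot_trivial_int Module.finrank_pos) (HerbrandQuot.pi fun v ↦ ?_)
  · exact (htriv _ (hex ▸ ⟨m, rfl⟩)).symm
  · obtain ⟨w⟩ := (inferInstance : Nonempty (InfOver K L v))
    have hcard := card_infOver_mul_finrank v hσ w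
    have h := herbrandQuot_permAct (bijective_infOver (L := L) σ v) (infOver_transitive hσ v)
      (Module.finrank_pos (R := v.Completion) (M := w.1.Completion)) (hen v)
      (by rw [← hcard, Nat.card_eq_fintype_card])
    convert h using 1
    rw [← hcard]
    have : (Nat.card (InfOver K L v) : ℚ) ≠ 0 := Nat.cast_ne_zero.2 Nat.card_pos.ne'
    push_cast
    field_simp

end GlobalUnits

/-! ### Ideles, their ideals and the finiteness of the class group. -/

section ClassGroup

open scoped nonZeroDivisors

variable {F : Type*} [Field F] [NumberField F]

/-- The component of an idele at a finite place. -/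
def finComp (w : HeightOneSpectrum (𝓞 F)) : AdeleRing (𝓞 F) F →* w.adicCompletion F where
  toFun x := x.2 w
  map_one' := rfl
  map_mul' _ _ := rfl

/-- The component of an idele at an infinite place. -/
def infComp (w : InfinitePlace F) : AdeleRing (𝓞 F) F →* w.Completion where
  toFun x := x.1 w
  map_one' := rfl
  map_mul' _ _ := rfl

theorem adele_ext {x y : AdeleRing (𝓞 F) F} (h1 : ∀ w, infComp w x = infComp w y)
    (h2 : ∀ w, finComp w x = finComp w y) : x = y :=
  Prod.ext (funext h1) (FiniteAdeleRing.ext F h2)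

theorem idele_ext {x y : IdeleGroup F}
    (h1 : ∀ w, infComp w (x : AdeleRing (𝓞 F) F) = infComp w (y : AdeleRing (𝓞 F) F))
    (h2 : ∀ w, finComp w (x : AdeleRing (𝓞 F) F) = finComp w (y : AdeleRing (𝓞 F) F)) : x = y :=
  Units.ext (adele_ext h1 h2)

theorem finComp_ne_zero (x : IdeleGroup F) (w : HeightOneSpectrum (𝓞 F)) :
    finComp w (x : AdeleRing (𝓞 F) F) ≠ 0 :=
  (x.isUnit.map (finComp w)).ne_zero

theorem finComp_diagonal (y : Fˣ) (w : HeightOneSpectrum (𝓞 F)) :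
    finComp w (diagonal F y : AdeleRing (𝓞 F) F) = algebraMap F (w.adicCompletion F) y := rfl

theorem eventually_valued_eq_one (x : IdeleGroup F) :
    ∀ᶠ w : HeightOneSpectrum (𝓞 F) in Filter.cofinite,
      Valued.v (finComp w (x : AdeleRing (𝓞 F) F)) = 1 := by
  let p : AdeleRing (𝓞 F) F →* FiniteAdeleRing (𝓞 F) F :=
    { toFun := fun x ↦ x.2
      map_one' := rfl
      map_mul' := fun _ _ ↦ rfl }
  exact (FiniteAdeleRing.isUnit_iff.1 (x.isUnit.map p)).2

theorem exists_idele {a : ∀ w : InfinitePlace F, w.Completion}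
    {b : ∀ w : HeightOneSpectrum (𝓞 F), w.adicCompletion F} (ha : ∀ w, a w ≠ 0)
    (hb : ∀ w, b w ≠ 0) (hb1 : ∀ᶠ w in Filter.cofinite, Valued.v (b w) = 1) :
    ∃ x : IdeleGroup F, (∀ w, infComp w (x : AdeleRing (𝓞 F) F) = a w) ∧
      ∀ w, finComp w (x : AdeleRing (𝓞 F) F) = b w := by
  have hmem : ∀ b' : ∀ w : HeightOneSpectrum (𝓞 F), w.adicCompletion F,
      (∀ᶠ w in Filter.cofinite, Valued.v (b' w) = 1) →
        ∀ᶠ w in Filter.cofinite, b' w ∈ w.adicCompletionIntegers F := fun b' h ↦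
    h.mono fun w hw ↦ hw.le
  let y : AdeleRing (𝓞 F) F := (a, ⟨b, hmem b hb1⟩)
  let z : AdeleRing (𝓞 F) F := (fun w ↦ (a w)⁻¹, ⟨fun w ↦ (b w)⁻¹, hmem _ (hb1.mono fun w hw ↦ by
    rw [map_inv₀, hw, inv_one])⟩)
  have hyz : y * z = 1 := adele_ext (fun w ↦ mul_inv_cancel₀ (ha w)) fun w ↦ mul_inv_cancel₀ (hb w)
  exact ⟨⟨y, z, hyz, (mul_comm _ _).trans hyz⟩, fun _ ↦ rfl, fun _ ↦ rfl⟩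

variable (F) in
/-- The ideles which are units at all finite places. -/
def unitIdeles : Subgroup (IdeleGroup F) where
  carrier := {x | ∀ w, Valued.v (finComp w (x : AdeleRing (𝓞 F) F)) = 1}
  one_mem' w := by simp
  mul_mem' hx hy w := by
    rw [Units.val_mul, map_mul, map_mul, hx w, hy w, one_mul]
  inv_mem' {x} hx w := by
    have h : finComp w ((x⁻¹ : IdeleGroup F) : AdeleRing (𝓞 F) F) *
        finComp w (x : AdeleRing (𝓞 F) F) = 1 := by
      rw [← map_mul, Units.inv_mul, map_one]
    have h2 := congrArg Valued.v h
    rwa [map_mul, hx w, mul_one, map_one] at h2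

theorem count_spanSingleton (w : HeightOneSpectrum (𝓞 F)) {y : F} (hy : y ≠ 0) :
    FractionalIdeal.count F w (FractionalIdeal.spanSingleton (𝓞 F)⁰ y) =
      -WithZero.log (w.valuation F y) := by
  have hcount : ∀ a : 𝓞 F, a ≠ 0 → FractionalIdeal.count F w
      (FractionalIdeal.spanSingleton (𝓞 F)⁰ (algebraMap (𝓞 F) F a)) =
        -WithZero.log (w.valuation F (algebraMap (𝓞 F) F a)) := by
    intro a ha
    rw [← FractionalIdeal.coeIdeal_span_singleton, FractionalIdeal.count_coe F w (by simpa using ha),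
      HeightOneSpectrum.valuation_of_algebraMap, HeightOneSpectrum.intValuation_if_neg _ ha,
      WithZero.log_exp, neg_neg]
  obtain ⟨a, b, hb, rfl⟩ := IsFractionRing.div_surjective (A := 𝓞 F) y
  have hb0 : b ≠ 0 := nonZeroDivisors.ne_zero hb
  have ha0 : a ≠ 0 := by
    rintro rfl
    simp at hy
  have hbF : algebraMap (𝓞 F) F b ≠ 0 := by simpa using hb0
  have haF : algebraMap (𝓞 F) F a ≠ 0 := by simpa using ha0
  rw [div_eq_mul_inv, ← FractionalIdeal.spanSingleton_mul_spanSingleton,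
    ← FractionalIdeal.spanSingleton_inv, FractionalIdeal.count_mul, FractionalIdeal.count_inv,
    hcount a ha0, hcount b hb0, map_mul, map_inv₀, WithZero.log_mul, WithZero.log_inv]
  · ring
  · simpa using ha0
  · simpa using hb0
  · exact FractionalIdeal.spanSingleton_ne_zero_iff.2 haF
  · rw [FractionalIdeal.spanSingleton_inv]
    exact FractionalIdeal.spanSingleton_ne_zero_iff.2 (inv_ne_zero hbF)

/-- The exponent of a prime in the ideal of an idele. -/
def ideleExp (x : IdeleGroup F) (w : HeightOneSpectrum (𝓞 F)) : ℤ :=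
  -WithZero.log (Valued.v (finComp w (x : AdeleRing (𝓞 F) F)))

theorem ideleExp_mul (x y : IdeleGroup F) (w : HeightOneSpectrum (𝓞 F)) :
    ideleExp (x * y) w = ideleExp x w + ideleExp y w := by
  unfold ideleExp
  rw [Units.val_mul, map_mul, map_mul, WithZero.log_mul, neg_add]
  · exact (Valuation.ne_zero_iff _).2 (finComp_ne_zero x w)
  · exact (Valuation.ne_zero_iff _).2 (finComp_ne_zero y w)

theorem eventually_ideleExp_eq_zero (x : IdeleGroup F) :
    ∀ᶠ w in Filter.cofinite, ideleExp x w = 0 := by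
  filter_upwards [eventually_valued_eq_one x] with w hw
  rw [ideleExp, hw, WithZero.log_one, neg_zero]

variable (F) in
/-- The fractional ideal of an idele. -/
def ideleIdeal : IdeleGroup F →* (FractionalIdeal (𝓞 F)⁰ F)ˣ :=
  MonoidHom.toHomUnits
    { toFun := fun x ↦ ∏ᶠ w : HeightOneSpectrum (𝓞 F),
        (w.asIdeal : FractionalIdeal (𝓞 F)⁰ F) ^ ideleExp x w
      map_one' := by
        refine finprod_eq_one_of_forall_eq_one fun w ↦ ?_
        simp [ideleExp]
      map_mul' := fun x y ↦ by
        have hfin : ∀ x : IdeleGroup F, (Function.mulSupport fun w : HeightOneSpectrum (𝓞 F) ↦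
            (w.asIdeal : FractionalIdeal (𝓞 F)⁰ F) ^ ideleExp x w).Finite := by
          intro x
          refine Set.Finite.subset (eventually_ideleExp_eq_zero x) fun w hw h ↦ hw ?_
          have h' : ideleExp x w = 0 := h
          change (w.asIdeal : FractionalIdeal (𝓞 F)⁰ F) ^ ideleExp x w = 1
          rw [h', zpow_zero]
        rw [← finprod_mul_distrib (hfin x) (hfin y)]
        refine finprod_congr fun w ↦ ?_
        rw [ideleExp_mul, zpow_add₀ (FractionalIdeal.coeIdeal_ne_zero.2 w.ne_bot)] }

theorem count_ideleIdeal (x : IdeleGroup F) (w : HeightOneSpectrum (𝓞 F)) :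
    FractionalIdeal.count F w (ideleIdeal F x : FractionalIdeal (𝓞 F)⁰ F) = ideleExp x w :=
  FractionalIdeal.count_finprod F w (ideleExp x) (eventually_ideleExp_eq_zero x)

variable (F) in
-- An idele whose ideal is principal becomes a unit at all finite places after division by a
-- generator. The index is therefore bounded through the class group, which is finite.
theorem finiteIndex_principalIdeles_sup_unitIdeles :
    (principalIdeles F ⊔ unitIdeles F).FiniteIndex := by
  let q : IdeleGroup F →* (FractionalIdeal (𝓞 F)⁰ F)ˣ ⧸ (toPrincipalIdeal (𝓞 F) F).range :=
    (QuotientGroup.mk' _).comp (ideleIdeal F)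
  have : Finite ((FractionalIdeal (𝓞 F)⁰ F)ˣ ⧸ (toPrincipalIdeal (𝓞 F) F).range) :=
    Finite.of_equiv _ (ClassGroup.equiv F).toEquiv
  have hq : q.ker ≤ principalIdeles F ⊔ unitIdeles F := by
    intro x hx
    obtain ⟨y, hy⟩ := (QuotientGroup.eq_one_iff _).1 hx
    rw [← mul_div_cancel (diagonal F y) x]
    refine mul_mem (le_sup_left (a := principalIdeles F) ⟨y, rfl⟩)
      (le_sup_right (b := unitIdeles F) fun w ↦ ?_)
    have h1 := count_ideleIdeal x w
    rw [← hy, coe_toPrincipalIdeal, count_spanSingleton w y.ne_zero, ideleExp, neg_inj] at h1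
    have h2 : w.valuation F y = Valued.v (finComp w (x : AdeleRing (𝓞 F) F)) := by
      rw [← WithZero.exp_log (x := w.valuation F y) (by simp), h1,
        WithZero.exp_log ((Valuation.ne_zero_iff _).2 (finComp_ne_zero x w))]
    have h3 : finComp w (x : AdeleRing (𝓞 F) F) =
        finComp w ((diagonal F y : IdeleGroup F) : AdeleRing (𝓞 F) F) *
          finComp w ((x / diagonal F y : IdeleGroup F) : AdeleRing (𝓞 F) F) := by
      rw [← map_mul, ← Units.val_mul, mul_div_cancel]
    have h4 := congrArg Valued.v h3
    rw [map_mul, ← h2, finComp_diagonal] at h4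
    have h5 := HeightOneSpectrum.valuedAdicCompletion_eq_valuation' w (y : F)
    have h6 : Valued.v (algebraMap F (w.adicCompletion F) (y : F)) = w.valuation F (y : F) := h5
    rw [h6] at h4
    exact (mul_eq_left₀ (by simp)).1 h4.symm
  have : q.ker.FiniteIndex := inferInstance
  exact Subgroup.finiteIndex_of_le hq

end ClassGroup

/-! ### The action on ideles, the inclusion of the ideles of `K`, and local components. -/

section IdeleAction

open scoped NumberField.LiesOver

variable {K L : Type*} [Field K] [NumberField K] [Field L] [NumberField L] [Algebra K L]

theorem unit_pi_ne_zero {ι : Type*} {F : ι → Type*} [∀ i, Field (F i)] (u : (∀ i, F i)ˣ) (i : ι) :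
    (u : ∀ i, F i) i ≠ 0 :=
  (u.isUnit.map (Pi.evalRingHom F i)).ne_zero

theorem prod_univ_congr {ι M : Type*} [CommMonoid M] (i₁ i₂ : Fintype ι) (f : ι → M) :
    (@Finset.univ ι i₁).prod f = (@Finset.univ ι i₂).prod f := by
  rw [Subsingleton.elim i₁ i₂]

variable (K) in
/-- A prime of `L`, as a prime over its restriction to `K`. -/
def overUnder (w : HeightOneSpectrum (𝓞 L)) : PrimesOver K L (w.under (𝓞 K)) :=
  ⟨w, ⟨rfl⟩⟩

variable (K) in
/-- An infinite place of `L`, as a place over its restriction to `K`. -/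
def infOverComap (w : InfinitePlace L) : InfOver K L (w.comap (algebraMap K L)) :=
  ⟨w, ⟨rfl⟩⟩

theorem under_eq {v : HeightOneSpectrum (𝓞 K)} (w : PrimesOver K L v) : w.1.under (𝓞 K) = v :=
  HeightOneSpectrum.ext w.2.over.symm

theorem comap_eq {v : InfinitePlace K} (w : InfOver K L v) :
    w.1.comap (algebraMap K L) = v := by
  obtain ⟨w, hw⟩ := w
  exact hw.comap_eq

variable (K L) in
theorem tendsto_under_cofinite :
    Filter.Tendsto (fun w : HeightOneSpectrum (𝓞 L) ↦ w.under (𝓞 K)) Filter.cofinite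
      Filter.cofinite := by
  refine Filter.Tendsto.cofinite_of_finite_preimage_singleton fun v ↦ ?_
  refine Set.Finite.subset (Set.finite_range fun w : PrimesOver K L v ↦ w.1) fun w hw ↦ ?_
  have h : w.under (𝓞 K) = v := hw
  subst h
  exact ⟨overUnder K w, rfl⟩

theorem eventually_forall_primesOver {P : HeightOneSpectrum (𝓞 L) → Prop}
    (h : ∀ᶠ w in Filter.cofinite, P w) :
    ∀ᶠ v : HeightOneSpectrum (𝓞 K) in Filter.cofinite, ∀ w : PrimesOver K L v, P w.1 := by
  refine Set.Finite.subset (Set.Finite.image (fun w : HeightOneSpectrum (𝓞 L) ↦ w.under (𝓞 K)) h)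
    fun v hv ↦ ?_
  obtain ⟨w, hw⟩ := not_forall.1 hv
  exact ⟨w.1, hw, under_eq w⟩

/-- The components of an idele at the primes over `v`. -/
def localComp (v : HeightOneSpectrum (𝓞 K)) : IdeleGroup L →* (LocalAlg L v)ˣ :=
  Units.map
    { toFun := fun x w ↦ finComp w.1 x
      map_one' := rfl
      map_mul' := fun _ _ ↦ rfl }

/-- The components of an idele at the infinite places over `v`. -/
def infLocalComp (v : InfinitePlace K) : IdeleGroup L →* (InfLocalAlg L v)ˣ :=
  Units.map
    { toFun := fun x w ↦ infComp w.1 x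
      map_one' := rfl
      map_mul' := fun _ _ ↦ rfl }

variable (K) in
theorem idele_ext_local {x y : IdeleGroup L}
    (h1 : ∀ v : InfinitePlace K, infLocalComp v x = infLocalComp v y)
    (h2 : ∀ v : HeightOneSpectrum (𝓞 K), localComp v x = localComp v y) : x = y :=
  idele_ext (fun w ↦ congrFun (congrArg Units.val (h1 (w.comap (algebraMap K L))))
      (infOverComap K w))
    fun w ↦ congrFun (congrArg Units.val (h2 (w.under (𝓞 K)))) (overUnder K w)

theorem exists_idele_local (a : ∀ v : InfinitePlace K, (InfLocalAlg L v)ˣ)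
    (b : ∀ v : HeightOneSpectrum (𝓞 K), (LocalAlg L v)ˣ)
    (hb : ∀ᶠ v in Filter.cofinite, ∀ w, Valued.v ((b v : LocalAlg L v) w) = 1) :
    ∃ x : IdeleGroup L, (∀ v, infLocalComp v x = a v) ∧ ∀ v, localComp v x = b v := by
  let a' : ∀ w : InfinitePlace L, w.Completion := fun w ↦
    (a (w.comap (algebraMap K L)) : InfLocalAlg L _) (infOverComap K w)
  let b' : ∀ w : HeightOneSpectrum (𝓞 L), w.adicCompletion L := fun w ↦
    (b (w.under (𝓞 K)) : LocalAlg L _) (overUnder K w)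
  have ha' : ∀ w, a' w ≠ 0 := fun w ↦ unit_pi_ne_zero (a _) (infOverComap K w)
  have hb' : ∀ w, b' w ≠ 0 := fun w ↦ unit_pi_ne_zero (b _) (overUnder K w)
  have hb1 : ∀ᶠ w in Filter.cofinite, Valued.v (b' w) = 1 := by
    filter_upwards [(tendsto_under_cofinite K L).eventually hb] with w hw
    exact hw (overUnder K w)
  obtain ⟨x, hx1, hx2⟩ := exists_idele ha' hb' hb1
  refine ⟨x, fun v ↦ Units.ext (funext fun w ↦ ?_), fun v ↦ Units.ext (funext fun w ↦ ?_)⟩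
  · obtain ⟨w, hw⟩ := w
    obtain rfl : w.comap (algebraMap K L) = v := comap_eq ⟨w, hw⟩
    exact hx1 w
  · obtain ⟨w, hw⟩ := w
    obtain rfl : w.under (𝓞 K) = v := under_eq ⟨w, hw⟩
    exact hx2 w

/-- The action of an automorphism on the adeles. -/
def galAdele (σ : Gal(L/K)) : AdeleRing (𝓞 L) L →* AdeleRing (𝓞 L) L where
  toFun x := (fun w ↦ galInfMap σ w (x.1 (w.comap (σ : L →+* L))),
    ⟨fun w ↦ galMap σ w (x.2 (galPlace σ w)),
      ((galPlace_injective σ).tendsto_cofinite.eventually x.2.2).mono fun w hw ↦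
        (valued_galMap σ w _).trans_le hw⟩)
  map_one' := adele_ext (fun w ↦ map_one (galInfMap σ w)) fun w ↦ map_one (galMap σ w)
  map_mul' _ _ := adele_ext (fun w ↦ map_mul (galInfMap σ w) _ _) fun w ↦ map_mul (galMap σ w) _ _

/-- The action of an automorphism on the ideles. -/
def ideleAct (σ : Gal(L/K)) : IdeleGroup L →* IdeleGroup L := Units.map (galAdele σ)

theorem localComp_ideleAct (σ : Gal(L/K)) (v : HeightOneSpectrum (𝓞 K)) (x : IdeleGroup L) :
    localComp v (ideleAct σ x) =
      Units.map (localAct σ v : LocalAlg L v →+* LocalAlg L v).toMonoidHom (localComp v x) :=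
  Units.ext rfl

theorem infLocalComp_ideleAct (σ : Gal(L/K)) (v : InfinitePlace K) (x : IdeleGroup L) :
    infLocalComp v (ideleAct σ x) = infUnitsAct σ v (infLocalComp v x) :=
  Units.ext rfl

theorem ideleAct_diagonal (σ : Gal(L/K)) (y : Lˣ) :
    ideleAct σ (diagonal L y) = diagonal L (Units.map (σ : L →* L) y) :=
  idele_ext (fun w ↦ galInfMap_algebraMap σ w y) fun w ↦ galMap_algebraMap σ w y

theorem valued_finComp_ideleAct (σ : Gal(L/K)) (x : IdeleGroup L) (w : HeightOneSpectrum (𝓞 L)) :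
    Valued.v (finComp w (ideleAct σ x : AdeleRing (𝓞 L) L)) =
      Valued.v (finComp (galPlace σ w) (x : AdeleRing (𝓞 L) L)) :=
  valued_galMap σ w _

variable (K) in
/-- The inclusion of completions at a prime of `L`. -/
def underMap (w : HeightOneSpectrum (𝓞 L)) :
    (w.under (𝓞 K)).adicCompletion K →+* w.adicCompletion L :=
  algebraMap _ ((overUnder K w).1.adicCompletion L)

variable (K) in
/-- The inclusion of completions at an infinite place of `L`. -/
def comapMap (w : InfinitePlace L) : (w.comap (algebraMap K L)).Completion →+* w.Completion :=
  algebraMap _ (infOverComap K w).1.Completion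

theorem valued_underMap_le_one (w : HeightOneSpectrum (𝓞 L))
    {x : (w.under (𝓞 K)).adicCompletion K} (hx : Valued.v x ≤ 1) :
    Valued.v (underMap K w x) ≤ 1 := by
  have : w.asIdeal.LiesOver (w.under (𝓞 K)).asIdeal := (overUnder K w).2
  exact (valued_adicCompletionMap (w.under (𝓞 K)) w x).trans_le (pow_le_one' hx _)

/-- The inclusion of the adeles of `K` into those of `L`. -/
def conormAdele : AdeleRing (𝓞 K) K →* AdeleRing (𝓞 L) L where
  toFun x := (fun w ↦ comapMap K w (x.1 _),
    ⟨fun w ↦ underMap K w (x.2 _), ((tendsto_under_cofinite K L).eventually x.2.2).mono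
      fun w hw ↦ valued_underMap_le_one w hw⟩)
  map_one' := adele_ext (fun w ↦ map_one (comapMap K w)) fun w ↦ map_one (underMap K w)
  map_mul' _ _ := adele_ext (fun w ↦ map_mul (comapMap K w) _ _)
    fun w ↦ map_mul (underMap K w) _ _

variable (K L) in
/-- The inclusion of the ideles of `K` into those of `L`. -/
def conorm : IdeleGroup K →* IdeleGroup L := Units.map conormAdele

theorem localComp_conorm (v : HeightOneSpectrum (𝓞 K)) (x : IdeleGroup K) :
    (localComp v (conorm K L x) : LocalAlg L v) =
      algebraMap (v.adicCompletion K) (LocalAlg L v) (finComp v (x : AdeleRing (𝓞 K) K)) := by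
  funext w
  obtain ⟨w, hw⟩ := w
  obtain rfl : w.under (𝓞 K) = v := under_eq ⟨w, hw⟩
  rfl

theorem infLocalComp_conorm (v : InfinitePlace K) (x : IdeleGroup K) :
    (infLocalComp v (conorm K L x) : InfLocalAlg L v) =
      algebraMap v.Completion (InfLocalAlg L v) (infComp v (x : AdeleRing (𝓞 K) K)) := by
  funext w
  obtain ⟨w, hw⟩ := w
  obtain rfl : w.comap (algebraMap K L) = v := comap_eq ⟨w, hw⟩
  rfl

theorem conorm_diagonal (y : Kˣ) :
    conorm K L (diagonal K y) = diagonal L (Units.map (algebraMap K L).toMonoidHom y) := by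
  refine idele_ext (fun w ↦ ?_) fun w ↦ ?_
  · change algebraMap (w.comap (algebraMap K L)).Completion (infOverComap K w).1.Completion
      (algebraMap K _ (y : K)) = algebraMap L (infOverComap K w).1.Completion (algebraMap K L y)
    rw [← IsScalarTower.algebraMap_apply, ← IsScalarTower.algebraMap_apply]
  · have : w.asIdeal.LiesOver (w.under (𝓞 K)).asIdeal := (overUnder K w).2
    exact adicCompletionMap_algebraMap K L (w.under (𝓞 K)) w (y : K)

theorem infComp_ideleNorm (v : InfinitePlace K) (x : IdeleGroup L) :
    infComp v (ideleNorm K L x : AdeleRing (𝓞 K) K) =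
      Algebra.norm v.Completion (infLocalComp v x : InfLocalAlg L v) := by
  rw [norm_pi_apply]
  exact prod_univ_congr _ _ _

theorem finComp_ideleNorm (v : HeightOneSpectrum (𝓞 K)) (x : IdeleGroup L) :
    finComp v (ideleNorm K L x : AdeleRing (𝓞 K) K) =
      Algebra.norm (v.adicCompletion K) (localComp v x : LocalAlg L v) :=
  prod_finiteLocalNorm v (localComp v x : LocalAlg L v)

end IdeleAction

/-! ### Fixed ideles and Hilbert 90 for ideles. -/

section IdeleModule

open scoped NumberField.LiesOver Valued

variable {K L : Type*} [Field K] [NumberField K] [Field L] [NumberField L] [Algebra K L]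
  [IsGalois K L] {σ : Gal(L/K)}

instance (v : HeightOneSpectrum (𝓞 K)) : Nontrivial (LocalAlg L v) := by
  obtain ⟨w⟩ := (inferInstance : Nonempty (PrimesOver K L v))
  exact Pi.nontrivial_at w

/-- The action of an automorphism on the units of the completions over `v`. -/
abbrev localAlgUnitsAct (σ : Gal(L/K)) (v : HeightOneSpectrum (𝓞 K)) :
    (LocalAlg L v)ˣ →* (LocalAlg L v)ˣ :=
  Units.map (localAct σ v : LocalAlg L v →+* LocalAlg L v).toMonoidHom

theorem localAlgUnitsAct_iterate_finrank (hσ : ∀ τ, τ ∈ Subgroup.zpowers σ)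
    (v : HeightOneSpectrum (𝓞 K)) (x : (LocalAlg L v)ˣ) :
    (localAlgUnitsAct σ v)^[Module.finrank K L] x = x :=
  Units.ext ((coe_iterate_units_map (localAct σ v) _ x).trans (localAct_iterate_finrank v hσ _))

theorem ideleAct_iterate_finrank (hσ : ∀ τ, τ ∈ Subgroup.zpowers σ) (x : IdeleGroup L) :
    (ideleAct σ)^[Module.finrank K L] x = x := by
  refine idele_ext_local K (fun v ↦ ?_) fun v ↦ ?_
  · rw [map_iterate_of_equivariant (infLocalComp_ideleAct σ v)]
    exact infUnitsAct_iterate_finrank v hσ _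
  · rw [map_iterate_of_equivariant (localComp_ideleAct σ v)]
    exact localAlgUnitsAct_iterate_finrank hσ v _

/-- It holds over each place of `K` by the local formula for the algebra norm. Since `conorm` is
injective, statements about the idele norm become statements about the cyclic module of ideles of
`L`. -/
theorem conorm_ideleNorm (hσ : ∀ τ, τ ∈ Subgroup.zpowers σ) (x : IdeleGroup L) :
    conorm K L (ideleNorm K L x) = cycNorm (Module.finrank K L) (ideleAct σ) x := by
  refine idele_ext_local K (fun v ↦ ?_) fun v ↦ ?_
  · have h1 := DFunLike.congr_fun
      (comp_cycNorm (Module.finrank K L) (infLocalComp_ideleAct σ v)) x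
    have h2 := cycNorm_units_map hσ (denseRange_infLocalAlg v) (infAct_algebraMap σ v)
      (infLocalComp v x)
    refine Eq.trans (Units.ext ?_) (h1.trans h2).symm
    rw [infLocalComp_conorm, infComp_ideleNorm]
    rfl
  · have h1 := DFunLike.congr_fun
      (comp_cycNorm (Module.finrank K L) (localComp_ideleAct σ v)) x
    have h2 : algebraMap (v.adicCompletion K) (LocalAlg L v)
        (Algebra.norm (v.adicCompletion K) (localComp v x : LocalAlg L v)) =
          ((cycNorm (Module.finrank K L) (localAlgUnitsAct σ v) (localComp v x) :
            (LocalAlg L v)ˣ) : LocalAlg L v) := by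
      rw [algebraMap_norm_localAlg v hσ, cycNorm_apply, Units.coe_prod]
      exact Finset.prod_congr rfl fun j _ ↦ (coe_iterate_units_map (localAct σ v) j _).symm
    refine Eq.trans (Units.ext ?_) h1.symm
    rw [localComp_conorm, finComp_ideleNorm]
    exact h2

variable (K L) in
theorem conorm_injective : Function.Injective (conorm K L) := by
  intro x y h
  refine idele_ext (fun v ↦ ?_) fun v ↦ ?_
  · apply (algebraMap v.Completion (InfLocalAlg L v)).injective
    rw [← infLocalComp_conorm, ← infLocalComp_conorm, h]
  · apply (algebraMap (v.adicCompletion K) (LocalAlg L v)).injective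
    rw [← localComp_conorm, ← localComp_conorm, h]

theorem ideleAct_conorm (σ : Gal(L/K)) (x : IdeleGroup K) :
    ideleAct σ (conorm K L x) = conorm K L x := by
  refine idele_ext_local K (fun v ↦ Units.ext ?_) fun v ↦ Units.ext ?_
  · rw [infLocalComp_ideleAct]
    change infAct σ v (infLocalComp v (conorm K L x) : InfLocalAlg L v) = _
    rw [infLocalComp_conorm, AlgHom.commutes]
  · rw [localComp_ideleAct]
    change localAct σ v (localComp v (conorm K L x) : LocalAlg L v) = _
    rw [localComp_conorm, AlgHom.commutes]

theorem exists_infComp_of_fixed (hσ : ∀ τ, τ ∈ Subgroup.zpowers σ) {x : IdeleGroup L}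
    (hx : ideleAct σ x = x) (v : InfinitePlace K) :
    ∃ a : v.Completion, (infLocalComp v x : InfLocalAlg L v) = algebraMap _ _ a := by
  refine mem_range_of_fixed hσ (denseRange_infLocalAlg v) (infAct_algebraMap σ v) ?_
  exact congrArg Units.val ((infLocalComp_ideleAct σ v x).symm.trans
    (congrArg (infLocalComp v) hx))

theorem exists_finComp_of_fixed (hσ : ∀ τ, τ ∈ Subgroup.zpowers σ) {x : IdeleGroup L}
    (hx : ideleAct σ x = x) (v : HeightOneSpectrum (𝓞 K)) :
    ∃ a : v.adicCompletion K, (localComp v x : LocalAlg L v) = algebraMap _ _ a := by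
  refine mem_range_of_fixed hσ (denseRange_localAlg v) (localAct_algebraMap σ v) ?_
  exact congrArg Units.val ((localComp_ideleAct σ v x).symm.trans
    (congrArg (localComp v) hx))

/-- Fixed elements descend place by place. The components obtained form an idele because, at almost
all `v`, a power of the valuation with the nonzero ramification index as exponent is one, hence so
is the valuation. -/
theorem exists_conorm_of_fixed (hσ : ∀ τ, τ ∈ Subgroup.zpowers σ) {x : IdeleGroup L}
    (hx : ideleAct σ x = x) : ∃ y, conorm K L y = x := by
  choose a ha using exists_infComp_of_fixed hσ hx
  choose b hb using exists_finComp_of_fixed hσ hx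
  have ha0 : ∀ v, a v ≠ 0 := by
    intro v h
    apply (infLocalComp v x).ne_zero
    rw [ha, h, map_zero]
  have hb0 : ∀ v, b v ≠ 0 := by
    intro v h
    apply (localComp v x).ne_zero
    rw [hb, h, map_zero]
  have hb1 : ∀ᶠ v in Filter.cofinite, Valued.v (b v) = 1 := by
    filter_upwards [eventually_forall_primesOver (K := K) (eventually_valued_eq_one x)] with v hv
    obtain ⟨w⟩ := (inferInstance : Nonempty (PrimesOver K L v))
    have := w.2
    have h1 : adicCompletionMap K L v w.1 (b v) = finComp w.1 (x : AdeleRing (𝓞 L) L) :=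
      (congrFun (hb v) w).symm
    have h2 := valued_adicCompletionMap v w.1 (b v)
    rw [h1, hv w] at h2
    exact (pow_eq_one_iff_of_nonneg zero_le
      (Ideal.IsDedekindDomain.ramificationIdx'_ne_zero_of_liesOver w.1.asIdeal v.ne_bot)).1 h2.symm
  obtain ⟨y, hy1, hy2⟩ := exists_idele ha0 hb0 hb1
  refine ⟨y, idele_ext_local K (fun v ↦ Units.ext ?_) fun v ↦ Units.ext ?_⟩
  · rw [infLocalComp_conorm, hy1, ha]
  · rw [localComp_conorm, hy2, hb]

theorem exists_integral_localAlg_unit (hσ : ∀ τ, τ ∈ Subgroup.zpowers σ)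
    {v : HeightOneSpectrum (𝓞 K)} (hv : IsGood (L := L) σ v) {x : (LocalAlg L v)ˣ}
    (hx : cycNorm (Module.finrank K L) (localAlgUnitsAct σ v) x = 1)
    (hx1 : ∀ w, Valued.v ((x : LocalAlg L v) w) = 1) :
    ∃ y : (LocalAlg L v)ˣ, cycDiff (localAlgUnitsAct σ v) y = x ∧
      ∀ w, Valued.v ((y : LocalAlg L v) w) = 1 := by
  let ι : (localInt L v)ˣ →* (LocalAlg L v)ˣ := Units.map (localInt L v).subtype.toMonoidHom
  have hι : ∀ u, ι (localUnitsAct σ v u) = localAlgUnitsAct σ v (ι u) := fun u ↦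
    Units.ext (coe_localActInt σ v u)
  have hinj : Function.Injective ι := Units.map_injective Subtype.val_injective
  obtain ⟨u, hu⟩ := exists_unit_localInt hx1
  have hu' : ι u = x := Units.ext hu
  have hN : cycNorm (Module.finrank K L) (localUnitsAct σ v) u = 1 := by
    apply hinj
    rw [map_one, ← hx, ← hu']
    exact DFunLike.congr_fun (comp_cycNorm (Module.finrank K L) hι) u
  obtain ⟨y, hy⟩ := hOneTrivial_localInt_units hσ hv u hN
  refine ⟨ι y, ?_, fun w ↦ valued_unit_localInt y w⟩
  rw [← hu', ← hy]
  exact (DFunLike.congr_fun (comp_cycDiff hι) y).symm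

/-- Hilbert 90 over each place gives local solutions; to assemble them into an idele they must be
integral units almost everywhere. This is arranged at the good places where `x` is a unit, which are
almost all. -/
theorem hOneTrivial_ideleAct (hσ : ∀ τ, τ ∈ Subgroup.zpowers σ) :
    HOneTrivial (Module.finrank K L) (ideleAct σ) := by
  intro x hx
  have h1 : ∀ v : InfinitePlace K, ∃ y, cycDiff (infUnitsAct σ v) y = infLocalComp v x := by
    intro v
    refine hOneTrivial_infLocalAlg_units v hσ _ ?_
    rw [← map_one (infLocalComp v), ← hx]
    exact (DFunLike.congr_fun (comp_cycNorm (Module.finrank K L) (infLocalComp_ideleAct σ v))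
      x).symm
  have h2 : ∀ v : HeightOneSpectrum (𝓞 K), ∃ y, cycDiff (localAlgUnitsAct σ v) y = localComp v x ∧
      (IsGood (L := L) σ v → (∀ w, Valued.v ((localComp v x : LocalAlg L v) w) = 1) →
        ∀ w, Valued.v ((y : LocalAlg L v) w) = 1) := by
    intro v
    have hN : cycNorm (Module.finrank K L) (localAlgUnitsAct σ v) (localComp v x) = 1 := by
      rw [← map_one (localComp v), ← hx]
      exact (DFunLike.congr_fun (comp_cycNorm (Module.finrank K L) (localComp_ideleAct σ v))
        x).symm
    by_cases hv : IsGood (L := L) σ v ∧ ∀ w, Valued.v ((localComp v x : LocalAlg L v) w) = 1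
    · obtain ⟨y, hy, hy1⟩ := exists_integral_localAlg_unit hσ hv.1 hN hv.2
      exact ⟨y, hy, fun _ _ ↦ hy1⟩
    · obtain ⟨y, hy⟩ := hOneTrivial_localAlg_units v hσ _ hN
      exact ⟨y, hy, fun h h' ↦ (hv ⟨h, h'⟩).elim⟩
  choose a ha using h1
  choose b hb hb1 using h2
  obtain ⟨y, hy1, hy2⟩ := exists_idele_local a b (by
    filter_upwards [eventually_isGood hσ,
      eventually_forall_primesOver (K := K) (eventually_valued_eq_one x)] with v h h'
    exact hb1 v h h')
  refine ⟨y, idele_ext_local K (fun v ↦ ?_) fun v ↦ ?_⟩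
  · rw [← ha, ← hy1]
    exact DFunLike.congr_fun (comp_cycDiff (infLocalComp_ideleAct σ v)) y
  · rw [← hb, ← hy2]
    exact DFunLike.congr_fun (comp_cycDiff (localComp_ideleAct σ v)) y

end IdeleModule

/-! ### The Herbrand quotient of the idele class group. -/

section ClassModule

open scoped NumberField.LiesOver

theorem HerbrandQuot.of_mulEquiv {n : ℕ} {M M' : Type*} [CommGroup M] [CommGroup M'] {s : M →* M}
    {s' : M' →* M'} (e : M ≃* M') (h : ∀ x, e (s x) = s' (e x)) (hs : ∀ x, s^[n] x = x) {q : ℚ}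
    (hq : HerbrandQuot n s q) : HerbrandQuot n s' q := by
  have hr : e.toMonoidHom.range = ⊤ := MonoidHom.range_eq_top.2 e.surjective
  have hfin : e.toMonoidHom.range.FiniteIndex := by
    rw [hr]
    infer_instance
  have hu : HerbrandQuot n (1 : Unit →* Unit) 1 :=
    HerbrandQuot.of_trivial (fun x _ ↦ ⟨x, Subsingleton.elim _ _⟩)
      fun x _ ↦ ⟨x, Subsingleton.elim _ _⟩
  have := HerbrandQuot.of_finiteIndex_range (i := (1 : Unit →* M)) (φ := e.toMonoidHom)
    (Function.injective_of_subsingleton _)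
    (by
      ext x
      constructor
      · intro hx
        exact ⟨1, (e.map_eq_one_iff.1 hx).symm⟩
      · rintro ⟨_, rfl⟩
        exact map_one e) (fun x ↦ (map_one s).symm) h hs
    (iterate_eq_of_surjective (φ := e.toMonoidHom) e.surjective h hs) hu hq
  rwa [div_one] at this

variable {K L : Type*} [Field K] [NumberField K] [Field L] [NumberField L] [Algebra K L]

theorem ideleAct_mem_unitIdeles (σ : Gal(L/K)) : ∀ x ∈ unitIdeles L, ideleAct σ x ∈ unitIdeles L :=
  fun x hx w ↦ (valued_finComp_ideleAct σ x w).trans (hx _)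

variable (K L) in
/-- The group of all units of the integral local components. -/
abbrev LocalUnits : Type _ :=
  (∀ v : InfinitePlace K, (InfLocalAlg L v)ˣ) × ∀ v : HeightOneSpectrum (𝓞 K), (localInt L v)ˣ

/-- The action of an automorphism on `LocalUnits`. -/
abbrev localUnitsPi (σ : Gal(L/K)) : LocalUnits K L →* LocalUnits K L :=
  (MonoidHom.piMap fun v ↦ infUnitsAct σ v).prodMap (MonoidHom.piMap fun v ↦ localUnitsAct σ v)

/-- The integral components over `v` of an idele which is a unit at all finite places. -/
def unitComp (v : HeightOneSpectrum (𝓞 K)) : unitIdeles L →* (localInt L v)ˣ :=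
  MonoidHom.toHomUnits
    { toFun := fun x ↦ ⟨fun w ↦ finComp w.1 ((x : IdeleGroup L) : AdeleRing (𝓞 L) L),
        fun w ↦ (x.2 w.1).le⟩
      map_one' := rfl
      map_mul' := fun _ _ ↦ rfl }

variable (K L) in
/-- The local components of the ideles which are units at all finite places. -/
def unitIdelesComp : unitIdeles L →* LocalUnits K L :=
  (MonoidHom.pi fun v ↦ (infLocalComp v).comp (unitIdeles L).subtype).prod (MonoidHom.pi unitComp)

variable (K L) in
theorem unitIdelesComp_bijective : Function.Bijective (unitIdelesComp K L) := by
  constructor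
  · intro x y h
    refine Subtype.ext (idele_ext_local K (fun v ↦ congrFun (congrArg Prod.fst h) v) fun v ↦ ?_)
    exact Units.ext (congrArg (fun u : (localInt L v)ˣ ↦ ((u : localInt L v) : LocalAlg L v))
      (congrFun (congrArg Prod.snd h) v))
  · rintro ⟨a, b⟩
    obtain ⟨x, hx1, hx2⟩ := exists_idele_local a
      (fun v ↦ Units.map (localInt L v).subtype.toMonoidHom (b v))
      (Filter.Eventually.of_forall fun v w ↦ valued_unit_localInt (b v) w)
    refine ⟨⟨x, fun w ↦ ?_⟩, Prod.ext (funext hx1) (funext fun v ↦ Units.ext (Subtype.ext ?_))⟩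
    · have h := congrFun (congrArg Units.val (hx2 (w.under (𝓞 K)))) (overUnder K w)
      have h' : finComp w (x : AdeleRing (𝓞 L) L) =
          ((b (w.under (𝓞 K)) : localInt L (w.under (𝓞 K))) : LocalAlg L (w.under (𝓞 K)))
            (overUnder K w) := h
      rw [h']
      exact valued_unit_localInt (b _) (overUnder K w)
    · exact congrArg Units.val (hx2 v)

theorem unitIdelesComp_restrictEnd (σ : Gal(L/K)) (x : unitIdeles L) :
    unitIdelesComp K L (restrictEnd (ideleAct σ) _ (ideleAct_mem_unitIdeles σ) x) =
      localUnitsPi σ (unitIdelesComp K L x) :=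
  Prod.ext (funext fun v ↦ infLocalComp_ideleAct σ v x)
    (funext fun _ ↦ Units.ext (Subtype.ext rfl))

variable (L) in
/-- The global units, as ideles. -/
def unitDiagonal : (𝓞 L)ˣ →* unitIdeles L :=
  ((diagonal L).comp (Units.map (algebraMap (𝓞 L) L).toMonoidHom)).codRestrict (unitIdeles L)
    fun u w ↦ by
      refine (HeightOneSpectrum.valuedAdicCompletion_eq_valuation' w _).trans ?_
      have h := HeightOneSpectrum.valuation_of_unit_eq (K := L) w u
      rw [← WithZero.coe_inj, HeightOneSpectrum.valuationOfNeZero_eq] at h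
      exact h

variable (L) in
theorem unitDiagonal_injective : Function.Injective (unitDiagonal L) := by
  intro u u' h
  obtain ⟨w⟩ := (inferInstance : Nonempty (InfinitePlace L))
  have h1 := congrArg (fun x : unitIdeles L ↦ infComp w ((x : IdeleGroup L) : AdeleRing (𝓞 L) L)) h
  exact Units.ext (RingOfIntegers.coe_injective ((algebraMap L w.Completion).injective h1))

/-- The idele class group. -/
def IdeleClass (L : Type*) [Field L] [NumberField L] : Type _ :=
  IdeleGroup L ⧸ principalIdeles L

instance : CommGroup (IdeleClass L) :=
  inferInstanceAs (CommGroup (IdeleGroup L ⧸ principalIdeles L))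

variable (L) in
/-- The class of an idele. -/
def ideleClass : IdeleGroup L →* IdeleClass L := QuotientGroup.mk' (principalIdeles L)

variable (L) in
theorem ideleClass_surjective : Function.Surjective (ideleClass L) :=
  QuotientGroup.mk'_surjective (principalIdeles L)

variable (L) in
theorem ker_ideleClass : (ideleClass L).ker = principalIdeles L :=
  QuotientGroup.ker_mk' (principalIdeles L)

theorem principalIdeles_le_comap (σ : Gal(L/K)) :
    principalIdeles L ≤ (principalIdeles L).comap (ideleAct σ) := by
  rintro _ ⟨y, rfl⟩
  exact ⟨_, (ideleAct_diagonal σ y).symm⟩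

/-- The action of an automorphism on the idele class group. -/
def classAct (σ : Gal(L/K)) : IdeleClass L →* IdeleClass L :=
  QuotientGroup.map _ _ (ideleAct σ) (principalIdeles_le_comap σ)

theorem ideleClass_ideleAct (σ : Gal(L/K)) (x : IdeleGroup L) :
    ideleClass L (ideleAct σ x) = classAct σ (ideleClass L x) := rfl

variable (L) in
/-- The ideles which are units at all finite places, modulo principal ideles. -/
def unitClass : unitIdeles L →* IdeleClass L :=
  (ideleClass L).comp (unitIdeles L).subtype

variable (L) in
-- An element of the field with valuation one at every prime is integral together with its inverse.
theorem ker_unitClass : (unitClass L).ker = (unitDiagonal L).range := by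
  ext x
  have h : x ∈ (unitClass L).ker ↔ (x : IdeleGroup L) ∈ principalIdeles L :=
    QuotientGroup.eq_one_iff _
  rw [h]
  constructor
  · rintro ⟨y, hy⟩
    have hval : ∀ w : HeightOneSpectrum (𝓞 L), w.valuation L (y : L) = 1 := by
      intro w
      rw [← x.2 w, ← hy]
      exact (HeightOneSpectrum.valuedAdicCompletion_eq_valuation' w _).symm
    obtain ⟨a, ha⟩ := HeightOneSpectrum.mem_integers_of_valuation_le_one L (y : L)
      fun w ↦ (hval w).le
    obtain ⟨b, hb⟩ := HeightOneSpectrum.mem_integers_of_valuation_le_one L ((y⁻¹ : Lˣ) : L)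
      fun w ↦ by rw [Units.val_inv_eq_inv_val, map_inv₀, hval w, inv_one]
    have hab : a * b = 1 := by
      apply RingOfIntegers.coe_injective
      rw [map_mul, ha, hb, map_one, Units.mul_inv]
    refine ⟨⟨a, b, hab, (mul_comm b a).trans hab⟩, Subtype.ext ?_⟩
    rw [← hy]
    exact congrArg (diagonal L) (Units.ext ha)
  · rintro ⟨u, rfl⟩
    exact ⟨_, rfl⟩

variable (L) in
theorem finiteIndex_range_unitClass : (unitClass L).range.FiniteIndex := by
  have h : (unitClass L).range.comap (ideleClass L) =
      principalIdeles L ⊔ unitIdeles L := by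
    rw [unitClass, MonoidHom.range_comp, Subgroup.range_subtype, Subgroup.comap_map_eq,
      ker_ideleClass, sup_comm]
  refine ⟨?_⟩
  rw [← Subgroup.index_comap_of_surjective _ (ideleClass_surjective L), h]
  exact (finiteIndex_principalIdeles_sup_unitIdeles L).index_ne_zero

variable [IsGalois K L] {σ : Gal(L/K)}

theorem localUnitsPi_iterate_finrank (hσ : ∀ τ, τ ∈ Subgroup.zpowers σ) (x : LocalUnits K L) :
    (localUnitsPi σ)^[Module.finrank K L] x = x := by
  have h : ∀ (j : ℕ) (x : LocalUnits K L), (localUnitsPi σ)^[j] x =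
      ((MonoidHom.piMap fun v ↦ infUnitsAct σ v)^[j] x.1,
        (MonoidHom.piMap fun v ↦ localUnitsAct σ v)^[j] x.2) := by
    intro j
    induction j with
    | zero => exact fun _ ↦ rfl
    | succ j ih => exact fun x ↦ ih _
  rw [h]
  refine Prod.ext (funext fun v ↦ ?_) (funext fun v ↦ ?_)
  · exact (iterate_piMap_apply _ _ _ v).trans (infUnitsAct_iterate_finrank v hσ _)
  · exact (iterate_piMap_apply _ _ _ v).trans (localUnitsAct_iterate_finrank hσ v _)

theorem herbrandQuot_localUnitsPi (hσ : ∀ τ, τ ∈ Subgroup.zpowers σ) :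
    HerbrandQuot (Module.finrank K L) (localUnitsPi (L := L) σ)
      (∏ v : InfinitePlace K, (Module.finrank K L / Nat.card (InfOver K L v) : ℚ)) := by
  have h := herbrandQuot_prod (s := MonoidHom.piMap fun v ↦ infUnitsAct (L := L) σ v)
    (s' := MonoidHom.piMap fun v ↦ localUnitsAct (L := L) σ v)
    (fun x ↦ funext fun v ↦
      (iterate_piMap_apply _ _ _ v).trans (infUnitsAct_iterate_finrank v hσ _))
    (fun x ↦ funext fun v ↦
      (iterate_piMap_apply _ _ _ v).trans (localUnitsAct_iterate_finrank hσ v _))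
    (HerbrandQuot.pi fun v ↦ herbrandQuot_infLocalAlg_units v hσ)
    (herbrandQuot_pi_localInt_units hσ)
  rwa [mul_one] at h

theorem herbrandQuot_unitIdeles (hσ : ∀ τ, τ ∈ Subgroup.zpowers σ) :
    HerbrandQuot (Module.finrank K L)
      (restrictEnd (ideleAct σ) _ (ideleAct_mem_unitIdeles σ))
      (∏ v : InfinitePlace K, (Module.finrank K L / Nat.card (InfOver K L v) : ℚ)) := by
  let e := MulEquiv.ofBijective (unitIdelesComp K L) (unitIdelesComp_bijective K L)
  refine (herbrandQuot_localUnitsPi hσ).of_mulEquiv e.symm (fun x ↦ ?_)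
    (localUnitsPi_iterate_finrank hσ)
  obtain ⟨y, rfl⟩ := e.surjective x
  apply e.injective
  rw [e.apply_symm_apply, e.symm_apply_apply]
  exact (unitIdelesComp_restrictEnd σ y).symm

theorem classAct_iterate_finrank (hσ : ∀ τ, τ ∈ Subgroup.zpowers σ) (x : IdeleClass L) :
    (classAct σ)^[Module.finrank K L] x = x :=
  iterate_eq_of_surjective (ideleClass_surjective L) (ideleClass_ideleAct σ)
    (ideleAct_iterate_finrank hσ) x

theorem unitDiagonal_galUnits (σ : Gal(L/K)) (u : (𝓞 L)ˣ) :
    unitDiagonal L (galUnits σ u) =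
      restrictEnd (ideleAct σ) _ (ideleAct_mem_unitIdeles σ) (unitDiagonal L u) :=
  Subtype.ext (ideleAct_diagonal σ (Units.map (algebraMap (𝓞 L) L).toMonoidHom u)).symm

theorem unitClass_restrictEnd (σ : Gal(L/K)) (x : unitIdeles L) :
    unitClass L (restrictEnd (ideleAct σ) _ (ideleAct_mem_unitIdeles σ) x) =
      classAct σ (unitClass L x) := rfl

theorem unitIdeles_iterate_finrank (hσ : ∀ τ, τ ∈ Subgroup.zpowers σ) (x : unitIdeles L) :
    (restrictEnd (ideleAct σ) _ (ideleAct_mem_unitIdeles σ))^[Module.finrank K L] x = x :=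
  iterate_eq_of_injective (φ := (unitIdeles L).subtype) Subtype.val_injective
    (fun _ ↦ rfl) (ideleAct_iterate_finrank hσ) x

theorem herbrandQuot_classAct (hσ : ∀ τ, τ ∈ Subgroup.zpowers σ) :
    HerbrandQuot (Module.finrank K L) (classAct σ) (Module.finrank K L) := by
  have := finiteIndex_range_unitClass L
  have hA := herbrandQuot_units (L := L) hσ
  have hB := herbrandQuot_unitIdeles (L := L) hσ
  have h := HerbrandQuot.of_finiteIndex_range (unitDiagonal_injective L) (ker_unitClass L)
    (unitDiagonal_galUnits σ) (unitClass_restrictEnd σ) (unitIdeles_iterate_finrank hσ)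
    (classAct_iterate_finrank hσ) hA hB
  have hne := hB.ne_zero
  -- The product of the local degrees at infinity occurs both for the unit ideles and for the global
  -- units, and cancels.
  have e := div_div_cancel₀ (b := (Module.finrank K L : ℚ)) hne
  exact e ▸ h

end ClassModule

/-! ### Translation of the two indices from the class group of `L` to the ideles of `K`. -/

section Indices

variable {K L : Type*} [Field K] [NumberField K] [Field L] [NumberField L] [Algebra K L]
  [IsGalois K L] {σ : Gal(L/K)}

variable (L) in
theorem diagonal_injective : Function.Injective (diagonal L) := by
  intro y y' h
  obtain ⟨w⟩ := (inferInstance : Nonempty (InfinitePlace L))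
  have h1 := congrArg (fun x : IdeleGroup L ↦ infComp w (x : AdeleRing (𝓞 L) L)) h
  exact Units.ext ((algebraMap L w.Completion).injective h1)

theorem coe_iterate_galois (σ : Gal(L/K)) (j : ℕ) (y : Lˣ) :
    (((Units.map (σ : L →* L))^[j] y : Lˣ) : L) = σ^[j] (y : L) := by
  induction j with
  | zero => rfl
  | succ j ih =>
    rw [Function.iterate_succ_apply', Function.iterate_succ_apply', ← ih]
    rfl

/-- Hilbert's Theorem 90 for a cyclic extension with generator `σ`. -/
theorem hOneTrivial_galois (hσ : ∀ τ, τ ∈ Subgroup.zpowers σ) :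
    HOneTrivial (Module.finrank K L) (Units.map (σ : L →* L)) := by
  refine hOneTrivial_units_of_residues (s := (σ : L →+* L)) (ι := Unit) Module.finrank_pos
    (fun _ ↦ RingHom.id L) (fun x hx ↦ (hx ()).isUnit) (e := id) (fun _ _ ↦ ⟨0, rfl⟩)
    (fun x _ ↦ map_eq_zero (σ : L →+* L)) (iterate_finrank hσ) () fun i hi j hj hij ↦
      exists_iterate_ne hσ hi hj hij

theorem cycNorm_diagonal (hσ : ∀ τ, τ ∈ Subgroup.zpowers σ) (y : Lˣ) :
    cycNorm (Module.finrank K L) (ideleAct σ) (diagonal L y) =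
      conorm K L (diagonal K (Units.map (Algebra.norm K : L →* K) y)) := by
  have h := DFunLike.congr_fun (comp_cycNorm (Module.finrank K L)
    (s := Units.map (σ : L →* L)) (φ := diagonal L) fun y ↦ (ideleAct_diagonal σ y).symm) y
  refine h.symm.trans ?_
  rw [conorm_diagonal]
  refine congrArg (diagonal L) (Units.ext ?_)
  rw [cycNorm_apply, Units.coe_prod]
  refine (Finset.prod_congr rfl fun j _ ↦ coe_iterate_galois σ j y).trans ?_
  exact (algebraMap_norm_eq_prod_iterate hσ (y : L)).symm

theorem ideleNorm_diagonal (hσ : ∀ τ, τ ∈ Subgroup.zpowers σ) (y : Lˣ) :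
    ideleNorm K L (diagonal L y) = diagonal K (Units.map (Algebra.norm K : L →* K) y) :=
  conorm_injective K L ((conorm_ideleNorm hσ _).trans (cycNorm_diagonal hσ y))

theorem map_ideleNorm_principalIdeles (hσ : ∀ τ, τ ∈ Subgroup.zpowers σ) :
    (principalIdeles L).map (ideleNorm K L) = fieldNormSubgroup K L := by
  rw [principalIdeles, fieldNormSubgroup, MonoidHom.map_range, MonoidHom.map_range]
  exact congrArg MonoidHom.range (MonoidHom.ext (ideleNorm_diagonal hσ))

theorem fieldNormSubgroup_le (hσ : ∀ τ, τ ∈ Subgroup.zpowers σ) :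
    fieldNormSubgroup K L ≤ principalIdeles K ⊓ ideleNormSubgroup K L := by
  refine le_inf (Subgroup.map_le_range _ _) ?_
  rw [← map_ideleNorm_principalIdeles hσ]
  exact Subgroup.map_le_range _ _

/-- An element of `L` whose diagonal idele comes from `K` is fixed by `σ`, hence lies in `K`. -/
theorem conorm_mem_principalIdeles (hσ : ∀ τ, τ ∈ Subgroup.zpowers σ) {a : IdeleGroup K} :
    conorm K L a ∈ principalIdeles L ↔ a ∈ principalIdeles K := by
  constructor
  · rintro ⟨y, hy⟩
    have h1 : Units.map (σ : L →* L) y = y := by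
      apply diagonal_injective L
      rw [← ideleAct_diagonal, hy, ideleAct_conorm]
    have h2 : σ (y : L) = y := congrArg Units.val h1
    have h3 : ∀ j : ℕ, σ^[j] (y : L) = y := fun j ↦ Function.iterate_fixed h2 j
    obtain ⟨k, hk⟩ := (IsGalois.mem_range_algebraMap_iff_fixed (F := K) (y : L)).2 fun τ ↦ by
      obtain ⟨j, hj⟩ := exists_iterate_eq hσ τ
      rw [hj, h3]
    have hk0 : k ≠ 0 := by
      rintro rfl
      exact y.ne_zero (by rw [← hk, map_zero])
    refine ⟨Units.mk0 k hk0, conorm_injective K L ?_⟩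
    rw [conorm_diagonal, ← hy]
    exact congrArg (diagonal L) (Units.ext hk)
  · rintro ⟨k, rfl⟩
    exact ⟨_, (conorm_diagonal k).symm⟩

theorem ideleClass_eq_one {x : IdeleGroup L} :
    ideleClass L x = 1 ↔ x ∈ principalIdeles L := by
  rw [← MonoidHom.mem_ker, ker_ideleClass]

theorem ideleClass_cycNorm (hσ : ∀ τ, τ ∈ Subgroup.zpowers σ) (x : IdeleGroup L) :
    cycNorm (Module.finrank K L) (classAct σ) (ideleClass L x) =
      ideleClass L (conorm K L (ideleNorm K L x)) := by
  rw [conorm_ideleNorm hσ]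
  exact (DFunLike.congr_fun (comp_cycNorm (Module.finrank K L) (ideleClass_ideleAct σ)) x).symm

/-- If the class of `x` is fixed, `σ x / x` is principal of norm one, so by Hilbert 90 it is `σ t /
t` with `t` in `L^*`. Then `x / t` is a fixed idele in the same class. -/
theorem range_ideleClass_conorm (hσ : ∀ τ, τ ∈ Subgroup.zpowers σ) :
    ((ideleClass L).comp (conorm K L)).range = (cycDiff (classAct σ)).ker := by
  ext z
  rw [mem_ker_cycDiff]
  constructor
  · rintro ⟨a, rfl⟩
    rw [MonoidHom.comp_apply, ← ideleClass_ideleAct, ideleAct_conorm]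
  · intro hz
    obtain ⟨x, rfl⟩ := ideleClass_surjective L z
    obtain ⟨y, hy⟩ : ideleAct σ x / x ∈ principalIdeles L := by
      rw [← ideleClass_eq_one, map_div, ideleClass_ideleAct, hz, div_self']
    have h1 : cycNorm (Module.finrank K L) (ideleAct σ) (diagonal L y) = 1 := by
      rw [hy]
      exact DFunLike.congr_fun (cycNorm_comp_cycDiff (ideleAct_iterate_finrank hσ)) x
    obtain ⟨t, ht⟩ := hOneTrivial_galois hσ y (diagonal_injective L (by
      rw [map_one, ← h1]
      exact DFunLike.congr_fun (comp_cycNorm (Module.finrank K L) (s := Units.map (σ : L →* L))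
        (φ := diagonal L) fun y ↦ (ideleAct_diagonal σ y).symm) y))
    have h2 : ideleAct σ x = x * (diagonal L (Units.map (σ : L →* L) t) / diagonal L t) := by
      rw [← map_div, ← cycDiff_apply, ht, hy, mul_div_cancel]
    obtain ⟨a, ha⟩ := exists_conorm_of_fixed hσ (x := x / diagonal L t) (by
      rw [map_div, ideleAct_diagonal, h2, mul_div_assoc, div_div_cancel_left, div_eq_mul_inv])
    refine ⟨a, ?_⟩
    rw [MonoidHom.comp_apply, ha, map_div, ideleClass_eq_one.2 ⟨t, rfl⟩, div_one]

theorem comap_range_cycNorm_classAct (hσ : ∀ τ, τ ∈ Subgroup.zpowers σ) :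
    (cycNorm (Module.finrank K L) (classAct σ)).range.comap ((ideleClass L).comp (conorm K L)) =
      principalIdeles K ⊔ ideleNormSubgroup K L := by
  ext a
  constructor
  · rintro ⟨z, hz⟩
    obtain ⟨x, rfl⟩ := ideleClass_surjective L z
    rw [ideleClass_cycNorm hσ, MonoidHom.comp_apply, eq_comm, ← div_eq_one, ← map_div, ← map_div,
      ideleClass_eq_one, conorm_mem_principalIdeles hσ] at hz
    rw [← div_mul_cancel a (ideleNorm K L x)]
    exact Subgroup.mul_mem_sup hz ⟨x, rfl⟩
  · intro ha
    obtain ⟨y, hy, _, ⟨x, rfl⟩, rfl⟩ := Subgroup.mem_sup.1 ha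
    refine ⟨ideleClass L x, ?_⟩
    rw [ideleClass_cycNorm hσ, MonoidHom.comp_apply, map_mul, map_mul,
      ideleClass_eq_one.2 ((conorm_mem_principalIdeles hσ).2 hy), one_mul]

theorem relIndex_range_cycNorm_classAct (hσ : ∀ τ, τ ∈ Subgroup.zpowers σ) :
    (cycNorm (Module.finrank K L) (classAct σ)).range.relIndex (cycDiff (classAct σ)).ker =
      (principalIdeles K ⊔ ideleNormSubgroup K L).index := by
  rw [← range_ideleClass_conorm hσ, ← Subgroup.index_comap, comap_range_cycNorm_classAct hσ]

theorem ker_ideleNorm (hσ : ∀ τ, τ ∈ Subgroup.zpowers σ) :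
    (ideleNorm K L).ker = (cycDiff (ideleAct σ)).range := by
  ext x
  have h : x ∈ (ideleNorm K L).ker ↔ cycNorm (Module.finrank K L) (ideleAct σ) x = 1 := by
    rw [← conorm_ideleNorm hσ, MonoidHom.mem_ker, ← (conorm_injective K L).eq_iff, map_one]
  rw [h]
  constructor
  · exact hOneTrivial_ideleAct hσ x
  · rintro ⟨y, rfl⟩
    exact DFunLike.congr_fun (cycNorm_comp_cycDiff (ideleAct_iterate_finrank hσ)) y

theorem ker_cycNorm_classAct (hσ : ∀ τ, τ ∈ Subgroup.zpowers σ) :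
    (cycNorm (Module.finrank K L) (classAct σ)).ker =
      ((principalIdeles K).comap (ideleNorm K L)).map (ideleClass L) := by
  have h : ∀ x, ideleClass L x ∈ (cycNorm (Module.finrank K L) (classAct σ)).ker ↔
      ideleNorm K L x ∈ principalIdeles K := fun x ↦ by
    rw [MonoidHom.mem_ker, ideleClass_cycNorm hσ, ideleClass_eq_one, conorm_mem_principalIdeles hσ]
  ext z
  constructor
  · intro hz
    obtain ⟨x, rfl⟩ := ideleClass_surjective L z
    exact ⟨x, (h x).1 hz, rfl⟩
  · rintro ⟨x, hx, rfl⟩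
    exact (h x).2 hx

theorem range_cycDiff_classAct (σ : Gal(L/K)) :
    (cycDiff (classAct σ)).range = (cycDiff (ideleAct σ)).range.map (ideleClass L) := by
  rw [MonoidHom.map_range, comp_cycDiff (ideleClass_ideleAct σ), MonoidHom.range_comp,
    MonoidHom.range_eq_top.2 (ideleClass_surjective L), MonoidHom.range_eq_map]

/-- Both indices equal the index of `L^* · ker N` in the group of ideles whose norm is principal:
one by passing to classes, where `ker N` is `im D` by Hilbert 90 for ideles, the other by applying
the idele norm. -/
theorem relIndex_range_cycDiff_classAct (hσ : ∀ τ, τ ∈ Subgroup.zpowers σ) :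
    (cycDiff (classAct σ)).range.relIndex (cycNorm (Module.finrank K L) (classAct σ)).ker =
      (fieldNormSubgroup K L).relIndex (principalIdeles K ⊓ ideleNormSubgroup K L) := by
  have h1 : principalIdeles L ≤ (principalIdeles K).comap (ideleNorm K L) := by
    rintro _ ⟨y, rfl⟩
    exact ⟨_, (ideleNorm_diagonal hσ y).symm⟩
  have h2 : (ideleNorm K L).ker ≤ (principalIdeles K).comap (ideleNorm K L) :=
    Subgroup.ker_le_comap _ _
  have h3 : principalIdeles K ⊓ ideleNormSubgroup K L =
      ((principalIdeles K).comap (ideleNorm K L)).map (ideleNorm K L) := by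
    rw [Subgroup.map_comap_eq, inf_comm, ideleNormSubgroup]
  rw [range_cycDiff_classAct, ker_cycNorm_classAct hσ, Subgroup.relIndex_map_map, ker_ideleClass,
    sup_eq_left.2 h1, h3, ← map_ideleNorm_principalIdeles hσ, Subgroup.relIndex_map_map,
    sup_eq_left.2 h2, ker_ideleNorm hσ, sup_comm]

theorem index_norms (hσ : ∀ τ, τ ∈ Subgroup.zpowers σ) :
    (principalIdeles K ⊔ ideleNormSubgroup K L).index ≠ 0 ∧
      (fieldNormSubgroup K L).relIndex (principalIdeles K ⊓ ideleNormSubgroup K L) ≠ 0 ∧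
      ((principalIdeles K ⊔ ideleNormSubgroup K L).index : ℚ) /
        ((fieldNormSubgroup K L).relIndex (principalIdeles K ⊓ ideleNormSubgroup K L) : ℚ) =
          (Module.finrank K L : ℚ) := by
  obtain ⟨h0, h1, h2⟩ := herbrandQuot_classAct (L := L) hσ
  rw [relIndex_range_cycNorm_classAct hσ] at h0 h2
  rw [relIndex_range_cycDiff_classAct hσ] at h1 h2
  exact ⟨h0, h1, h2⟩

end Indices

end NormIndex

end

theorem mainTheorem1 (K L : Type*) [Field K] [NumberField K] [Field L] [NumberField L]
    [Algebra K L] [IsGalois K L] [IsCyclic Gal(L/K)] :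
    NormIndex.fieldNormSubgroup K L ≤
        NormIndex.principalIdeles K ⊓ NormIndex.ideleNormSubgroup K L ∧
      (NormIndex.principalIdeles K ⊔ NormIndex.ideleNormSubgroup K L).FiniteIndex ∧
      (NormIndex.fieldNormSubgroup K L).IsFiniteRelIndex
        (NormIndex.principalIdeles K ⊓ NormIndex.ideleNormSubgroup K L) ∧
      ((NormIndex.principalIdeles K ⊔ NormIndex.ideleNormSubgroup K L).index : ℚ) /
          ((NormIndex.fieldNormSubgroup K L).relIndex
            (NormIndex.principalIdeles K ⊓ NormIndex.ideleNormSubgroup K L) : ℚ) =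
        (Module.finrank K L : ℚ) ∧
      Module.finrank K L ≤
        (NormIndex.principalIdeles K ⊔ NormIndex.ideleNormSubgroup K L).index := by
  obtain ⟨σ, hσ⟩ := IsCyclic.exists_generator (α := Gal(L/K))
  obtain ⟨h0, h1, h2⟩ := NormIndex.index_norms hσ
  refine ⟨NormIndex.fieldNormSubgroup_le hσ, ⟨h0⟩, ⟨h1⟩, h2, ?_⟩
  rw [div_eq_iff (Nat.cast_ne_zero.2 h1)] at h2
  -- The rational identity, cleared of its denominator, shows the idele index to be a positive
  -- multiple of the degree.
  have h3 : (NormIndex.principalIdeles K ⊔ NormIndex.ideleNormSubgroup K L).index =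
      Module.finrank K L * (NormIndex.fieldNormSubgroup K L).relIndex
        (NormIndex.principalIdeles K ⊓ NormIndex.ideleNormSubgroup K L) := by
    exact_mod_cast h2
  rw [h3]
  exact Nat.le_mul_of_pos_right _ (Nat.pos_of_ne_zero h1)
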